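/- All algebras are unital and over $\mathbb C$. A *dga* is a graded algebra $\Omega\mathcal A=\bigoplus_{k\ge 0}\Omega^k\mathcal A$, $\mathcal A=\Omega^0\mathcal A$, with a $\mathbb C$-linear $d$ of degree $+1$, $d^2=0$, $d(\alpha\beta)=d\alpha\,\beta+(-1)^{|\alpha|}\alpha\,d\beta$. For a graded $\Omega\mathcal A$-bimodule $\Omega\mathcal E=\bigoplus_{k\ge0}\Omega^k\mathcal E$, the graded centre $Z_g(\Omega\mathcal E)$ is the set of $\epsilon$ whose graded commutators $[\nu,\epsilon]$, $\nu\in\Omega\mathcal A$, vanish; its degree-zero part is written $Z_g(\mathcal E)$. In particular $Z_g(\Omega\mathcal A)$ is a sub-dga of $\Omega\mathcal A$. *dg-Morita equivalence.* $\mathrm{Mod}^{dg}_{\Omega\mathcal A}$ is the category of ($\mathbb Z$-graded) differential graded right $\Omega\mathcal A$-modules with all graded right module morphisms (sums of homogeneous morphisms of any degree), and $df=d\circ f-(-1)^{|f|}f\circ d$. Two dga's are dg-Morita equivalent if there is a $\mathbb C$-linear functor between these categories which preserves the degrees of morphisms, commutes with their differentials, and is an equivalence of categories. *Property Q.* Suppose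 that the degree-zero part $\mathcal Z$ of a dga $\Omega\mathcal Z$ is contained as a dense unital $*$-subalgebra in a unital $C^*$-algebra $Z$, and that elements of $\mathcal Z$ invertible in $Z$ are invertible in $\mathcal Z$. Then $\Omega\mathcal Z$ satisfies property Q if, for all $a\in\mathcal Z$ with $a\ge0$, all $a_1,\dots,a_s\in\mathcal Z$ with $|a_i|\le a$ and all $\omega_1,\dots,\omega_s\in\Omega^1\mathcal Z$, the equation $da=\sum_i a_i\omega_i$ implies that $a=0$ or $a$ is invertible. Write $\widehat{\mathcal Z}$ for the Gelfand spectrum (the characters) of $Z$. *Fundamental group.* $\mathcal C_\flat(\Omega\mathcal A)$ is the category of graded bimodules $\Omega\mathcal E$ that are direct summands of some $(\Omega\mathcal A)^n$ as graded bimodules, with a $\mathbb C$-linear $\nabla$ of degree $+1$ satisfying $\nabla^2=0$ and the left and right Leibniz rules; morphisms are bimodule maps of degree $0$ commuting with $\nabla$. It is a tensor category under $\otimes_{\Omega\mathcal A}$ with unit $(\Omega\mathcal A,d)$. For $p\in\widehat{Z_g(\mathcal A)}$ the fibre functor is $\omega_p(\Omega\mathcal E)=Z_g(\mathcal E)\otimes_{Z_g(\mathcal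 A)}\mathbb C$, where $Z_g(\mathcal A)$ acts on $\mathbb C$ through $p$. The fundamental group $\pi^1(\Omega\mathcal A,p)$ is the group functor on commutative $\mathbb C$-algebras $R\mapsto \mathrm{Aut}^\otimes(R\otimes\omega_p)$ of $R$-linear tensor automorphisms of $\omega_p$ with coefficients extended to $R$. For a dga morphism $\phi:Z_g(\Omega\mathcal A)\to Z_g(\Omega\mathcal B)$ and $q\in\widehat{Z_g(\mathcal B)}$, $p\in\widehat{Z_g(\mathcal A)}$ with $p=q\circ\phi$ on $Z_g(\mathcal A)$, the induced map $\pi^1\phi:\pi^1(\Omega\mathcal B,q)\to\pi^1(\Omega\mathcal A,p)$ pulls automorphisms back along base change $\Omega\mathcal E\mapsto Z_g(\Omega\mathcal E)\otimes_{Z_g(\Omega\mathcal A),\phi}\Omega\mathcal B$: it sends $\lambda$ to $\mu$ with $\mu_{\Omega\mathcal E}=\lambda_{\Omega\mathcal F}$ under $\omega_p(\Omega\mathcal E)\cong\omega_q(\Omega\mathcal F)$ whenever $\Omega\mathcal F$ is the base change of $\Omega\mathcal E$. **Theorem.** Let $\Omega\mathcal A$ and $\Omega\mathcal B$ be dg-Morita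 equivalent dga's whose graded centres $Z_g(\Omega\mathcal A)$, $Z_g(\Omega\mathcal B)$ satisfy property Q (each with respect to a $C^*$-algebra containing its degree-zero part as above). Then: 1. There is an isomorphism of dga's $\phi:Z_g(\Omega\mathcal A)\to Z_g(\Omega\mathcal B)$. 2. For this $\phi$ and every $q\in\widehat{Z_g(\mathcal B)}$ there is $p=\phi^*(q)\in\widehat{Z_g(\mathcal A)}$ (that is, $p=q\circ\phi$ on $Z_g(\mathcal A)$), the induced map $\pi^1\phi:\pi^1(\Omega\mathcal B,q)\to\pi^1(\Omega\mathcal A,p)$ exists and is unique, and it is an isomorphism. -/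

import Mathlib

open CategoryTheory TensorProduct MulOpposite

universe u

noncomputable section

namespace NCGeom

/-! ### Differential graded algebras -/

/-- A differential graded algebra over `ℂ`: a unital associative algebra `⨁_{k ≥ 0} Ω^k` with a
differential of degree `+1` satisfying the graded Leibniz rule. -/
structure DGAlg where
  carrier : Type u
  [ring : Ring carrier]
  [algebra : Algebra ℂ carrier]
  gr : ℕ → Submodule ℂ carrier
  [graded : GradedAlgebra gr]
  d : carrier →ₗ[ℂ] carrier
  d_mem : ∀ {k : ℕ} {a : carrier}, a ∈ gr k → d a ∈ gr (k + 1)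
  leibniz : ∀ {k : ℕ} {a : carrier}, a ∈ gr k → ∀ b : carrier,
    d (a * b) = d a * b + (-1 : ℂ) ^ k • (a * d b)
  d_d : ∀ a : carrier, d (d a) = 0

attribute [instance] DGAlg.ring DGAlg.algebra DGAlg.graded

instance : CoeSort DGAlg.{u} (Type u) := ⟨DGAlg.carrier⟩

/-- Morphisms of dga's: unital algebra homomorphisms of degree `0` commuting with `d`. -/
structure DGHom (A B : DGAlg.{u}) extends A.carrier →ₐ[ℂ] B.carrier where
  map_gr : ∀ {k : ℕ} {a : A}, a ∈ A.gr k → toFun a ∈ B.gr k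
  map_d : ∀ a : A, toFun (A.d a) = B.d (toFun a)

/-- The degree zero part of a morphism of dga's. -/
def DGHom.zero {A B : DGAlg.{u}} (φ : DGHom A B) (a : A.gr 0) : B.gr 0 :=
  ⟨φ.toAlgHom a, φ.map_gr a.2⟩

/-- A morphism of dga's is an isomorphism if it has a two-sided inverse that is a morphism of
dga's. -/
def DGHom.IsIso {A B : DGAlg.{u}} (φ : DGHom A B) : Prop :=
  ∃ ψ : DGHom B A, (∀ a : A, ψ.toAlgHom (φ.toAlgHom a) = a) ∧
    ∀ b : B, φ.toAlgHom (ψ.toAlgHom b) = b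

/-! ### Graded bimodules, their graded centre, and flat connections -/

/-- A graded bimodule `⨁_{k ≥ 0} Ω^k E` over a dga (only the graded algebra is used). The right
action is written as an action of the opposite algebra. -/
structure GrBimod (A : DGAlg.{u}) where
  carrier : Type u
  [addCommGroup : AddCommGroup carrier]
  [moduleC : Module ℂ carrier]
  [moduleL : Module A.carrier carrier]
  [moduleR : Module A.carrierᵐᵒᵖ carrier]
  [bimod : SMulCommClass A.carrier A.carrierᵐᵒᵖ carrier]
  [towerL : IsScalarTower ℂ A.carrier carrier]
  [towerR : IsScalarTower ℂ A.carrierᵐᵒᵖ carrier]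
  gr : ℕ → Submodule ℂ carrier
  [decomposition : DirectSum.Decomposition gr]
  smul_mem : ∀ {i j : ℕ} {a : A} {x : carrier}, a ∈ A.gr i → x ∈ gr j → a • x ∈ gr (i + j)
  op_smul_mem : ∀ {i j : ℕ} {a : A} {x : carrier}, a ∈ A.gr i → x ∈ gr j → op a • x ∈ gr (j + i)

attribute [instance] GrBimod.addCommGroup GrBimod.moduleC GrBimod.moduleL GrBimod.moduleR
  GrBimod.bimod GrBimod.towerL GrBimod.towerR GrBimod.decomposition

instance (A : DGAlg.{u}) : CoeSort (GrBimod A) (Type u) := ⟨GrBimod.carrier⟩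

/-- The homogeneous component of degree `i`. -/
abbrev GrBimod.comp {A : DGAlg.{u}} (E : GrBimod A) (x : E) (i : ℕ) : E :=
  (DirectSum.decompose E.gr x i : E)

/-- `E` is finitely generated projective: `E ⊕ F ≅ A ^ n` as graded bimodules, for some graded
bimodule `F` and some `n`. -/
def GrBimod.IsFGP {A : DGAlg.{u}} (E : GrBimod A) : Prop :=
  ∃ (F : GrBimod A) (n : ℕ) (e : (E × F) ≃+ (Fin n → A)),
    (∀ (a : A) (x : E × F) (i : Fin n), e (a • x) i = a * e x i) ∧
    (∀ (a : A) (x : E × F) (i : Fin n), e (op a • x) i = e x i * a) ∧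
    ∀ (k : ℕ) (x : E × F), (x.1 ∈ E.gr k ∧ x.2 ∈ F.gr k) ↔ ∀ i, e x i ∈ A.gr k

/-- The graded centre of a graded bimodule: all `x` with `[ν, x] = 0` for every `ν ∈ A`, where
`[ν, x] = ν x - (-1) ^ (|ν| |x|) x ν` on homogeneous elements, extended bilinearly. As
`[ν, x_i]` has degree `|ν| + i`, this is a condition on each homogeneous component `x_i`. -/
def GrBimod.center {A : DGAlg.{u}} (E : GrBimod A) : Submodule ℂ E.carrier where
  carrier := {x | ∀ (i j : ℕ) (ν : A), ν ∈ A.gr j →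
    ν • E.comp x i = (-1 : ℂ) ^ (j * i) • op ν • E.comp x i}
  add_mem' := by
    intro x y hx hy i j ν hν
    simp only [GrBimod.comp, DirectSum.decompose_add, DirectSum.add_apply, Submodule.coe_add,
      smul_add] at *
    rw [hx i j ν hν, hy i j ν hν]
  zero_mem' := by
    intro i j ν hν
    simp [GrBimod.comp]
  smul_mem' := by
    intro c x hx i j ν hν
    have h := hx i j ν hν
    simp only [GrBimod.comp, DirectSum.decompose_smul, DirectSum.smul_apply,
      Submodule.coe_smul] at *
    rw [smul_comm ν c, h, smul_comm (op ν) c, smul_comm _ c]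

lemma GrBimod.mem_center_of_mem {A : DGAlg.{u}} (E : GrBimod A) {k : ℕ} {x : E} (hx : x ∈ E.gr k) :
    x ∈ E.center ↔ ∀ (j : ℕ) (ν : A), ν ∈ A.gr j → ν • x = (-1 : ℂ) ^ (j * k) • op ν • x := by
  constructor
  · intro h j ν hν
    have := h k j ν hν
    simpa only [GrBimod.comp, DirectSum.decompose_of_mem_same _ hx] using this
  · intro h i j ν hν
    rcases eq_or_ne k i with rfl | hne
    · simpa only [GrBimod.comp, DirectSum.decompose_of_mem_same _ hx] using h j ν hν
    · simp [GrBimod.comp, DirectSum.decompose_of_mem_ne _ hx hne]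

/-- The degree zero part of the graded centre of a graded bimodule. -/
def GrBimod.center₀ {A : DGAlg.{u}} (E : GrBimod A) : Submodule ℂ E.carrier := E.center ⊓ E.gr 0


lemma GrBimod.comp_mem_center {A : DGAlg.{u}} (E : GrBimod A) {x : E} (hx : x ∈ E.center)
    (i : ℕ) : E.comp x i ∈ E.center :=
  (E.mem_center_of_mem (SetLike.coe_mem _)).2 fun j ν hν => hx i j ν hν

lemma GrBimod.mem_of_homogeneous {A : DGAlg.{u}} (E : GrBimod A) (S : Submodule ℂ E.carrier)
    {x : E} (hx : x ∈ E.center) (h : ∀ (k : ℕ) (y : E), y ∈ E.gr k → y ∈ E.center → y ∈ S) :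
    x ∈ S := by
  classical
  rw [← DirectSum.sum_support_decompose E.gr x]
  exact S.sum_mem fun i _ => h i _ (SetLike.coe_mem _) (E.comp_mem_center hx i)

lemma GrBimod.mem_center₀_iff {A : DGAlg.{u}} (E : GrBimod A) {x : E} :
    x ∈ E.center₀ ↔ x ∈ E.gr 0 ∧ ∀ ν : A, ν • x = op ν • x := by
  constructor
  · rintro ⟨h1, h0⟩
    have h0 : x ∈ E.gr 0 := h0
    refine ⟨h0, fun ν => ?_⟩
    have h := (E.mem_center_of_mem h0).1 h1
    induction ν using DirectSum.Decomposition.inductionOn A.gr with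
    | zero => simp
    | homogeneous m => simpa using h _ _ m.2
    | add a b ha hb => rw [add_smul, MulOpposite.op_add, add_smul, ha, hb]
  · rintro ⟨h0, h⟩
    exact ⟨(E.mem_center_of_mem h0).2 fun j ν _ => by simpa using h ν, h0⟩

/-- An object of `C_♭(A)`: a graded finitely generated projective bimodule over `A` with a flat
bimodule connection. -/
structure FlatObj (A : DGAlg.{u}) extends GrBimod A where
  fgp : toGrBimod.IsFGP
  nabla : carrier →ₗ[ℂ] carrier
  nabla_mem : ∀ {k : ℕ} {x : carrier}, x ∈ gr k → nabla x ∈ gr (k + 1)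
  leibniz_right : ∀ {k : ℕ} {x : carrier}, x ∈ gr k → ∀ a : A,
    nabla (op a • x) = op a • nabla x + (-1 : ℂ) ^ k • op (A.d a) • x
  leibniz_left : ∀ {k : ℕ} {a : A}, a ∈ A.gr k → ∀ x : carrier,
    nabla (a • x) = A.d a • x + (-1 : ℂ) ^ k • a • nabla x
  flat : ∀ x : carrier, nabla (nabla x) = 0

instance (A : DGAlg.{u}) : CoeSort (FlatObj A) (Type u) := ⟨fun E => E.carrier⟩

/-- Morphisms of `C_♭(A)`: bimodule maps of degree `0` commuting with the connections. -/
@[ext]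
structure FlatObj.Hom {A : DGAlg.{u}} (E F : FlatObj A) where
  lin : E.carrier →ₗ[ℂ] F.carrier
  map_smul : ∀ (a : A) (x : E), lin (a • x) = a • lin x
  map_op_smul : ∀ (a : A) (x : E), lin (op a • x) = op a • lin x
  map_gr : ∀ {k : ℕ} {x : E}, x ∈ E.gr k → lin x ∈ F.gr k
  map_nabla : ∀ x : E, lin (E.nabla x) = F.nabla (lin x)

instance (A : DGAlg.{u}) : Category (FlatObj A) where
  Hom := FlatObj.Hom
  id E := ⟨LinearMap.id, fun _ _ => rfl, fun _ _ => rfl, fun h => h, fun _ => rfl⟩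
  comp f g := ⟨g.lin ∘ₗ f.lin, fun a x => by simp [f.map_smul, g.map_smul],
    fun a x => by simp [f.map_op_smul, g.map_op_smul], fun h => g.map_gr (f.map_gr h),
    fun x => by simp [f.map_nabla, g.map_nabla]⟩

/-- `A` as a graded bimodule over itself. -/
def DGAlg.selfBimod (A : DGAlg.{u}) : GrBimod A where
  carrier := A.carrier
  gr := A.gr
  smul_mem := fun ha hx => SetLike.GradedMul.mul_mem ha hx
  op_smul_mem := fun ha hx => SetLike.GradedMul.mul_mem hx ha

/-- The zero graded bimodule. -/
def DGAlg.zeroBimod (A : DGAlg.{u}) : GrBimod A where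
  carrier := PUnit.{u + 1}
  gr := fun _ => (⊤ : Submodule ℂ PUnit.{u + 1})
  decomposition := DirectSum.IsInternal.chooseDecomposition _
    ⟨fun _ _ _ => DFinsupp.ext fun _ => Subsingleton.elim _ _, fun y =>
      ⟨DirectSum.of (fun _ => (⊤ : Submodule ℂ PUnit.{u + 1})) 0 ⟨y, trivial⟩, rfl⟩⟩
  smul_mem := fun _ _ => trivial
  op_smul_mem := fun _ _ => trivial

/-- The unit object `(A, d)` of `C_♭(A)`. -/
def FlatObj.unit (A : DGAlg.{u}) : FlatObj A where
  toGrBimod := A.selfBimod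
  fgp := by
    refine ⟨A.zeroBimod, 1,
      { toFun := fun x _ => x.1
        invFun := fun y => (y 0, PUnit.unit)
        left_inv := fun _ => rfl
        right_inv := fun y => by funext i; fin_cases i; rfl
        map_add' := fun _ _ => rfl }, fun _ _ _ => rfl, fun _ _ _ => rfl, fun k x => ?_⟩
    exact ⟨fun h _ => h.1, fun h => ⟨h 0, trivial⟩⟩
  nabla := A.d
  nabla_mem := A.d_mem
  leibniz_right := fun hx a => A.leibniz hx a
  leibniz_left := fun ha x => A.leibniz ha x
  flat := A.d_d

/-- A connection preserves the graded centre. -/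
lemma FlatObj.nabla_mem_center {A : DGAlg.{u}} (E : FlatObj A) {x : E} (hx : x ∈ E.center) :
    E.nabla x ∈ E.center := by
  refine E.mem_of_homogeneous (E.center.comap E.nabla) hx fun k y hy hyc => ?_
  refine (E.mem_center_of_mem (E.nabla_mem hy)).2 fun j ν hν => ?_
  have h1 := (E.mem_center_of_mem hy).1 hyc
  have h2 := congrArg E.nabla (h1 j ν hν)
  rw [E.leibniz_left hν, _root_.map_smul, E.leibniz_right hy, h1 _ _ (A.d_mem hν), smul_add,
    smul_smul] at h2
  have e1 : ((-1 : ℂ)) ^ ((j + 1) * k) = (-1) ^ (j * k) * (-1) ^ k := by ring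
  rw [e1, add_comm] at h2
  have h3 := add_right_cancel h2
  have e2 : ((-1 : ℂ)) ^ (j * (k + 1)) = (-1) ^ j * (-1) ^ (j * k) := by ring
  have e3 : ((-1 : ℂ)) ^ j * (-1) ^ j = 1 := by rw [← mul_pow]; simp
  rw [e2, mul_smul, ← h3, smul_smul, e3, one_smul]

/-! ### The graded centre of a dga -/

lemma DGAlg.mul_mem_center (A : DGAlg.{u}) {a b : A} (ha : a ∈ A.selfBimod.center)
    (hb : b ∈ A.selfBimod.center) : (a * b : A) ∈ A.selfBimod.center := by
  let Sb : Submodule ℂ A.carrier :=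
    Submodule.comap (LinearMap.mulRight ℂ b) (show Submodule ℂ A.carrier from A.selfBimod.center)
  refine A.selfBimod.mem_of_homogeneous Sb ha fun k (a : A.carrier) hak ha => ?_
  let Sa : Submodule ℂ A.carrier :=
    Submodule.comap (LinearMap.mulLeft ℂ a) (show Submodule ℂ A.carrier from A.selfBimod.center)
  refine A.selfBimod.mem_of_homogeneous Sa hb fun l (b : A.carrier) hbl hb => ?_
  have hab : a * b ∈ A.gr (k + l) := SetLike.GradedMul.mul_mem hak hbl
  refine (A.selfBimod.mem_center_of_mem (x := (a * b : A.carrier)) hab).2 fun j ν hν => ?_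
  have h1 : ν * a = (-1 : ℂ) ^ (j * k) • (a * ν) :=
    (A.selfBimod.mem_center_of_mem hak).1 ha j ν hν
  have h2 : ν * b = (-1 : ℂ) ^ (j * l) • (b * ν) :=
    (A.selfBimod.mem_center_of_mem hbl).1 hb j ν hν
  change ν * (a * b) = (-1 : ℂ) ^ (j * (k + l)) • (a * b * ν)
  rw [← mul_assoc, h1, smul_mul_assoc, mul_assoc, h2, mul_smul_comm, smul_smul, mul_assoc,
    mul_add, pow_add]

lemma DGAlg.algebraMap_mem_center (A : DGAlg.{u}) (c : ℂ) :
    algebraMap ℂ A.carrier c ∈ A.selfBimod.center := by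
  have hc : algebraMap ℂ A.carrier c ∈ A.gr 0 := SetLike.algebraMap_mem_graded A.gr c
  refine (A.selfBimod.mem_center_of_mem hc).2 fun j ν _ => ?_
  change ν * algebraMap ℂ A.carrier c = (-1 : ℂ) ^ (j * 0) • (algebraMap ℂ A.carrier c * ν)
  rw [mul_zero, pow_zero, one_smul, Algebra.commutes]

/-- The underlying algebra of the graded centre of a dga. -/
def DGAlg.centerSubalgebra (A : DGAlg.{u}) : Subalgebra ℂ A.carrier where
  carrier := {a : A.carrier | a ∈ A.selfBimod.center}
  mul_mem' := A.mul_mem_center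
  add_mem' := A.selfBimod.center.add_mem
  algebraMap_mem' := A.algebraMap_mem_center

lemma DGAlg.comp_mem_center (A : DGAlg.{u}) (z : A.centerSubalgebra) (i : ℕ) :
    (DirectSum.decompose A.gr (z : A.carrier) i : A.carrier) ∈ A.centerSubalgebra :=
  A.selfBimod.comp_mem_center z.2 i

lemma DGAlg.center_isInternal (A : DGAlg.{u}) : DirectSum.IsInternal
    fun k => (A.gr k).comap A.centerSubalgebra.val.toLinearMap := by
  classical
  refine DirectSum.isInternal_submodule_of_iSupIndep_of_iSup_eq_top ?_ ?_
  · have hA := (DirectSum.Decomposition.isInternal A.gr).submodule_iSupIndep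
    intro i
    rw [Submodule.disjoint_def]
    intro x hx hx'
    refine Subtype.ext ((Submodule.disjoint_def.1 (hA i)) _ hx ?_)
    have h := Submodule.mem_map_of_mem (f := A.centerSubalgebra.val.toLinearMap) hx'
    simp only [Submodule.map_iSup] at h
    exact (iSup₂_mono fun j _ => Submodule.map_comap_le _ _) h
  · rw [eq_top_iff]
    intro z _
    have hz : z = ∑ i ∈ (DirectSum.decompose A.gr (z : A.carrier)).support,
        (⟨_, A.comp_mem_center z i⟩ : A.centerSubalgebra) := by
      apply Subtype.ext
      rw [AddSubmonoidClass.coe_finsetSum]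
      exact (DirectSum.sum_support_decompose A.gr (z : A.carrier)).symm
    rw [hz]
    exact Submodule.sum_mem _ fun i _ => Submodule.mem_iSup_of_mem i (SetLike.coe_mem
      (DirectSum.decompose A.gr (z : A.carrier) i))

/-- The graded centre `Z_g(A)`, a sub-dga of `A`. -/
def DGAlg.center (A : DGAlg.{u}) : DGAlg.{u} where
  carrier := A.centerSubalgebra
  gr k := (A.gr k).comap A.centerSubalgebra.val.toLinearMap
  graded :=
    { one_mem := SetLike.GradedOne.one_mem (A := A.gr)
      mul_mem := fun _ _ _ _ h1 h2 => SetLike.GradedMul.mul_mem (A := A.gr) h1 h2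
      toDecomposition := A.center_isInternal.chooseDecomposition }
  d := A.d.restrict (p := Subalgebra.toSubmodule A.centerSubalgebra)
    (q := Subalgebra.toSubmodule A.centerSubalgebra)
    fun _ h => (FlatObj.unit A).nabla_mem_center h
  d_mem := fun h => A.d_mem h
  leibniz := fun h b => Subtype.ext (A.leibniz h b)
  d_d := fun a => Subtype.ext (A.d_d a)

/-- The inclusion `Z_g(A) ⊆ A`. -/
def DGAlg.centerIncl {A : DGAlg.{u}} (z : A.center) : A := Subtype.val (p := (· ∈ A.centerSubalgebra)) z

/-- The graded centre of a bimodule is a right `Z_g(A)`-module. -/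
lemma GrBimod.op_smul_mem_center {A : DGAlg.{u}} (E : GrBimod A) {x : E} (hx : x ∈ E.center)
    (z : A.center) : op (DGAlg.centerIncl z) • x ∈ E.center := by
  obtain ⟨z, hz⟩ := z
  let Sx : Submodule ℂ A.carrier :=
    { carrier := {z : A.carrier | op z • x ∈ E.center}
      add_mem' := fun {a b} ha hb => by
        have := E.center.add_mem ha hb
        rwa [← add_smul, ← MulOpposite.op_add] at this
      zero_mem' := by simp
      smul_mem' := fun c a ha => by
        have := E.center.smul_mem c ha
        rwa [← smul_assoc, ← MulOpposite.op_smul] at this }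
  refine A.selfBimod.mem_of_homogeneous Sx hz fun k (z : A.carrier) hzk hz => ?_
  let Sz : Submodule ℂ E.carrier :=
    { carrier := {x : E.carrier | op z • x ∈ E.center}
      add_mem' := fun {a b} ha hb => by
        have := E.center.add_mem ha hb
        rwa [← smul_add] at this
      zero_mem' := by simp
      smul_mem' := fun c a ha => by
        have := E.center.smul_mem c ha
        rwa [smul_comm] at this }
  refine E.mem_of_homogeneous Sz hx fun l x hxl hx => ?_
  refine (E.mem_center_of_mem (E.op_smul_mem hzk hxl)).2 fun j ν hν => ?_
  have h1 : ν * z = (-1 : ℂ) ^ (j * k) • (z * ν) :=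
    (A.selfBimod.mem_center_of_mem hzk).1 hz j ν hν
  have h2 := (E.mem_center_of_mem hxl).1 hx j ν hν
  rw [smul_comm ν (op z), h2, smul_comm (op z), smul_smul (op z), ← MulOpposite.op_mul, h1,
    MulOpposite.op_smul, smul_assoc, smul_smul, MulOpposite.op_mul, mul_smul (op ν), mul_add, pow_add]

/-! ### Property Q -/

/-- The data of a dense inclusion of the degree zero part of a dga, as a unital `*`-algebra, into
a unital C*-algebra, such that every element of the former that is invertible in the latter has its
inverse in the former. -/
structure CStarCompletion (Z : DGAlg.{u}) where
  alg : Type u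
  [cstar : CStarAlgebra alg]
  ι : Z.gr 0 →ₐ[ℂ] alg
  injective : Function.Injective ι
  dense : DenseRange ι
  star_mem : ∀ a : Z.gr 0, ∃ b : Z.gr 0, ι b = star (ι a)
  isUnit_of_isUnit : ∀ a : Z.gr 0, IsUnit (ι a) → IsUnit a

attribute [instance] CStarCompletion.cstar

/-- Property Q. Here `≤` is the usual order of the C*-algebra and `CFC.abs x = (x* x) ^ (1/2)`. -/
def PropertyQ {Z : DGAlg.{u}} (C : CStarCompletion Z) : Prop :=
  letI : PartialOrder C.alg := CStarAlgebra.spectralOrder C.alg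
  haveI : StarOrderedRing C.alg := CStarAlgebra.spectralOrderedRing C.alg
  ∀ a : Z.gr 0, 0 ≤ C.ι a →
    ∀ (s : ℕ) (b : Fin s → Z.gr 0) (ω : Fin s → Z.gr 1), (∀ i, CFC.abs (C.ι (b i)) ≤ C.ι a) →
      Z.d a = ∑ i, (b i : Z) * (ω i : Z) → a = 0 ∨ IsUnit a

/-- The Gelfand spectrum. -/
abbrev CStarCompletion.Spec {Z : DGAlg.{u}} (C : CStarCompletion Z) : Type u :=
  WeakDual.characterSpace ℂ C.alg

/-- The character of the degree zero part given by a point of the Gelfand spectrum. -/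
def CStarCompletion.char {Z : DGAlg.{u}} (C : CStarCompletion Z) (p : C.Spec) : Z.gr 0 →ₐ[ℂ] ℂ :=
  (WeakDual.CharacterSpace.toAlgHom p).comp C.ι

/-! ### The fibre functor -/

section Fibre

variable {A : DGAlg.{u}} (χ : A.center.gr 0 →ₐ[ℂ] ℂ)

/-- The relations `x · z = χ(z) x` in the degree zero part of the graded centre of `E`. -/
def fibreRel (E : FlatObj A) : Submodule ℂ E.center₀ :=
  Submodule.span ℂ {y | ∃ (z : A.center.gr 0) (x : E.center₀),
    (y : E) = op (DGAlg.centerIncl (z : A.center)) • (x : E) - χ z • (x : E)}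

/-- The fibre functor on objects: `Z_g(E)⁰ ⊗ ℂ` over `Z_g(A)⁰`, which acts on `ℂ` through `χ`,
presented as the quotient of `Z_g(E)⁰` by the relations `x · z = χ(z) x`. -/
abbrev Fibre (E : FlatObj A) : Type u := E.center₀ ⧸ fibreRel χ E

/-- The map of fibres induced by a linear map `Z_g(E)⁰ → Z_g(F)⁰` that respects the relations. -/
def fibreMapAux {B : DGAlg.{u}} {ψ : B.center.gr 0 →ₐ[ℂ] ℂ} {E : FlatObj A} {F : FlatObj B}
    (f : E.center₀ →ₗ[ℂ] F.center₀) (σ : A.center.gr 0 → B.center.gr 0)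
    (hσ : ∀ z, ψ (σ z) = χ z)
    (hf : ∀ (z : A.center.gr 0) (x y : E.center₀),
      (y : E) = op (DGAlg.centerIncl (z : A.center)) • (x : E) →
      (f y : F) = op (DGAlg.centerIncl (σ z : B.center)) • (f x : F)) :
    Fibre χ E →ₗ[ℂ] Fibre ψ F :=
  Submodule.mapQ _ _ f (by
    refine Submodule.span_le.2 ?_
    rintro y ⟨z, x, hy⟩
    refine Submodule.subset_span ⟨σ z, f x, ?_⟩
    have h := hf z x (y + χ z • x) (by simp [hy])
    rw [map_add, map_smul, Submodule.coe_add, Submodule.coe_smul] at h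
    rw [← h, hσ, add_sub_cancel_right])

/-- The fibre functor on morphisms. -/
def fibreMap {E F : FlatObj A} (f : E ⟶ F) : Fibre χ E →ₗ[ℂ] Fibre χ F :=
  fibreMapAux χ (ψ := χ)
    (f.lin.restrict (p := E.center₀) (q := F.center₀) fun x hx => by
      rw [GrBimod.mem_center₀_iff] at hx ⊢
      exact ⟨f.map_gr hx.1, fun ν => by rw [← f.map_smul, hx.2, f.map_op_smul]⟩)
    id (fun _ => rfl) (fun z x y h => by
      change f.lin (y : E) = _ • f.lin (x : E)
      rw [h, f.map_op_smul]; rfl)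

/-- A pairing `E × F → G` of objects of `C_♭(A)`: a `ℂ`-bilinear map of degree `0` that is
`A`-balanced and a bimodule map, and that satisfies
`∇(e · f) = ∇(e) · f + (-1) ^ |e| e · ∇(f)`. -/
structure Pairing (E F G : FlatObj A) where
  bil : E.carrier →ₗ[ℂ] F.carrier →ₗ[ℂ] G.carrier
  smul_left : ∀ (a : A) (x : E) (y : F), bil (a • x) y = a • bil x y
  balanced : ∀ (a : A) (x : E) (y : F), bil (op a • x) y = bil x (a • y)
  smul_right : ∀ (a : A) (x : E) (y : F), bil x (op a • y) = op a • bil x y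
  map_gr : ∀ {i j : ℕ} {x : E} {y : F}, x ∈ E.gr i → y ∈ F.gr j → bil x y ∈ G.gr (i + j)
  map_nabla : ∀ {i : ℕ} {x : E} (y : F), x ∈ E.gr i →
    G.nabla (bil x y) = bil (E.nabla x) y + (-1 : ℂ) ^ i • bil x (F.nabla y)

/-- The pairing exhibits `G` as the tensor product `E ⊗_A F` in `C_♭(A)`: the induced map from
`E ⊗_A F = (E ⊗_ℂ F) / (e a ⊗ f - e ⊗ a f)` to `G` is bijective. (The bimodule structure, the
grading and the connection of `G` are then those of `E ⊗_A F`.) -/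
def Pairing.IsTensor {E F G : FlatObj A} (b : Pairing E F G) : Prop :=
  Function.Surjective (TensorProduct.lift b.bil) ∧
  LinearMap.ker (TensorProduct.lift b.bil) =
    Submodule.span ℂ {t | ∃ (a : A) (x : E) (y : F), t = (op a • x) ⊗ₜ[ℂ] y - x ⊗ₜ[ℂ] (a • y)}

lemma Pairing.mem_center₀ {E F G : FlatObj A} (b : Pairing E F G) {x : E} {y : F}
    (hx : x ∈ E.center₀) (hy : y ∈ F.center₀) : b.bil x y ∈ G.center₀ := by
  rw [GrBimod.mem_center₀_iff] at *
  refine ⟨b.map_gr hx.1 hy.1, fun ν => ?_⟩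
  rw [← b.smul_left, hx.2, b.balanced, hy.2, b.smul_right]

/-- The restriction of a pairing to the degree zero parts of the graded centres. -/
def Pairing.center₀ {E F G : FlatObj A} (b : Pairing E F G) :
    E.center₀ →ₗ[ℂ] F.center₀ →ₗ[ℂ] G.center₀ :=
  LinearMap.mk₂ ℂ (fun x y => ⟨b.bil x y, b.mem_center₀ x.2 y.2⟩)
    (fun _ _ _ => Subtype.ext (by simp)) (fun _ _ _ => Subtype.ext (by simp))
    (fun _ _ _ => Subtype.ext (by simp)) (fun _ _ _ => Subtype.ext (by simp))

/-- The map `ω(E) → ω(F) → ω(G)` induced by a pairing. -/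
def Pairing.fibreBil {E F G : FlatObj A} (b : Pairing E F G) :
    Fibre χ E →ₗ[ℂ] Fibre χ F →ₗ[ℂ] Fibre χ G :=
  Submodule.liftQ _
    { toFun := fun x => Submodule.mapQ _ _ (b.center₀ x) (by
        refine Submodule.span_le.2 ?_
        rintro y ⟨z, y', hy⟩
        refine Submodule.subset_span ⟨z, b.center₀ x y', ?_⟩
        change b.bil x y = _ • b.bil x y' - _ • b.bil x y'
        rw [hy, map_sub, b.smul_right, map_smul])
      map_add' := fun x x' => by
        refine Submodule.linearMap_qext _ (LinearMap.ext fun y => ?_)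
        simp only [map_add]
        rfl
      map_smul' := fun c x => by
        refine Submodule.linearMap_qext _ (LinearMap.ext fun y => ?_)
        simp only [map_smul]
        rfl }
    (by
      refine Submodule.span_le.2 ?_
      rintro x ⟨z, x', hx⟩
      refine Submodule.linearMap_qext _ (LinearMap.ext fun y => ?_)
      refine (Submodule.Quotient.mk_eq_zero _).2 (Submodule.subset_span ⟨z, b.center₀ x' y, ?_⟩)
      change b.bil x y = _ • b.bil x' y - _ • b.bil x' y
      have hy := (GrBimod.mem_center₀_iff _).1 y.2
      rw [hx, map_sub, LinearMap.sub_apply, b.balanced, hy.2, b.smul_right, LinearMap.map_smul,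
        LinearMap.smul_apply])

/-- The map `ω(E) ⊗ ω(F) → ω(G)` induced by a pairing, extended `R`-bilinearly to
`(R ⊗ ω(E)) × (R ⊗ ω(F)) → R ⊗ ω(G)`. -/
def Pairing.fibrePair (R : Type u) [CommRing R] [Algebra ℂ R] {E F G : FlatObj A}
    (b : Pairing E F G) (u : R ⊗[ℂ] Fibre χ E) (v : R ⊗[ℂ] Fibre χ F) : R ⊗[ℂ] Fibre χ G :=
  (TensorProduct.lift (b.fibreBil χ)).baseChange R
    ((AlgebraTensorModule.distribBaseChange ℂ R (Fibre χ E) (Fibre χ F)).symm (u ⊗ₜ[R] v))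

/-! ### The fundamental group -/

/-- The `R`-valued points of the fundamental group scheme: the `R`-linear tensor automorphisms
of the fibre functor with coefficients extended to `R`, that is, the families of `R`-linear
automorphisms of `R ⊗ ω(E)`, natural in `E`, compatible with tensor products and with the unit. -/
def tensorAut (R : Type u) [CommRing R] [Algebra ℂ R] :
    Subgroup (∀ E : FlatObj A, (R ⊗[ℂ] Fibre χ E) ≃ₗ[R] (R ⊗[ℂ] Fibre χ E)) where
  carrier := {l |
    (∀ (E F : FlatObj A) (f : E ⟶ F) (u : R ⊗[ℂ] Fibre χ E),
      l F ((fibreMap χ f).baseChange R u) = (fibreMap χ f).baseChange R (l E u)) ∧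
    (∀ (E F G : FlatObj A) (b : Pairing E F G), b.IsTensor →
      ∀ (u : R ⊗[ℂ] Fibre χ E) (v : R ⊗[ℂ] Fibre χ F),
        l G (b.fibrePair χ R u v) = b.fibrePair χ R (l E u) (l F v)) ∧
    ∀ u, l (FlatObj.unit A) u = u}
  mul_mem' := by
    rintro l m ⟨l1, l2, l3⟩ ⟨m1, m2, m3⟩
    refine ⟨fun E F f u => ?_, fun E F G b hb u v => ?_, fun u => ?_⟩
    · simp only [Pi.mul_apply, LinearEquiv.mul_apply, m1, l1]
    · simp only [Pi.mul_apply, LinearEquiv.mul_apply, m2 E F G b hb, l2 E F G b hb]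
    · simp only [Pi.mul_apply, LinearEquiv.mul_apply, m3, l3]
  one_mem' := ⟨fun _ _ _ _ => rfl, fun _ _ _ _ _ _ _ => rfl, fun _ => rfl⟩
  inv_mem' := by
    rintro l ⟨l1, l2, l3⟩
    have hl : ∀ E u, l⁻¹ E (l E u) = u := fun E u => (l E).symm_apply_apply u
    have hl' : ∀ E u, l E (l⁻¹ E u) = u := fun E u => (l E).apply_symm_apply u
    refine ⟨fun E F f u => ?_, fun E F G b hb u v => ?_, fun u => ?_⟩
    · rw [← hl F ((fibreMap χ f).baseChange R (l⁻¹ E u)), l1, hl']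
    · rw [← hl G (b.fibrePair χ R (l⁻¹ E u) (l⁻¹ F v)), l2 E F G b hb, hl', hl']
    · conv_lhs => rw [← l3 u]
      exact hl _ u

/-- The `S`-linear extension of an `R`-linear endomorphism of `R ⊗ V` along `g : R → S`. -/
def extendEnd {R S : Type u} [CommRing R] [Algebra ℂ R] [CommRing S] [Algebra ℂ S]
    (g : R →ₐ[ℂ] S) {V : Type u} [AddCommGroup V] [Module ℂ V]
    (f : R ⊗[ℂ] V →ₗ[R] R ⊗[ℂ] V) : S ⊗[ℂ] V →ₗ[S] S ⊗[ℂ] V :=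
  LinearMap.liftBaseChange S
    ((g.toLinearMap.rTensor V) ∘ₗ (f.restrictScalars ℂ) ∘ₗ (TensorProduct.mk ℂ R V 1))

section Extend

variable {R S : Type u} [CommRing R] [Algebra ℂ R] [CommRing S] [Algebra ℂ S] (g : R →ₐ[ℂ] S)
  {V W : Type u} [AddCommGroup V] [Module ℂ V] [AddCommGroup W] [Module ℂ W]

lemma rTensor_smul (r : R) (u : R ⊗[ℂ] V) :
    g.toLinearMap.rTensor V (r • u) = g r • g.toLinearMap.rTensor V u := by
  induction u with
  | zero => simp
  | tmul a v => simp [smul_tmul']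
  | add x y hx hy => rw [smul_add, map_add, hx, hy, map_add, smul_add]

lemma extendEnd_rTensor (f : R ⊗[ℂ] V →ₗ[R] R ⊗[ℂ] V) (u : R ⊗[ℂ] V) :
    extendEnd g f (g.toLinearMap.rTensor V u) = g.toLinearMap.rTensor V (f u) := by
  induction u with
  | zero => simp
  | tmul a v =>
    have h : a ⊗ₜ[ℂ] v = a • ((1 : R) ⊗ₜ[ℂ] v) := by simp [smul_tmul']
    rw [h, rTensor_smul, LinearMap.map_smul f, rTensor_smul, LinearMap.map_smul]
    simp [extendEnd]
  | add x y hx hy => simp only [map_add, hx, hy]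

lemma ext_rTensor {M : Type u} [AddCommGroup M] [Module S M] {f f' : S ⊗[ℂ] V →ₗ[S] M}
    (h : ∀ u : R ⊗[ℂ] V, f (g.toLinearMap.rTensor V u) = f' (g.toLinearMap.rTensor V u)) :
    f = f' := by
  refine LinearMap.ext fun u => ?_
  induction u with
  | zero => simp
  | tmul a v =>
    have e : a ⊗ₜ[ℂ] v = a • g.toLinearMap.rTensor V ((1 : R) ⊗ₜ[ℂ] v) := by simp [smul_tmul']
    rw [e, map_smul, map_smul, h]
  | add x y hx hy => simp only [map_add, hx, hy]

lemma baseChange_rTensor (f : V →ₗ[ℂ] W) (u : R ⊗[ℂ] V) :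
    f.baseChange S (g.toLinearMap.rTensor V u) = g.toLinearMap.rTensor W (f.baseChange R u) := by
  induction u with
  | zero => simp
  | tmul a v => simp
  | add x y hx hy => simp only [map_add, hx, hy]

/-- The `S`-linear extension of an `R`-linear automorphism of `R ⊗ V` along `g : R → S`. -/
def extendEquiv (f : (R ⊗[ℂ] V) ≃ₗ[R] (R ⊗[ℂ] V)) : (S ⊗[ℂ] V) ≃ₗ[S] (S ⊗[ℂ] V) :=
  LinearEquiv.ofLinearMap (extendEnd g f.toLinearMap) (extendEnd g f.symm.toLinearMap)
    (ext_rTensor g fun u => by simp [extendEnd_rTensor])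
    (ext_rTensor g fun u => by simp [extendEnd_rTensor])

lemma extendEquiv_rTensor (f : (R ⊗[ℂ] V) ≃ₗ[R] (R ⊗[ℂ] V)) (u : R ⊗[ℂ] V) :
    extendEquiv g f (g.toLinearMap.rTensor V u) = g.toLinearMap.rTensor V (f u) :=
  extendEnd_rTensor g f.toLinearMap u

lemma extendEquiv_id (f : (R ⊗[ℂ] V) ≃ₗ[R] (R ⊗[ℂ] V)) : extendEquiv (AlgHom.id ℂ R) f = f := by
  refine LinearEquiv.toLinearMap_injective (ext_rTensor (AlgHom.id ℂ R) fun u => ?_)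
  refine (extendEquiv_rTensor (AlgHom.id ℂ R) f u).trans ?_
  have h : (AlgHom.id ℂ R).toLinearMap.rTensor V = LinearMap.id := LinearMap.rTensor_id _ _
  rw [h]
  rfl

lemma rTensor_comp_apply {T : Type u} [CommRing T] [Algebra ℂ T] (h : S →ₐ[ℂ] T)
    (u : R ⊗[ℂ] V) : (h.comp g).toLinearMap.rTensor V u =
      h.toLinearMap.rTensor V (g.toLinearMap.rTensor V u) := by
  induction u with
  | zero => simp
  | tmul a v => simp
  | add x y hx hy => simp only [map_add, hx, hy]

lemma extendEquiv_comp {T : Type u} [CommRing T] [Algebra ℂ T] (h : S →ₐ[ℂ] T)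
    (f : (R ⊗[ℂ] V) ≃ₗ[R] (R ⊗[ℂ] V)) :
    extendEquiv (h.comp g) f = extendEquiv h (extendEquiv g f) := by
  refine LinearEquiv.toLinearMap_injective (ext_rTensor (h.comp g) fun u => ?_)
  have h1 := extendEquiv_rTensor (h.comp g) f u
  have h2 := extendEquiv_rTensor h (extendEquiv g f) (g.toLinearMap.rTensor V u)
  rw [extendEquiv_rTensor g f u, ← rTensor_comp_apply, ← rTensor_comp_apply] at h2
  exact h1.trans h2.symm

end Extend

lemma Pairing.fibrePair_tmul {R : Type u} [CommRing R] [Algebra ℂ R] {E F G : FlatObj A}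
    (b : Pairing E F G) (r s : R) (x : Fibre χ E) (y : Fibre χ F) :
    b.fibrePair χ R (r ⊗ₜ x) (s ⊗ₜ y) = (r * s) ⊗ₜ b.fibreBil χ x y := by
  rw [Pairing.fibrePair, AlgebraTensorModule.distribBaseChange_symm_tmul]
  simp

/-- `Pairing.fibrePair` as a bilinear map. -/
def Pairing.fibrePairₗ (R : Type u) [CommRing R] [Algebra ℂ R] {E F G : FlatObj A}
    (b : Pairing E F G) :
    (R ⊗[ℂ] Fibre χ E) →ₗ[R] (R ⊗[ℂ] Fibre χ F) →ₗ[R] R ⊗[ℂ] Fibre χ G :=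
  LinearMap.mk₂ R (b.fibrePair χ R) (fun _ _ _ => by simp [Pairing.fibrePair, add_tmul])
    (fun _ _ _ => by simp [Pairing.fibrePair, ← smul_tmul'])
    (fun _ _ _ => by simp [Pairing.fibrePair, tmul_add])
    (fun _ _ _ => by simp [Pairing.fibrePair])

lemma Pairing.fibrePair_rTensor {R S : Type u} [CommRing R] [Algebra ℂ R] [CommRing S]
    [Algebra ℂ S] (g : R →ₐ[ℂ] S) {E F G : FlatObj A} (b : Pairing E F G)
    (u : R ⊗[ℂ] Fibre χ E) (v : R ⊗[ℂ] Fibre χ F) :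
    b.fibrePair χ S (g.toLinearMap.rTensor _ u) (g.toLinearMap.rTensor _ v) =
      g.toLinearMap.rTensor _ (b.fibrePair χ R u v) := by
  change b.fibrePairₗ χ S _ _ = g.toLinearMap.rTensor _ (b.fibrePairₗ χ R u v)
  induction u with
  | zero => simp
  | add x y hx hy => simp only [map_add, LinearMap.add_apply, hx, hy]
  | tmul r x =>
    induction v with
    | zero => simp
    | add x y hx hy => simp only [map_add, hx, hy]
    | tmul s y =>
      change b.fibrePair χ S (g r ⊗ₜ x) (g s ⊗ₜ y) =
        g.toLinearMap.rTensor _ (b.fibrePair χ R (r ⊗ₜ x) (s ⊗ₜ y))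
      simp [Pairing.fibrePair_tmul]

/-- Extension of coefficients of tensor automorphisms along `g : R → S`. -/
def tensorAutMap {R S : Type u} [CommRing R] [Algebra ℂ R] [CommRing S] [Algebra ℂ S]
    (g : R →ₐ[ℂ] S) : tensorAut χ R →* tensorAut χ S where
  toFun l := ⟨fun E => extendEquiv g (l.1 E), by
    obtain ⟨l, l1, l2, l3⟩ := l
    refine ⟨fun E F f u => ?_, fun E F G b hb u v => ?_, fun u => ?_⟩
    · refine LinearMap.congr_fun (f := (extendEquiv g (l F)).toLinearMap ∘ₗ
        (fibreMap χ f).baseChange S) (g := (fibreMap χ f).baseChange S ∘ₗ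
        (extendEquiv g (l E)).toLinearMap) (ext_rTensor g fun u => ?_) u
      simp only [LinearMap.comp_apply, LinearEquiv.coe_coe, baseChange_rTensor,
        extendEquiv_rTensor, l1]
    · have h : (b.fibrePairₗ χ S).compr₂ (extendEquiv g (l G)).toLinearMap =
          (b.fibrePairₗ χ S).compl₁₂ (extendEquiv g (l E)).toLinearMap
            (extendEquiv g (l F)).toLinearMap := by
        refine ext_rTensor g fun u => ext_rTensor g fun v => ?_
        change extendEquiv g (l G) (b.fibrePair χ S _ _) =
          b.fibrePair χ S (extendEquiv g (l E) _) (extendEquiv g (l F) _)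
        rw [Pairing.fibrePair_rTensor, extendEquiv_rTensor, extendEquiv_rTensor,
          extendEquiv_rTensor, Pairing.fibrePair_rTensor, l2 E F G b hb]
      exact LinearMap.congr_fun (LinearMap.congr_fun h u) v
    · refine LinearMap.congr_fun (f := (extendEquiv g (l (FlatObj.unit A))).toLinearMap)
        (g := LinearMap.id) (ext_rTensor g fun u => ?_) u
      simp only [LinearEquiv.coe_coe, extendEquiv_rTensor, l3, LinearMap.id_apply]⟩
  map_one' := by
    refine Subtype.ext (funext fun E => LinearEquiv.toLinearMap_injective
      (ext_rTensor g fun u => ?_))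
    exact extendEquiv_rTensor g _ u
  map_mul' l m := by
    refine Subtype.ext (funext fun E => LinearEquiv.toLinearMap_injective
      (ext_rTensor g fun u => ?_))
    refine (extendEquiv_rTensor g _ u).trans ?_
    change _ = extendEquiv g (l.1 E) (extendEquiv g (m.1 E) _)
    rw [extendEquiv_rTensor, extendEquiv_rTensor]
    rfl

lemma tensorAutMap_id {R : Type u} [CommRing R] [Algebra ℂ R] (l : tensorAut χ R) :
    tensorAutMap χ (AlgHom.id ℂ R) l = l :=
  Subtype.ext (funext fun E => extendEquiv_id (l.1 E))

lemma tensorAutMap_comp {R S T : Type u} [CommRing R] [Algebra ℂ R] [CommRing S] [Algebra ℂ S]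
    [CommRing T] [Algebra ℂ T] (g : R →ₐ[ℂ] S) (h : S →ₐ[ℂ] T) (l : tensorAut χ R) :
    tensorAutMap χ (h.comp g) l = tensorAutMap χ h (tensorAutMap χ g l) :=
  Subtype.ext (funext fun E => extendEquiv_comp g h (l.1 E))

/-- The group scheme of tensor automorphisms of the fibre functor at the character `χ`, as the
functor `R ↦ Aut^⊗(ω)(R)` from commutative `ℂ`-algebras to groups. -/
def autGroup : CommAlgCat.{u} ℂ ⥤ GrpCat.{u + 1} where
  obj R := GrpCat.of (tensorAut χ R)
  map g := GrpCat.ofHom (tensorAutMap χ g.hom)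
  map_id _ := GrpCat.hom_ext (MonoidHom.ext fun l => tensorAutMap_id χ l)
  map_comp g h := GrpCat.hom_ext (MonoidHom.ext fun l => tensorAutMap_comp χ g.hom h.hom l)

end Fibre

/-- The fundamental group `π¹(A, p)` of a dga `A` whose graded centre is densely included in a
C*-algebra, at a point `p` of the Gelfand spectrum of the latter. -/
def fundamentalGroup {A : DGAlg.{u}} (C : CStarCompletion A.center) (p : C.Spec) :
    CommAlgCat.{u} ℂ ⥤ GrpCat.{u + 1} :=
  autGroup (C.char p)

/-! ### The induced map on fundamental groups -/

section Induced

variable {A B : DGAlg.{u}} (φ : DGHom A.center B.center)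

/-- The bilinear map `(x, b) ↦ l(x) b`. -/
def GrBimod.actBil (F : GrBimod B) {V : Type u} [AddCommGroup V] [Module ℂ V]
    (l : V →ₗ[ℂ] F.carrier) : V →ₗ[ℂ] B.carrier →ₗ[ℂ] F.carrier :=
  LinearMap.mk₂ ℂ (fun x b => op b • l x)
    (fun _ _ _ => by rw [map_add, smul_add]) (fun _ _ _ => by rw [map_smul, smul_comm])
    (fun _ _ _ => by rw [MulOpposite.op_add, add_smul])
    (fun _ _ _ => by rw [MulOpposite.op_smul, smul_assoc])

/-- `F = Z_g(E) ⊗ B` over `Z_g(A)`, which acts on `B` through `φ : Z_g(A) → Z_g(B)`, with the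
connection extending that of `Z_g(E)`: the data of a `φ`-semilinear map `Z_g(E) → Z_g(F)` of degree
`0` commuting with the connections such that the induced map to `F` from
`Z_g(E) ⊗ B = (Z_g(E) ⊗_ℂ B) / (e z ⊗ b - e ⊗ φ(z) b)` is bijective. -/
structure BaseChange (E : FlatObj A) (F : FlatObj B) where
  lin : E.center →ₗ[ℂ] F.carrier
  mem_center : ∀ x : E.center, lin x ∈ F.center
  semilinear : ∀ (z : A.center) (x : E.center),
    lin ⟨op (DGAlg.centerIncl z) • (x : E), E.op_smul_mem_center x.2 z⟩ =
      op (DGAlg.centerIncl (φ.toAlgHom z)) • lin x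
  map_gr : ∀ {k : ℕ} {x : E.center}, (x : E) ∈ E.gr k → lin x ∈ F.gr k
  map_nabla : ∀ x : E.center, lin ⟨E.nabla x, E.nabla_mem_center x.2⟩ = F.nabla (lin x)
  surjective : Function.Surjective (TensorProduct.lift (F.actBil lin))
  ker_eq : LinearMap.ker (TensorProduct.lift (F.actBil lin)) =
    Submodule.span ℂ {t | ∃ (z : A.center) (x : E.center) (b : B),
      t = (⟨op (DGAlg.centerIncl z) • (x : E), E.op_smul_mem_center x.2 z⟩ : E.center) ⊗ₜ[ℂ] b -
        x ⊗ₜ[ℂ] (DGAlg.centerIncl (φ.toAlgHom z) * b)}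

variable {φ} {χ : A.center.gr 0 →ₐ[ℂ] ℂ} {ψ : B.center.gr 0 →ₐ[ℂ] ℂ}

/-- The identification `ω_χ(E) → ω_ψ(F)` induced by a base change, where `χ = ψ ∘ φ`. -/
def BaseChange.fibreMap {E : FlatObj A} {F : FlatObj B} (f : BaseChange φ E F)
    (h : ∀ z, χ z = ψ (φ.zero z)) : Fibre χ E →ₗ[ℂ] Fibre ψ F :=
  fibreMapAux χ (ψ := ψ)
    { toFun := fun x => ⟨f.lin ⟨x, x.2.1⟩, f.mem_center _, f.map_gr x.2.2⟩
      map_add' := fun x y => Subtype.ext (f.lin.map_add ⟨x, x.2.1⟩ ⟨y, y.2.1⟩)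
      map_smul' := fun c x => Subtype.ext (f.lin.map_smul c ⟨x, x.2.1⟩) }
    φ.zero (fun z => (h z).symm) (fun z x y hxy => by
      refine Eq.trans ?_ (f.semilinear z ⟨x, x.2.1⟩)
      exact congrArg f.lin (Subtype.ext hxy))

/-- `θ` is the map of fundamental groups induced by `φ`, that is, pull back of automorphisms along
base change: `θ(l)_E = l_F` under the identification of `ω_χ(E)` with `ω_ψ(F)`, whenever `F` is the
base change of `E` along `φ`. -/
def IsInduced (φ : DGHom A.center B.center) (h : ∀ z, χ z = ψ (φ.zero z))
    (θ : autGroup ψ ⟶ autGroup χ) : Prop :=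
  ∀ (R : CommAlgCat.{u} ℂ) (l : tensorAut ψ R) (E : FlatObj A) (F : FlatObj B)
    (f : BaseChange φ E F) (u : R ⊗[ℂ] Fibre χ E),
    (f.fibreMap h).baseChange R (((θ.app R).hom l : tensorAut χ R).1 E u) =
      l.1 F ((f.fibreMap h).baseChange R u)

end Induced

/-! ### dg-Morita equivalence -/

/-- A differential graded right module over a dga. -/
structure DGMod (A : DGAlg.{u}) where
  carrier : Type u
  [addCommGroup : AddCommGroup carrier]
  [moduleC : Module ℂ carrier]
  [moduleR : Module A.carrierᵐᵒᵖ carrier]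
  [tower : IsScalarTower ℂ A.carrierᵐᵒᵖ carrier]
  gr : ℤ → Submodule ℂ carrier
  [decomposition : DirectSum.Decomposition gr]
  op_smul_mem : ∀ {i : ℕ} {j : ℤ} {a : A} {x : carrier}, a ∈ A.gr i → x ∈ gr j →
    op a • x ∈ gr (j + i)
  d : carrier →ₗ[ℂ] carrier
  d_mem : ∀ {j : ℤ} {x : carrier}, x ∈ gr j → d x ∈ gr (j + 1)
  leibniz : ∀ {j : ℤ} {x : carrier}, x ∈ gr j → ∀ a : A,
    d (op a • x) = op a • d x + (-1 : ℂ) ^ j • op (A.d a) • x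
  d_d : ∀ x : carrier, d (d x) = 0

attribute [instance] DGMod.addCommGroup DGMod.moduleC DGMod.moduleR DGMod.tower
  DGMod.decomposition

instance (A : DGAlg.{u}) : CoeSort (DGMod A) (Type u) := ⟨DGMod.carrier⟩

instance (A : DGAlg.{u}) (M : DGMod A) : SMulCommClass A.carrierᵐᵒᵖ ℂ M.carrier :=
  IsScalarTower.to_smulCommClass'

section Mod

variable {A : DGAlg.{u}}

/-- The right `A`-linear maps `M → N` that are homogeneous of degree `n`. -/
def homDeg (M N : DGMod A) (n : ℤ) : Submodule ℂ (M.carrier →ₗ[A.carrierᵐᵒᵖ] N.carrier) where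
  carrier := {f | ∀ (j : ℤ) (x : M), x ∈ M.gr j → f x ∈ N.gr (j + n)}
  add_mem' hf hg j x hx := (N.gr _).add_mem (hf j x hx) (hg j x hx)
  zero_mem' _ _ _ := (N.gr _).zero_mem
  smul_mem' c _ hf j x hx := (N.gr _).smul_mem c (hf j x hx)

/-- All graded module morphisms `M → N`, not only those of degree `0`: the sums of homogeneous
right `A`-linear maps. -/
def gradedHom (M N : DGMod A) : Submodule ℂ (M.carrier →ₗ[A.carrierᵐᵒᵖ] N.carrier) :=
  ⨆ n : ℤ, homDeg M N n

lemma id_mem_homDeg (M : DGMod A) : LinearMap.id ∈ homDeg M M 0 := by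
  intro j x hx
  simpa using hx

lemma comp_mem_homDeg {M N P : DGMod A} {m n : ℤ} {f : M.carrier →ₗ[A.carrierᵐᵒᵖ] N.carrier}
    {g : N.carrier →ₗ[A.carrierᵐᵒᵖ] P.carrier} (hf : f ∈ homDeg M N m) (hg : g ∈ homDeg N P n) :
    g ∘ₗ f ∈ homDeg M P (m + n) := by
  intro j x hx
  rw [← add_assoc]
  exact hg _ _ (hf _ _ hx)

lemma comp_mem_gradedHom {M N P : DGMod A} {f : M.carrier →ₗ[A.carrierᵐᵒᵖ] N.carrier}
    {g : N.carrier →ₗ[A.carrierᵐᵒᵖ] P.carrier} (hf : f ∈ gradedHom M N) (hg : g ∈ gradedHom N P) :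
    g ∘ₗ f ∈ gradedHom M P := by
  induction hf using Submodule.iSup_induction' with
  | zero => rw [LinearMap.comp_zero]; exact Submodule.zero_mem _
  | add f f' _ _ h h' => rw [LinearMap.comp_add]; exact Submodule.add_mem _ h h'
  | mem m f hf =>
    induction hg using Submodule.iSup_induction' with
    | zero => rw [LinearMap.zero_comp]; exact Submodule.zero_mem _
    | add g g' _ _ h h' => rw [LinearMap.add_comp]; exact Submodule.add_mem _ h h'
    | mem n g hg => exact Submodule.mem_iSup_of_mem _ (comp_mem_homDeg hf hg)

/-- The category `Mod^dg_A`: dg right modules and all graded module morphisms. -/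
instance : Category (DGMod A) where
  Hom M N := gradedHom M N
  id M := ⟨LinearMap.id, Submodule.mem_iSup_of_mem 0 (id_mem_homDeg M)⟩
  comp f g := ⟨g.1 ∘ₗ f.1, comp_mem_gradedHom f.2 g.2⟩

instance (M N : DGMod A) : AddCommGroup (M ⟶ N) := inferInstanceAs (AddCommGroup (gradedHom M N))

instance (M N : DGMod A) : Module ℂ (M ⟶ N) := inferInstanceAs (Module ℂ (gradedHom M N))

/-- The underlying linear map of a morphism. -/
def DGMod.lin {M N : DGMod A} (f : M ⟶ N) : M.carrier →ₗ[A.carrierᵐᵒᵖ] N.carrier := f.1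

/-- A morphism is homogeneous of degree `n`. -/
def DGMod.HasDegree {M N : DGMod A} (n : ℤ) (f : M ⟶ N) : Prop := DGMod.lin f ∈ homDeg M N n

/-- The differential `d ∘ f - (-1) ^ n f ∘ d` of a homogeneous morphism `f` of degree `n`. -/
def DGMod.homD {M N : DGMod A} {n : ℤ} (f : M ⟶ N) (hf : DGMod.HasDegree n f) : M ⟶ N :=
  ⟨{ toFun := fun x => N.d (DGMod.lin f x) - (-1 : ℂ) ^ n • DGMod.lin f (M.d x)
     map_add' := fun x y => by simp only [map_add, smul_add]; abel
     map_smul' := fun a x => by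
       induction x using DirectSum.Decomposition.inductionOn M.gr with
       | zero => simp
       | add x y hx hy =>
         simp only [smul_add, map_add, RingHom.id_apply] at *
         rw [add_sub_add_comm, hx, hy, ← smul_add, ← add_sub_add_comm]
       | @homogeneous j x =>
         have hx := x.2
         have e : ((-1 : ℂ)) ^ (j + n) = (-1) ^ n * (-1) ^ j := by
           rw [add_comm, zpow_add₀ (by norm_num)]
         have hC : ∀ (c : ℂ) (y : M.carrier), DGMod.lin f (c • y) = c • DGMod.lin f y :=
           fun c y => LinearMap.map_smul_of_tower _ c y
         rw [RingHom.id_apply, ← op_unop a, LinearMap.map_smul, N.leibniz (hf j _ hx),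
           M.leibniz hx, map_add, hC, LinearMap.map_smul, LinearMap.map_smul, e, smul_add,
           smul_smul, smul_sub, smul_comm (op (unop a)) ((-1 : ℂ) ^ n)]
         abel },
    Submodule.mem_iSup_of_mem (n + 1) fun j x hx => by
      have h1 := N.d_mem (hf j x hx)
      have h2 := hf _ _ (M.d_mem hx)
      rw [add_right_comm] at h2
      rw [← add_assoc]
      exact (N.gr _).sub_mem h1 ((N.gr _).smul_mem _ h2)⟩

end Mod

/-- Two dga's are dg-Morita equivalent if their dg-categories of dg-modules are equivalent: there
is a dg-functor, that is, a functor that is `ℂ`-linear on morphisms, preserves degrees and commutes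
with the differentials of morphisms, which is an equivalence of categories (so it is fully faithful,
and every object is isomorphic in `Mod^dg_B` to one in its image; this holds in particular if the
isomorphisms can be chosen closed of degree `0`). -/
def DGMoritaEquivalent (A B : DGAlg.{u}) : Prop :=
  ∃ T : DGMod A ⥤ DGMod B,
    (∀ (M N : DGMod A) (f g : M ⟶ N), T.map (f + g) = T.map f + T.map g) ∧
    (∀ (M N : DGMod A) (c : ℂ) (f : M ⟶ N), T.map (c • f) = c • T.map f) ∧
    (∀ (M N : DGMod A) (n : ℤ) (f : M ⟶ N) (hf : DGMod.HasDegree n f),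
      ∃ hTf : DGMod.HasDegree n (T.map f), T.map (DGMod.homD f hf) = DGMod.homD (T.map f) hTf) ∧
    T.IsEquivalence

end NCGeom

end

/-!
The graded centre of a dga `A` consists of the graded natural endomorphisms of the identity functor
of `Mod^dg_A`: a central `z` of degree `k` acts on every dg module by `x ↦ (-1)^(k|x|) x z`, and
commutes in the graded sense with all morphisms. Conversely, a family of this kind is determined by
its value at `1` in the regular module `A`. A dg equivalence `T` transports such families, and so
gives an isomorphism `φ` of the graded centres with inverse `ψ`
(`DGMoritaEquivalent.exists_isIso`). The isomorphism between `T M` and the regular module of `B`,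
for a suitable `M`, need not be homogeneous. It is used only to write `1` as a sum of images of
homogeneous elements under homogeneous morphisms, which is what determines the transported element.

A character of the degree zero part of the graded centre extends to the C*-completion: an element
`z` minus the value of the character at `z` is not invertible, hence not invertible in the
completion, so the value lies in the spectrum and the character is bounded by the norm
(`CStarCompletion.exists_char_eq`). So every `q` has a `p` with `p = q ∘ φ`.

A bimodule which is a direct summand of a free one has a dual basis consisting of elements and
coordinates that are compatible with the graded centres (`DualBasis`). It is therefore generated by
its graded centre, on which everything else can be read off: a flat object over `A` and one over `B`
match along `φ` when their graded centres are isomorphic over `φ`, compatibly with degrees and `∇`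
(`CenterEquiv`). Every flat object has a match (`exists_centerEquiv`), base changes along `φ` are
matches and matches are base changes (`BaseChange.exists_centerEquiv`, `CenterEquiv.toBaseChange`),
and matches carry morphisms to morphisms (`CenterEquiv.exists_hom`) and tensor products to tensor
products (`CenterEquiv.exists_pairing`). They induce isomorphisms of fibres, so a tensor
automorphism over `B` can be pulled back to `A`. By naturality the result does not depend on the
matches chosen (`CenterEquiv.pull_eq_pull`); this gives existence and uniqueness of the induced map
of fundamental groups, and pulling back along `ψ` is its inverse (`pullAut_bijective`).
-/

noncomputable section

namespace NCGeom

/-! ### Gradings -/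

/-- A family of submodules with projections onto its members is a grading. -/
lemma isInternal_of_projections {ι V : Type*} [DecidableEq ι] [AddCommGroup V] [Module ℂ V]
    (gr : ι → Submodule ℂ V) (π : ι → V →ₗ[ℂ] V) (hmem : ∀ k v, π k v ∈ gr k)
    (hsame : ∀ k, ∀ v ∈ gr k, π k v = v) (hne : ∀ j k, j ≠ k → ∀ v ∈ gr k, π j v = 0)
    (hsum : ∀ v, ∃ s : Finset ι, v = ∑ k ∈ s, π k v) : DirectSum.IsInternal gr := by
  refine DirectSum.isInternal_submodule_of_iSupIndep_of_iSup_eq_top ?_ ?_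
  · intro i
    rw [Submodule.disjoint_def]
    intro x hx hx'
    have h : (⨆ j, ⨆ (_ : j ≠ i), gr j) ≤ LinearMap.ker (π i) :=
      iSup₂_le fun j hj v hv => hne i j hj.symm v hv
    rw [← hsame i x hx]
    exact h hx'
  · rw [eq_top_iff]
    intro v _
    obtain ⟨s, hs⟩ := hsum v
    rw [hs]
    exact Submodule.sum_mem _ fun k _ => Submodule.mem_iSup_of_mem k (hmem k v)

section Scale

variable {ι V : Type*} [DecidableEq ι] [AddCommGroup V] [Module ℂ V] (gr : ι → Submodule ℂ V)
  [DirectSum.Decomposition gr]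

/-- The projection onto the homogeneous component of degree `k`. -/
def gradedProj (k : ι) : V →ₗ[ℂ] V :=
  (gr k).subtype ∘ₗ DirectSum.component ℂ ι (fun i => gr i) k ∘ₗ
    (DirectSum.decomposeLinearEquiv gr).toLinearMap

lemma gradedProj_apply (k : ι) (x : V) : gradedProj gr k x = (DirectSum.decompose gr x k : V) :=
  rfl

/-- Multiplication by `c k` in degree `k`. -/
def gradedScale (c : ι → ℂ) : V →ₗ[ℂ] V :=
  DirectSum.coeLinearMap gr ∘ₗ
    DirectSum.lmap (fun k => (c k • LinearMap.id : gr k →ₗ[ℂ] gr k)) ∘ₗ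
    (DirectSum.decomposeLinearEquiv gr).toLinearMap

lemma gradedScale_of_mem (c : ι → ℂ) {k : ι} {x : V} (hx : x ∈ gr k) :
    gradedScale gr c x = c k • x := by
  lift x to gr k using hx
  simp [gradedScale, DirectSum.decomposeLinearEquiv]

/-- Linear maps that agree on homogeneous elements agree. -/
lemma eq_of_homogeneous {W : Type*} [AddCommGroup W] [Module ℂ W] {f g : V →ₗ[ℂ] W}
    (h : ∀ k, ∀ x ∈ gr k, f x = g x) (x : V) : f x = g x := by
  induction x using DirectSum.Decomposition.inductionOn gr with
  | zero => simp
  | homogeneous m => exact h _ _ m.2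
  | add a b ha hb => rw [map_add, map_add, ha, hb]

/-- Linear maps of degree `0` commute with the projections onto homogeneous components. -/
lemma map_gradedProj {W : Type*} [AddCommGroup W] [Module ℂ W] (gr' : ι → Submodule ℂ W)
    [DirectSum.Decomposition gr'] {f : V →ₗ[ℂ] W} (hf : ∀ k, ∀ x ∈ gr k, f x ∈ gr' k) (k : ι)
    (x : V) : f (gradedProj gr k x) = gradedProj gr' k (f x) := by
  refine eq_of_homogeneous gr (f := f ∘ₗ gradedProj gr k) (g := gradedProj gr' k ∘ₗ f)
    (fun j y hy => ?_) x
  rw [LinearMap.comp_apply, LinearMap.comp_apply, gradedProj_apply, gradedProj_apply]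
  rcases eq_or_ne j k with rfl | hj
  · rw [DirectSum.decompose_of_mem_same _ hy, DirectSum.decompose_of_mem_same _ (hf j y hy)]
  · rw [DirectSum.decompose_of_mem_ne _ hy hj, DirectSum.decompose_of_mem_ne _ (hf j y hy) hj,
      map_zero]

end Scale

/-! ### The dga as a module over itself -/

/-- The grading of a dga, indexed by the integers. -/
def DGAlg.intGr (A : DGAlg.{u}) : ℤ → Submodule ℂ A.carrier
  | Int.ofNat n => A.gr n
  | Int.negSucc _ => ⊥

lemma DGAlg.intGr_isInternal (A : DGAlg.{u}) : DirectSum.IsInternal A.intGr := by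
  refine isInternal_of_projections _
    (fun k => match k with
      | Int.ofNat n => gradedProj A.gr n
      | Int.negSucc _ => 0) ?_ ?_ ?_ ?_
  · rintro (n | n) v
    · exact SetLike.coe_mem _
    · exact Submodule.zero_mem _
  · rintro (n | n) v hv
    · exact DirectSum.decompose_of_mem_same _ hv
    · exact ((Submodule.mem_bot ℂ).1 hv).symm
  · rintro (n | n) (m | m) h v hv
    · exact DirectSum.decompose_of_mem_ne (ℳ := A.gr) hv fun e => h (by rw [e])
    · rw [(Submodule.mem_bot ℂ).1 hv, map_zero]
    · rfl
    · rfl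
  · intro v
    classical
    refine ⟨(DirectSum.decompose A.gr v).support.map ⟨Int.ofNat, fun _ _ h => Int.ofNat.inj h⟩, ?_⟩
    rw [Finset.sum_map]
    exact (DirectSum.sum_support_decompose A.gr v).symm

instance (A : DGAlg.{u}) : DirectSum.Decomposition A.intGr :=
  A.intGr_isInternal.chooseDecomposition

/-- A dga as a dg right module over itself. -/
abbrev DGAlg.selfMod (A : DGAlg.{u}) : DGMod A where
  carrier := A.carrier
  gr := A.intGr
  op_smul_mem := by
    rintro i (j | j) a x ha hx
    · exact SetLike.GradedMul.mul_mem (A := A.gr) hx ha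
    · rw [(Submodule.mem_bot ℂ).1 hx, smul_zero]; exact Submodule.zero_mem _
  d := A.d
  d_mem := by
    rintro (j | j) x hx
    · exact A.d_mem hx
    · rw [(Submodule.mem_bot ℂ).1 hx, map_zero]; exact Submodule.zero_mem _
  leibniz := by
    rintro (j | j) x hx a
    · rw [Int.ofNat_eq_natCast, zpow_natCast]
      exact A.leibniz hx a
    · rw [(Submodule.mem_bot ℂ).1 hx]; simp
  d_d := A.d_d

variable {A B : DGAlg.{u}}

namespace DGMod

/-- The homogeneous morphism `A → M`, `a ↦ x a`, defined by an element `x` of `M`. -/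
def ofElem {M : DGMod A} {j : ℤ} {x : M} (hx : x ∈ M.gr j) : A.selfMod ⟶ M :=
  ⟨{ toFun := fun a : A.carrier => op a • x
     map_add' := fun a b => by rw [MulOpposite.op_add, add_smul]
     map_smul' := fun a b => by
      change op (b * unop a) • x = a • op b • x
      rw [MulOpposite.op_mul, mul_smul, op_unop] },
    Submodule.mem_iSup_of_mem j (by
      rintro (i | i) a ha
      · rw [add_comm]; exact M.op_smul_mem ha hx
      · rw [(Submodule.mem_bot ℂ).1 ha, map_zero]; exact Submodule.zero_mem _)⟩

lemma lin_ofElem {M : DGMod A} {j : ℤ} {x : M} (hx : x ∈ M.gr j) (a : A) :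
    lin (ofElem hx) (a : A.carrier) = op a • x := rfl

lemma hasDegree_ofElem {M : DGMod A} {j : ℤ} {x : M} (hx : x ∈ M.gr j) :
    HasDegree j (ofElem hx) := by
  rintro (i | i) a ha
  · rw [add_comm]; exact M.op_smul_mem ha hx
  · rw [(Submodule.mem_bot ℂ).1 ha, map_zero]; exact Submodule.zero_mem _

@[ext] lemma hom_ext {M N : DGMod A} {f g : M ⟶ N} (h : ∀ x, lin f x = lin g x) : f = g :=
  Subtype.ext (LinearMap.ext h)

lemma lin_comp {M N P : DGMod A} (f : M ⟶ N) (g : N ⟶ P) (x : M) :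
    lin (f ≫ g) x = lin g (lin f x) := rfl

lemma lin_id {M : DGMod A} (x : M) : lin (𝟙 M) x = x := rfl

lemma lin_add {M N : DGMod A} (f g : M ⟶ N) (x : M) : lin (f + g) x = lin f x + lin g x := rfl

lemma lin_smul {M N : DGMod A} (c : ℂ) (f : M ⟶ N) (x : M) : lin (c • f) x = c • lin f x := rfl

lemma lin_csmul {M N : DGMod A} (f : M ⟶ N) (c : ℂ) (x : M) : lin f (c • x) = c • lin f x :=
  LinearMap.map_smul_of_tower _ c x

lemma HasDegree.comp {M N P : DGMod A} {m n : ℤ} {f : M ⟶ N} {g : N ⟶ P} (hf : HasDegree m f)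
    (hg : HasDegree n g) : HasDegree (m + n) (f ≫ g) := comp_mem_homDeg hf hg

/-- Morphisms that agree on homogeneous elements agree. -/
lemma hom_ext_homogeneous {M N : DGMod A} {f g : M ⟶ N}
    (h : ∀ j, ∀ x ∈ M.gr j, lin f x = lin g x) : f = g := by
  refine hom_ext fun x => ?_
  induction x using DirectSum.Decomposition.inductionOn M.gr with
  | zero => simp
  | homogeneous m => exact h _ _ m.2
  | add a b ha hb => rw [map_add, map_add, ha, hb]

/-- Every morphism is a finite sum of homogeneous ones. -/
lemma exists_homogeneous_sum {M N : DGMod A} (f : M ⟶ N) :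
    ∃ (s : Finset ℤ) (g : ℤ → (M ⟶ N)), (∀ k, HasDegree k (g k)) ∧ f = ∑ k ∈ s, g k := by
  classical
  obtain ⟨f, hf⟩ := f
  obtain ⟨g, hg, hfg⟩ := (Submodule.mem_iSup_iff_exists_finsupp _ _).1 hf
  refine ⟨g.support, fun k => ⟨g k, Submodule.mem_iSup_of_mem k (hg k)⟩, hg, ?_⟩
  refine Subtype.ext (hfg.symm.trans ?_)
  exact (map_sum (gradedHom M N).subtype (fun k => (⟨g k, _⟩ : gradedHom M N)) g.support).symm

lemma lin_sum {M N : DGMod A} {κ : Type*} (s : Finset κ) (g : κ → (M ⟶ N)) (x : M) :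
    lin (∑ k ∈ s, g k) x = ∑ k ∈ s, lin (g k) x := by
  classical
  induction s using Finset.induction_on with
  | empty => simp only [Finset.sum_empty]; rfl
  | insert a s ha ih => rw [Finset.sum_insert ha, Finset.sum_insert ha, lin_add, ih]

/-- In a homogeneous sum of homogeneous morphisms, the terms of the other degrees vanish. -/
lemma eq_zero_of_hasDegree_sum {M N : DGMod A} (s : Finset ℤ) (g : ℤ → (M ⟶ N))
    (hg : ∀ k, HasDegree k (g k)) {n : ℤ} (h : HasDegree n (∑ k ∈ s, g k)) {j : ℤ} (hj : j ∈ s)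
    (hjn : j ≠ n) : g j = 0 := by
  classical
  refine hom_ext_homogeneous fun i x hx => ?_
  have h1 := DirectSum.decompose_of_mem_ne N.gr (h i x hx) (j := i + j)
    (fun e => hjn (add_left_cancel e).symm)
  rw [lin_sum, DirectSum.decompose_sum, DFinsupp.finsetSum_apply,
    AddSubmonoidClass.coe_finsetSum, Finset.sum_eq_single j] at h1
  · rw [DirectSum.decompose_of_mem_same N.gr (hg j i x hx)] at h1
    exact h1
  · intro k _ hk
    exact DirectSum.decompose_of_mem_ne N.gr (hg k i x hx) fun e => hk (add_left_cancel e)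
  · exact fun h => (h hj).elim

end DGMod

/-! ### The graded centre acting on dg modules -/

lemma neg_one_zpow_congr {k l : ℤ} (h : Even (k - l)) : ((-1 : ℂ)) ^ k = (-1) ^ l := by
  rw [← sub_add_cancel k l, zpow_add₀ (by norm_num), h.neg_one_zpow, one_mul]

lemma neg_one_zpow_mul (k l : ℤ) : ((-1 : ℂ)) ^ k * (-1) ^ l = (-1) ^ (k + l) :=
  (zpow_add₀ (by norm_num) k l).symm

lemma DGAlg.mul_eq_of_center {m n : ℕ} {z ν : A} (hz : z ∈ A.gr n)
    (hc : z ∈ A.selfBimod.center) (hν : ν ∈ A.gr m) :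
    ν * z = (-1 : ℂ) ^ ((m : ℤ) * n) • (z * ν) := by
  have h := (A.selfBimod.mem_center_of_mem hz).1 hc m ν hν
  rw [← Nat.cast_mul, zpow_natCast]
  exact h

lemma DGAlg.center_of_mul_eq {n : ℕ} {z : A} (hz : z ∈ A.gr n)
    (h : ∀ (m : ℕ) (ν : A), ν ∈ A.gr m → ν * z = (-1 : ℂ) ^ ((m : ℤ) * n) • (z * ν)) :
    z ∈ A.selfBimod.center := by
  refine (A.selfBimod.mem_center_of_mem hz).2 fun m ν hν => ?_
  have h := h m ν hν
  rw [← Nat.cast_mul, zpow_natCast] at h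
  exact h

namespace DGMod

/-- A central element `z` of degree `n` acts on each dg module by `x ↦ (-1) ^ (n |x|) x z`. -/
def act (M : DGMod A) {n : ℕ} {z : A} (hz : z ∈ A.gr n) (hc : z ∈ A.selfBimod.center) : M ⟶ M :=
  ⟨{ toFun := fun x => op z • gradedScale M.gr (fun j => (-1 : ℂ) ^ (n * j)) x
     map_add' := fun x y => by rw [map_add, smul_add]
     map_smul' := fun a x => by
      rw [RingHom.id_apply]
      induction x using DirectSum.Decomposition.inductionOn M.gr with
      | zero => simp
      | add x y hx hy => simp only [smul_add, map_add, hx, hy]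
      | @homogeneous j x =>
        obtain ⟨a, rfl⟩ := MulOpposite.op_surjective a
        induction a using DirectSum.Decomposition.inductionOn A.gr with
        | zero => simp
        | add a b ha hb => simp only [MulOpposite.op_add, add_smul, smul_add, map_add, ha, hb]
        | @homogeneous m a =>
          rw [gradedScale_of_mem _ _ (M.op_smul_mem a.2 x.2), gradedScale_of_mem _ _ x.2,
            smul_comm (op z) (_ : ℂ) (_ • _), smul_smul (op z) (op (a : A.carrier)),
            ← MulOpposite.op_mul, DGAlg.mul_eq_of_center hz hc a.2, MulOpposite.op_smul,
            smul_assoc, smul_smul _ _ (op (z * (a : A.carrier)) • (x : M.carrier)),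
            neg_one_zpow_mul, smul_comm (op z) (_ : ℂ), smul_comm (op (a : A.carrier)) (_ : ℂ),
            smul_smul (op (a : A.carrier)) (op z), ← MulOpposite.op_mul,
            neg_one_zpow_congr (k := n * (j + m) + m * n) (l := n * j) ⟨n * m, by ring⟩] },
    Submodule.mem_iSup_of_mem (n : ℤ) fun j x hx => by
      change op z • gradedScale M.gr _ x ∈ _
      rw [gradedScale_of_mem _ _ hx]
      exact M.op_smul_mem hz ((M.gr j).smul_mem _ hx)⟩

lemma lin_act {M : DGMod A} {n : ℕ} {z : A} (hz : z ∈ A.gr n) (hc : z ∈ A.selfBimod.center)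
    {j : ℤ} {x : M} (hx : x ∈ M.gr j) : lin (act M hz hc) x = (-1 : ℂ) ^ (n * j) • op z • x := by
  change op z • gradedScale M.gr _ x = _
  rw [gradedScale_of_mem _ _ hx, smul_comm]

lemma hasDegree_act {M : DGMod A} {n : ℕ} {z : A} (hz : z ∈ A.gr n)
    (hc : z ∈ A.selfBimod.center) : HasDegree (n : ℤ) (act M hz hc) := by
  intro j x hx
  rw [lin_act hz hc hx]
  exact (M.gr _).smul_mem _ (M.op_smul_mem hz hx)

/-- Central elements act by graded natural transformations. -/
lemma lin_act_comm {M N : DGMod A} {n : ℕ} {z : A} (hz : z ∈ A.gr n)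
    (hc : z ∈ A.selfBimod.center) {m : ℤ} {f : M ⟶ N} (hf : HasDegree m f) :
    f ≫ act N hz hc = (-1 : ℂ) ^ (n * m) • (act M hz hc ≫ f) := by
  refine hom_ext_homogeneous fun j x hx => ?_
  rw [lin_comp, lin_smul, lin_comp, lin_act hz hc hx, lin_act hz hc (hf j x hx), lin_csmul,
    LinearMap.map_smul, smul_smul, neg_one_zpow_mul, mul_add, add_comm]

lemma act_selfMod_one {n : ℕ} {z : A} (hz : z ∈ A.gr n) (hc : z ∈ A.selfBimod.center) :
    lin (act A.selfMod hz hc) (1 : A.carrier) = z := by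
  have h1 : (1 : A.carrier) ∈ A.selfMod.gr 0 := SetLike.GradedOne.one_mem (A := A.gr)
  rw [lin_act hz hc h1, mul_zero, zpow_zero, one_smul, op_smul_eq_mul, one_mul]

lemma act_one (M : DGMod A) (h1 : (1 : A.carrier) ∈ A.gr 0)
    (hc : (1 : A.carrier) ∈ A.selfBimod.center) : act M h1 hc = 𝟙 M := by
  refine hom_ext_homogeneous fun j x hx => ?_
  rw [lin_act _ _ hx, lin_id, MulOpposite.op_one, one_smul, Nat.cast_zero, zero_mul, zpow_zero,
    one_smul]

lemma act_add (M : DGMod A) {n : ℕ} {z z' : A.carrier} (hz : z ∈ A.gr n)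
    (hc : z ∈ A.selfBimod.center) (hz' : z' ∈ A.gr n) (hc' : z' ∈ A.selfBimod.center)
    (h : z + z' ∈ A.gr n) (hh : z + z' ∈ A.selfBimod.center) :
    act M h hh = act M hz hc + act M hz' hc' := by
  refine hom_ext_homogeneous fun j x hx => ?_
  rw [lin_add, lin_act _ _ hx, lin_act _ _ hx, lin_act _ _ hx, MulOpposite.op_add, add_smul,
    smul_add]

lemma act_smul (M : DGMod A) {n : ℕ} {z : A.carrier} (hz : z ∈ A.gr n)
    (hc : z ∈ A.selfBimod.center) (c : ℂ)
    (h : c • z ∈ A.gr n) (hh : c • z ∈ A.selfBimod.center) :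
    act M h hh = c • act M hz hc := by
  refine hom_ext_homogeneous fun j x hx => ?_
  rw [lin_smul, lin_act _ _ hx, lin_act _ _ hx, MulOpposite.op_smul, smul_assoc, smul_comm]

lemma act_mul (M : DGMod A) {n n' : ℕ} {z z' : A.carrier} (hz : z ∈ A.gr n)
    (hc : z ∈ A.selfBimod.center) (hz' : z' ∈ A.gr n') (hc' : z' ∈ A.selfBimod.center)
    (h : z * z' ∈ A.gr (n + n')) (hh : z * z' ∈ A.selfBimod.center) :
    act M h hh = act M hz' hc' ≫ act M hz hc := by
  refine hom_ext_homogeneous fun j x hx => ?_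
  rw [lin_comp, lin_act _ _ hx, lin_act _ _ hx, lin_csmul, lin_act hz hc (M.op_smul_mem hz' hx),
    smul_smul (op z) (op z'), ← MulOpposite.op_mul, DGAlg.mul_eq_of_center hz hc hz',
    MulOpposite.op_smul, smul_assoc, smul_smul, smul_smul, neg_one_zpow_mul, neg_one_zpow_mul,
    neg_one_zpow_congr (k := (n + n' : ℕ) * j) (l := n' * j + n * (j + n') + n' * n)
      ⟨-(n * n'), by push_cast; ring⟩]

/-- The differential of the action of a central element is the action of its differential. -/
lemma homD_act (M : DGMod A) {n : ℕ} {z : A} (hz : z ∈ A.gr n) (hc : z ∈ A.selfBimod.center)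
    (h : A.d z ∈ A.gr (n + 1)) (hh : A.d z ∈ A.selfBimod.center) :
    homD (act M hz hc) (hasDegree_act hz hc) = act M h hh := by
  refine hom_ext_homogeneous fun j x hx => ?_
  change M.d (lin (act M hz hc) x) - (-1 : ℂ) ^ (n : ℤ) • lin (act M hz hc) (M.d x) = _
  rw [lin_act hz hc hx, lin_act h hh hx, lin_act hz hc (M.d_mem hx), _root_.map_smul,
    M.leibniz hx, smul_add, smul_smul, smul_smul, neg_one_zpow_mul, neg_one_zpow_mul,
    neg_one_zpow_congr (k := n + n * (j + 1)) (l := n * j) ⟨n, by ring⟩,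
    neg_one_zpow_congr (k := n * j + j) (l := (n + 1 : ℕ) * j) ⟨0, by push_cast; ring⟩,
    add_sub_cancel_left]

/-- A graded natural endomorphism at `A` itself is left multiplication by a graded-central
element. -/
lemma center_of_comm {n : ℕ} {e : A.selfMod ⟶ A.selfMod} (he : HasDegree (n : ℤ) e)
    (h : ∀ (m : ℕ) (f : A.selfMod ⟶ A.selfMod), HasDegree (m : ℤ) f →
      f ≫ e = (-1 : ℂ) ^ ((n : ℤ) * m) • (e ≫ f)) :
    lin e (1 : A.carrier) ∈ A.gr n ∧ (lin e (1 : A.carrier) : A.carrier) ∈ A.selfBimod.center := by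
  have h1 : (1 : A.carrier) ∈ A.selfMod.gr 0 := SetLike.GradedOne.one_mem (A := A.gr)
  have hz : (lin e (1 : A.carrier) : A.carrier) ∈ A.gr n := by
    have := he 0 _ h1
    rw [zero_add] at this
    exact this
  refine ⟨hz, DGAlg.center_of_mul_eq hz fun m ν hν => ?_⟩
  let L : A.selfMod ⟶ A.selfMod := ofElem (M := A.selfMod) (j := (m : ℤ)) (x := ν) hν
  have h2 : lin e (lin L (1 : A.carrier)) =
      (-1 : ℂ) ^ ((n : ℤ) * m) • lin L (lin e (1 : A.carrier)) :=
    congrArg (fun f => lin f (1 : A.carrier)) (h m L (hasDegree_ofElem _))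
  have h3 : lin L (1 : A.carrier) = ν := mul_one ν
  have h4 : lin e ν = lin e (1 : A.carrier) * ν := by
    have := LinearMap.map_smul (lin e) (op ν) (1 : A.carrier)
    rw [op_smul_eq_mul, one_mul] at this
    exact this
  rw [h3, h4] at h2
  have h5 : lin L (lin e (1 : A.carrier)) = ν * lin e (1 : A.carrier) := rfl
  rw [h5] at h2
  rw [h2, smul_smul, neg_one_zpow_mul, neg_one_zpow_congr (l := 0) ⟨n * m, by ring⟩, zpow_zero,
    one_smul]

end DGMod

/-! ### Transport of the graded centre along a dg equivalence -/

/-- A `ℂ`-linear functor between categories of dg modules that preserves degrees, commutes with the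
differentials of morphisms, and is an equivalence. -/
structure IsDGEquivalence (T : DGMod A ⥤ DGMod B) : Prop where
  map_add : ∀ (M N : DGMod A) (f g : M ⟶ N), T.map (f + g) = T.map f + T.map g
  map_smul : ∀ (M N : DGMod A) (c : ℂ) (f : M ⟶ N), T.map (c • f) = c • T.map f
  map_homD : ∀ (M N : DGMod A) (n : ℤ) (f : M ⟶ N) (hf : DGMod.HasDegree n f),
    ∃ hTf : DGMod.HasDegree n (T.map f), T.map (DGMod.homD f hf) = DGMod.homD (T.map f) hTf
  isEquivalence : T.IsEquivalence

namespace IsDGEquivalence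

open DGMod

variable {T : DGMod A ⥤ DGMod B} (hT : IsDGEquivalence T)

include hT

lemma hasDegree_map {M N : DGMod A} {n : ℤ} {f : M ⟶ N} (hf : HasDegree n f) :
    HasDegree n (T.map f) := (hT.map_homD M N n f hf).1

lemma map_zero (M N : DGMod A) : T.map (0 : M ⟶ N) = 0 := by
  have := hT.map_smul M N 0 0
  rwa [zero_smul, zero_smul] at this

lemma map_sum {M N : DGMod A} (s : Finset ℤ) (g : ℤ → (M ⟶ N)) :
    T.map (∑ k ∈ s, g k) = ∑ k ∈ s, T.map (g k) := by
  classical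
  induction s using Finset.induction_on with
  | empty => rw [Finset.sum_empty, Finset.sum_empty, hT.map_zero]
  | insert a s ha ih => rw [Finset.sum_insert ha, Finset.sum_insert ha, hT.map_add, ih]

lemma map_injective {M N : DGMod A} {f g : M ⟶ N} (h : T.map f = T.map g) : f = g :=
  have := hT.isEquivalence
  T.map_injective h

/-- Degrees are reflected: the homogeneous components of `f` are mapped to those of `T f`, and `T` is
faithful. -/
lemma hasDegree_of_map {M N : DGMod A} {n : ℤ} {f : M ⟶ N} (hf : HasDegree n (T.map f)) :
    HasDegree n f := by
  obtain ⟨s, g, hg, rfl⟩ := exists_homogeneous_sum f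
  rw [hT.map_sum] at hf
  have h0 : ∀ k ∈ s, k ≠ n → g k = 0 := fun k hk hkn => hT.map_injective (by
    rw [hT.map_zero]
    exact eq_zero_of_hasDegree_sum s _ (fun k => hT.hasDegree_map (hg k)) hf hk hkn)
  by_cases hn : n ∈ s
  · rw [Finset.sum_eq_single_of_mem n hn h0]
    exact hg n
  · rw [Finset.sum_eq_zero fun k hk => h0 k hk fun e => hn (e ▸ hk)]
    exact Submodule.zero_mem _

/-- Every homogeneous morphism between objects in the image comes from a homogeneous morphism of
the same degree. -/
lemma exists_map_eq {M N : DGMod A} {n : ℤ} {g : T.obj M ⟶ T.obj N} (hg : HasDegree n g) :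
    ∃ f : M ⟶ N, HasDegree n f ∧ T.map f = g := by
  have := hT.isEquivalence
  obtain ⟨f, rfl⟩ := T.map_surjective g
  exact ⟨f, hT.hasDegree_of_map hg, rfl⟩

omit hT in
/-- The unit of `B` as a sum of values of homogeneous morphisms from an object isomorphic to `B`.
The isomorphism itself need not be homogeneous. -/
lemma exists_one_eq_sum {M : DGMod B} (i : M ≅ B.selfMod) :
    ∃ (s : Finset ℤ) (g : ℤ → (M ⟶ B.selfMod)) (y : ℤ → M), (∀ k, HasDegree k (g k)) ∧
      (∀ k, y k ∈ M.gr (-k)) ∧ ∑ k ∈ s, lin (g k) (y k) = (1 : B.carrier) := by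
  classical
  obtain ⟨s, g, hg, hi⟩ := exists_homogeneous_sum i.hom
  let y : M := lin i.inv (1 : B.carrier)
  refine ⟨s, g, fun k => (DirectSum.decompose M.gr y (-k) : M), hg, fun k => SetLike.coe_mem _, ?_⟩
  have h1 : (1 : B.carrier) ∈ B.selfMod.gr 0 := SetLike.GradedOne.one_mem (A := B.gr)
  have h2 : lin i.hom y = (1 : B.carrier) := by
    change lin (i.inv ≫ i.hom) (1 : B.carrier) = (1 : B.carrier)
    rw [i.inv_hom_id]
    rfl
  -- the component of degree `0` of `g k y` only sees the component of degree `-k` of `y`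
  have h3 : ∀ k, (DirectSum.decompose B.selfMod.gr (lin (g k) y) 0 : B.selfMod.carrier) =
      lin (g k) (DirectSum.decompose M.gr y (-k) : M) := by
    intro k
    conv_lhs => rw [← DirectSum.sum_support_decompose M.gr y]
    rw [_root_.map_sum, DirectSum.decompose_sum, DFinsupp.finsetSum_apply,
      AddSubmonoidClass.coe_finsetSum, Finset.sum_eq_single (-k)]
    · have := hg k (-k) _ (SetLike.coe_mem (DirectSum.decompose M.gr y (-k)))
      rw [neg_add_cancel] at this
      exact DirectSum.decompose_of_mem_same B.selfMod.gr this
    · intro l _ hl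
      exact DirectSum.decompose_of_mem_ne B.selfMod.gr
        (hg k l _ (SetLike.coe_mem (DirectSum.decompose M.gr y l)))
        fun e => hl (eq_neg_of_add_eq_zero_left e)
    · intro h
      rw [DFinsupp.notMem_support_iff] at h
      rw [h, ZeroMemClass.coe_zero, _root_.map_zero, DirectSum.decompose_zero]
      rfl
  have h4 : (DirectSum.decompose B.selfMod.gr (lin i.hom y) 0 : B.selfMod.carrier) =
      (1 : B.carrier) := by
    rw [h2]
    exact DirectSum.decompose_of_mem_same B.selfMod.gr h1
  rw [← h4, hi, lin_sum, DirectSum.decompose_sum, DFinsupp.finsetSum_apply,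
    AddSubmonoidClass.coe_finsetSum]
  exact Finset.sum_congr rfl fun k _ => (h3 k).symm

omit hT in
/-- An object of the source whose image generates the regular module of `B` in the sense of
`exists_one_eq_sum`. -/
lemma exists_object [T.IsEquivalence] :
    ∃ (M : DGMod A) (s : Finset ℤ) (g : ℤ → (T.obj M ⟶ B.selfMod)) (y : ℤ → T.obj M),
      (∀ k, HasDegree k (g k)) ∧ (∀ k, y k ∈ (T.obj M).gr (-k)) ∧
      ∑ k ∈ s, lin (g k) (y k) = (1 : B.carrier) :=
  ⟨_, exists_one_eq_sum (T.objObjPreimageIso B.selfMod)⟩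

/-- Two homogeneous central elements correspond to each other if `T` maps the action of the first
on dg modules to the action of the second. -/
def Corresponds (T : DGMod A ⥤ DGMod B) (n : ℕ) (z : A) (w : B) : Prop :=
  ∃ (hz : z ∈ A.gr n) (hzc : z ∈ A.selfBimod.center) (hw : w ∈ B.gr n)
    (hwc : w ∈ B.selfBimod.center), ∀ M, T.map (act M hz hzc) = act (T.obj M) hw hwc

end IsDGEquivalence

lemma DGAlg.d_mem_center {a : A.carrier} (ha : a ∈ A.selfBimod.center) :
    A.d a ∈ A.selfBimod.center := (FlatObj.unit A).nabla_mem_center ha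

namespace IsDGEquivalence

open DGMod

variable {T : DGMod A ⥤ DGMod B} (hT : IsDGEquivalence T)

include hT

/-- The images of the actions of a central element commute with all homogeneous morphisms between
objects in the image of `T`, as `T` is full. -/
lemma map_act_comm {n : ℕ} {z : A} (hz : z ∈ A.gr n) (hzc : z ∈ A.selfBimod.center)
    {M N : DGMod A} {m : ℤ} {f : T.obj M ⟶ T.obj N} (hf : HasDegree m f) :
    f ≫ T.map (act N hz hzc) = (-1 : ℂ) ^ (n * m) • (T.map (act M hz hzc) ≫ f) := by
  obtain ⟨f, hf', rfl⟩ := hT.exists_map_eq hf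
  rw [← T.map_comp, lin_act_comm hz hzc hf', hT.map_smul, T.map_comp]

/-- The image of the action of a central element is again the action of a central element. -/
lemma exists_corresponds_right {n : ℕ} {z : A} (hz : z ∈ A.gr n) (hzc : z ∈ A.selfBimod.center) :
    ∃ w, Corresponds T n z w := by
  have := hT.isEquivalence
  obtain ⟨M₀, s, g, y, hg, hy, h1⟩ := exists_object (T := T)
  set η : ∀ M, T.obj M ⟶ T.obj M := fun M => T.map (act M hz hzc) with hη
  have hηd : ∀ M, HasDegree (n : ℤ) (η M) := fun M => hT.hasDegree_map (hasDegree_act hz hzc)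
  -- `η M₀` evaluated at `1 = Σ g k (y k)`, with the sign for moving `η M₀` past `g k`
  let w : B.carrier := ∑ k ∈ s, (-1 : ℂ) ^ (n * k) • lin (g k) (lin (η M₀) (y k))
  have hw : w ∈ B.gr n := by
    refine Submodule.sum_mem _ fun k _ => Submodule.smul_mem _ _ ?_
    have := hg k _ _ (hηd M₀ _ _ (hy k))
    rw [neg_add_cancel_comm] at this
    exact this
  have key : ∀ (M : DGMod A) (j : ℤ) (x : T.obj M), x ∈ (T.obj M).gr j →
      lin (η M) x = (-1 : ℂ) ^ (n * j) • op w • x := by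
    intro M j x hx
    -- `ofElem hx` need not come from the source, but `g k ≫ ofElem hx` does
    have hx1 : x = ∑ k ∈ s, lin (g k ≫ ofElem hx) (y k) := by
      conv_lhs => rw [← one_smul B.carrierᵐᵒᵖ x, ← MulOpposite.op_one, ← h1]
      rw [Finset.op_sum, Finset.sum_smul]
      rfl
    conv_lhs => rw [hx1]
    rw [_root_.map_sum, Finset.op_sum, Finset.sum_smul, Finset.smul_sum]
    refine Finset.sum_congr rfl fun k _ => ?_
    have h2 := hT.map_act_comm hz hzc ((hg k).comp (hasDegree_ofElem hx))
    have h3 := congrArg (fun f => lin f (y k)) h2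
    refine Eq.trans h3 ?_
    rw [MulOpposite.op_smul, smul_assoc, smul_smul, neg_one_zpow_mul, ← mul_add, add_comm j]
    rfl
  have hwc : w ∈ B.selfBimod.center := by
    refine DGAlg.center_of_mul_eq hw fun m ν hν => ?_
    have h2 : w * ν = (-1 : ℂ) ^ ((m : ℤ) * n) • (ν * w) := by
      rw [Finset.sum_mul]
      have h3 : ν * w = ∑ k ∈ s, lin (g k) (y k) * (ν * w) := by
        rw [← Finset.sum_mul]
        exact ((congrArg (· * (ν * w)) h1).trans (one_mul _)).symm
      rw [h3, Finset.smul_sum]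
      refine Finset.sum_congr rfl fun k _ => ?_
      have h4 := key M₀ _ _ ((T.obj M₀).op_smul_mem hν (hy k))
      have h5 := congrArg (lin (g k)) h4
      rw [LinearMap.map_smul, LinearMap.map_smul, lin_csmul, LinearMap.map_smul,
        LinearMap.map_smul] at h5
      change lin (g k) (lin (η M₀) (y k)) * ν = (-1 : ℂ) ^ _ • (lin (g k) (y k) * ν * w) at h5
      rw [smul_mul_assoc, h5, smul_smul, neg_one_zpow_mul, mul_assoc,
        neg_one_zpow_congr (l := (m : ℤ) * n) ⟨0, by ring⟩]
    rw [h2, smul_smul, neg_one_zpow_mul, neg_one_zpow_congr (l := 0) ⟨m * n, by ring⟩, zpow_zero,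
      one_smul]
  refine ⟨w, hz, hzc, hw, hwc, fun M => hom_ext_homogeneous fun j x hx => ?_⟩
  rw [lin_act hw hwc hx]
  exact key M j x hx

/-- Every central element of the target comes from the source. -/
lemma exists_corresponds_left {n : ℕ} {w : B} (hw : w ∈ B.gr n) (hwc : w ∈ B.selfBimod.center) :
    ∃ z, Corresponds T n z w := by
  choose e hed he using fun M => hT.exists_map_eq (hasDegree_act (M := T.obj M) hw hwc)
  have hcomm : ∀ {M N : DGMod A} {m : ℤ} {f : M ⟶ N}, HasDegree m f →
      f ≫ e N = (-1 : ℂ) ^ ((n : ℤ) * m) • (e M ≫ f) := by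
    intro M N m f hf
    apply hT.map_injective
    rw [hT.map_smul, T.map_comp, T.map_comp, he, he, lin_act_comm hw hwc (hT.hasDegree_map hf)]
  obtain ⟨hz, hzc⟩ := center_of_comm (hed A.selfMod) fun m f hf => hcomm hf
  refine ⟨_, hz, hzc, hw, hwc, fun M => ?_⟩
  rw [← he]
  refine congrArg T.map (hom_ext_homogeneous fun j x hx => ?_)
  have h := congrArg (fun f => lin f (1 : A.carrier)) (hcomm (hasDegree_ofElem hx))
  have h' : lin (e M) (lin (ofElem hx) (1 : A.carrier)) =
    (-1 : ℂ) ^ (n * j) • lin (ofElem hx) (lin (e A.selfMod) (1 : A.carrier)) := h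
  rw [lin_ofElem, lin_ofElem, MulOpposite.op_one, one_smul] at h'
  rw [lin_act hz hzc hx, h']

lemma corresponds_right_unique {n : ℕ} {z : A} {w w' : B} (h : Corresponds T n z w)
    (h' : Corresponds T n z w') : w = w' := by
  have := hT.isEquivalence
  obtain ⟨M₀, s, g, y, hg, hy, h1⟩ := exists_object (T := T)
  obtain ⟨hz, hzc, hw, hwc, hw1⟩ := h
  obtain ⟨_, _, hw', hwc', hw1'⟩ := h'
  have h2 : ∀ k, op w • y k = op w' • y k := by
    intro k
    have h3 : lin (act (T.obj M₀) hw hwc) (y k) = lin (act (T.obj M₀) hw' hwc') (y k) := by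
      rw [← hw1, ← hw1']
    rw [lin_act _ _ (hy k), lin_act _ _ (hy k)] at h3
    exact smul_right_injective _ (zpow_ne_zero _ (by norm_num)) h3
  have h3 : ∀ v : B.carrier, v = ∑ k ∈ s, lin (g k) (op v • y k) := by
    intro v
    conv_lhs => rw [← one_mul v]
    refine (congrArg (· * v) h1.symm).trans ?_
    rw [Finset.sum_mul]
    exact Finset.sum_congr rfl fun k _ => (LinearMap.map_smul (lin (g k)) (op v) (y k)).symm
  rw [h3 w, h3 w']
  simp only [h2]

lemma corresponds_left_unique {n : ℕ} {z z' : A} {w : B} (h : Corresponds T n z w)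
    (h' : Corresponds T n z' w) : z = z' := by
  obtain ⟨hz, hzc, hw, hwc, hw1⟩ := h
  obtain ⟨hz', hzc', _, _, hw1'⟩ := h'
  rw [← act_selfMod_one hz hzc, ← act_selfMod_one hz' hzc',
    hT.map_injective ((hw1 A.selfMod).trans (hw1' A.selfMod).symm)]

omit hT in
lemma corresponds_one : Corresponds T 0 1 1 := by
  have hA : (1 : A.carrier) ∈ A.selfBimod.center := A.centerSubalgebra.one_mem
  have hB : (1 : B.carrier) ∈ B.selfBimod.center := B.centerSubalgebra.one_mem
  refine ⟨SetLike.GradedOne.one_mem, hA, SetLike.GradedOne.one_mem, hB, fun M => ?_⟩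
  rw [act_one, act_one, T.map_id]

lemma corresponds_add {n : ℕ} {z z' : A} {w w' : B} (h : Corresponds T n z w)
    (h' : Corresponds T n z' w') : Corresponds T n (z + z') (w + w') := by
  obtain ⟨hz, hzc, hw, hwc, hw1⟩ := h
  obtain ⟨hz', hzc', hw', hwc', hw1'⟩ := h'
  have hA : z + z' ∈ A.selfBimod.center := A.centerSubalgebra.add_mem hzc hzc'
  have hB : w + w' ∈ B.selfBimod.center := B.centerSubalgebra.add_mem hwc hwc'
  refine ⟨add_mem hz hz', hA, add_mem hw hw', hB, fun M => ?_⟩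
  rw [act_add _ hz hzc hz' hzc', act_add _ hw hwc hw' hwc', hT.map_add, hw1, hw1']

lemma corresponds_smul {n : ℕ} {z : A} {w : B} (c : ℂ) (h : Corresponds T n z w) :
    Corresponds T n (c • z) (c • w) := by
  obtain ⟨hz, hzc, hw, hwc, hw1⟩ := h
  have hA : c • z ∈ A.selfBimod.center := A.centerSubalgebra.smul_mem hzc c
  have hB : c • w ∈ B.selfBimod.center := B.centerSubalgebra.smul_mem hwc c
  refine ⟨Submodule.smul_mem _ c hz, hA, Submodule.smul_mem _ c hw, hB, fun M => ?_⟩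
  rw [act_smul _ hz hzc, act_smul _ hw hwc, hT.map_smul, hw1]

omit hT in
lemma corresponds_mul {n n' : ℕ} {z z' : A} {w w' : B} (h : Corresponds T n z w)
    (h' : Corresponds T n' z' w') : Corresponds T (n + n') (z * z') (w * w') := by
  obtain ⟨hz, hzc, hw, hwc, hw1⟩ := h
  obtain ⟨hz', hzc', hw', hwc', hw1'⟩ := h'
  refine ⟨SetLike.GradedMul.mul_mem hz hz', A.mul_mem_center hzc hzc',
    SetLike.GradedMul.mul_mem hw hw', B.mul_mem_center hwc hwc', fun M => ?_⟩
  rw [act_mul _ hz hzc hz' hzc', act_mul _ hw hwc hw' hwc', T.map_comp, hw1, hw1']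

lemma corresponds_d {n : ℕ} {z : A} {w : B} (h : Corresponds T n z w) :
    Corresponds T (n + 1) (A.d z) (B.d w) := by
  obtain ⟨hz, hzc, hw, hwc, hw1⟩ := h
  refine ⟨A.d_mem hz, DGAlg.d_mem_center hzc, B.d_mem hw, DGAlg.d_mem_center hwc, fun M => ?_⟩
  rw [← homD_act M hz hzc, ← homD_act _ hw hwc]
  obtain ⟨h1, h2⟩ := hT.map_homD M M n _ (hasDegree_act hz hzc)
  rw [h2]
  congr 1
  exact hw1 M

end IsDGEquivalence

/-! ### The isomorphism of graded centres -/

/-- A multiplicative, `ℂ`-linear relation between homogeneous elements of the same degree, which is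
compatible with the differentials and functional, is the graph of a morphism of dga's. -/
lemma exists_dgHom_of_relation {Z W : DGAlg.{u}} (R : ℕ → Z.carrier → W.carrier → Prop)
    (hmem : ∀ n z w, R n z w → w ∈ W.gr n) (hex : ∀ n, ∀ z ∈ Z.gr n, ∃ w, R n z w)
    (huniq : ∀ n z w w', R n z w → R n z w' → w = w') (hone : R 0 1 1)
    (hadd : ∀ n z w z' w', R n z w → R n z' w' → R n (z + z') (w + w'))
    (hsmul : ∀ n z w (c : ℂ), R n z w → R n (c • z) (c • w))
    (hmul : ∀ n n' z w z' w', R n z w → R n' z' w' → R (n + n') (z * z') (w * w'))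
    (hd : ∀ n z w, R n z w → R (n + 1) (Z.d z) (W.d w)) :
    ∃ φ : DGHom Z W, ∀ n, ∀ z ∈ Z.gr n, R n z (φ.toAlgHom z) := by
  choose f hf using fun n (z : Z.gr n) => hex n z z.2
  let Φ : ∀ n, Z.gr n →ₗ[ℂ] W.gr n := fun n =>
    { toFun := fun z => ⟨f n z, hmem _ _ _ (hf n z)⟩
      map_add' := fun z z' => Subtype.ext
        (huniq n _ _ _ (hf n (z + z')) (hadd n _ _ _ _ (hf n z) (hf n z')))
      map_smul' := fun c z => Subtype.ext
        (huniq n _ _ _ (hf n (c • z)) (hsmul n _ _ c (hf n z))) }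
  let L : Z.carrier →ₗ[ℂ] W.carrier := DirectSum.coeLinearMap W.gr ∘ₗ DirectSum.lmap Φ ∘ₗ
    (DirectSum.decomposeLinearEquiv Z.gr).toLinearMap
  have hL : ∀ n, ∀ z ∈ Z.gr n, R n z (L z) := by
    intro n z hz
    lift z to Z.gr n using hz
    have : L z = Φ n z := by
      simp [L, DirectSum.decomposeLinearEquiv]
    rw [this]
    exact hf n z
  have hL1 : L 1 = 1 := huniq 0 _ _ _ (hL 0 1 SetLike.GradedOne.one_mem) hone
  have hLmul : ∀ a b, L (a * b) = L a * L b := by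
    intro a b
    induction a using DirectSum.Decomposition.inductionOn Z.gr with
    | zero => simp
    | add a a' ha ha' => rw [add_mul, map_add, map_add, add_mul, ha, ha']
    | @homogeneous m a =>
      induction b using DirectSum.Decomposition.inductionOn Z.gr with
      | zero => simp
      | add b b' hb hb' => rw [mul_add, map_add, map_add, mul_add, hb, hb']
      | @homogeneous n b =>
        exact huniq _ _ _ _ (hL (m + n) _ (SetLike.GradedMul.mul_mem a.2 b.2))
          (hmul _ _ _ _ _ _ (hL m a a.2) (hL n b b.2))
  refine ⟨{ AlgHom.ofLinearMap L hL1 hLmul with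
    map_gr := fun {k a} ha => hmem _ _ _ (hL k a ha)
    map_d := fun a => ?_ }, hL⟩
  refine eq_of_homogeneous Z.gr (f := L ∘ₗ Z.d) (g := W.d ∘ₗ L) (fun k x hx => ?_) a
  exact huniq _ _ _ _ (hL (k + 1) _ (Z.d_mem hx)) (hd _ _ _ (hL k x hx))

lemma DGHom.ext_homogeneous {Z W : DGAlg.{u}} {φ ψ : Z.carrier →ₐ[ℂ] W.carrier}
    (h : ∀ n, ∀ z ∈ Z.gr n, φ z = ψ z) (z : Z.carrier) : φ z = ψ z :=
  eq_of_homogeneous Z.gr (f := φ.toLinearMap) (g := ψ.toLinearMap) h z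

/-- Equivalent categories of dg modules have isomorphic graded centres: the graded centre of a dga
is the dga of graded natural endomorphisms of the identity functor. -/
theorem DGMoritaEquivalent.exists_isIso (h : DGMoritaEquivalent A B) :
    ∃ φ : DGHom A.center B.center, φ.IsIso := by
  obtain ⟨T, h1, h2, h3, h4⟩ := h
  have hT : IsDGEquivalence T := ⟨h1, h2, h3, h4⟩
  obtain ⟨φ, hφ⟩ := exists_dgHom_of_relation (Z := A.center) (W := B.center)
    (fun n z w => IsDGEquivalence.Corresponds T n (DGAlg.centerIncl z) (DGAlg.centerIncl w))
    (fun n z w h => h.2.2.1)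
    (fun n z hz => by
      obtain ⟨w, hw⟩ := hT.exists_corresponds_right hz z.2
      exact ⟨⟨w, hw.2.2.2.1⟩, hw⟩)
    (fun n z w w' h h' => Subtype.ext (hT.corresponds_right_unique h h'))
    IsDGEquivalence.corresponds_one
    (fun _ _ _ _ _ h h' => hT.corresponds_add h h')
    (fun _ _ _ c h => hT.corresponds_smul c h)
    (fun _ _ _ _ _ _ h h' => IsDGEquivalence.corresponds_mul h h')
    (fun _ _ _ h => hT.corresponds_d h)
  obtain ⟨ψ, hψ⟩ := exists_dgHom_of_relation (Z := B.center) (W := A.center)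
    (fun n w z => IsDGEquivalence.Corresponds T n (DGAlg.centerIncl z) (DGAlg.centerIncl w))
    (fun n w z h => h.1)
    (fun n w hw => by
      obtain ⟨z, hz⟩ := hT.exists_corresponds_left hw w.2
      exact ⟨⟨z, hz.2.1⟩, hz⟩)
    (fun n w z z' h h' => Subtype.ext (hT.corresponds_left_unique h h'))
    IsDGEquivalence.corresponds_one
    (fun _ _ _ _ _ h h' => hT.corresponds_add h h')
    (fun _ _ _ c h => hT.corresponds_smul c h)
    (fun _ _ _ _ _ _ h h' => IsDGEquivalence.corresponds_mul h h')
    (fun _ _ _ h => hT.corresponds_d h)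
  refine ⟨φ, ψ, fun a => ?_, fun b => ?_⟩
  · refine DGHom.ext_homogeneous (φ := ψ.toAlgHom.comp φ.toAlgHom) (ψ := AlgHom.id ℂ _)
      (fun n z hz => Subtype.ext ?_) a
    exact hT.corresponds_left_unique (hψ n _ (φ.map_gr hz)) (hφ n z hz)
  · refine DGHom.ext_homogeneous (φ := φ.toAlgHom.comp ψ.toAlgHom) (ψ := AlgHom.id ℂ _)
      (fun n w hw => Subtype.ext ?_) b
    exact hT.corresponds_right_unique (hφ n _ (ψ.map_gr hw)) (hψ n w hw)

/-! ### Transport of characters -/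

/-- As inverses of elements of `Z⁰` are in `Z⁰`, characters of `Z⁰` are values in the spectrum, hence
bounded for the norm of the C*-algebra. -/
lemma CStarCompletion.norm_le {Z : DGAlg.{u}} (C : CStarCompletion Z)
    (χ : Z.gr 0 →ₐ[ℂ] ℂ) (a : Z.gr 0) : ‖χ a‖ ≤ ‖C.ι a‖ := by
  have : Nontrivial (Z.gr 0) := χ.toRingHom.domain_nontrivial
  have : Nontrivial C.alg := C.injective.nontrivial
  refine spectrum.norm_le_norm_of_mem (𝕜 := ℂ) (a := C.ι a) fun h => ?_
  have h1 : C.ι (algebraMap ℂ (Z.gr 0) (χ a) - a) = algebraMap ℂ C.alg (χ a) - C.ι a := by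
    rw [map_sub, AlgHom.commutes]
  rw [spectrum.mem_resolventSet_iff, ← h1] at h
  have h2 := (C.isUnit_of_isUnit _ h).map χ
  rw [map_sub, AlgHom.commutes, Algebra.algebraMap_self_apply, sub_self] at h2
  exact not_isUnit_zero h2

/-- A character of the degree zero part of `Z` extends to the C*-algebra. -/
lemma CStarCompletion.exists_char_eq {Z : DGAlg.{u}} (C : CStarCompletion Z)
    (χ : Z.gr 0 →ₐ[ℂ] ℂ) : ∃ p : C.Spec, ∀ z, C.char p z = χ z := by
  let g : C.alg →L[ℂ] ℂ := χ.toLinearMap.extendOfNorm C.ι.toLinearMap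
  have hg : ∀ z, g (C.ι z) = χ z := fun z =>
    LinearMap.extendOfNorm_eq C.dense ⟨1, fun a => by rw [one_mul]; exact C.norm_le χ a⟩ z
  have hmul : ∀ a b, g (a * b) = g a * g b := by
    intro a b
    refine C.dense.induction_on₂ (p := fun a b => g (a * b) = g a * g b) ?_ ?_ a b
    · exact isClosed_eq (by fun_prop) (by fun_prop)
    · intro a b
      rw [← map_mul, hg, hg, hg, map_mul]
  have hone : g 1 = 1 := by
    rw [← map_one C.ι, hg, map_one]
  refine ⟨WeakDual.CharacterSpace.equivAlgHom.symm
    (AlgHom.ofLinearMap g.toLinearMap hone hmul), fun z => ?_⟩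
  exact hg z

/-! ### Central dual bases of projective bimodules -/

lemma GrBimod.smul_eq_of_center {E : GrBimod A} {j k : ℕ} {x : E} (hx : x ∈ E.gr k)
    (hc : x ∈ E.center) {a : A} (ha : a ∈ A.gr j) : a • x = (-1 : ℂ) ^ (j * k) • op a • x :=
  (E.mem_center_of_mem hx).1 hc j a ha

lemma GrBimod.op_smul_eq_of_center {E : GrBimod A} {j k : ℕ} {x : E} (hx : x ∈ E.gr k)
    (hc : x ∈ E.center) {a : A} (ha : a ∈ A.gr j) : op a • x = (-1 : ℂ) ^ (j * k) • a • x := by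
  rw [smul_eq_of_center hx hc ha, smul_smul, ← mul_pow, neg_one_mul, neg_neg, one_pow, one_smul]

lemma GrBimod.smul_eq_of_center₀ {E : GrBimod A} {x : E} (hx : x ∈ E.center₀) (a : A) :
    a • x = op a • x := (E.mem_center₀_iff.1 hx).2 a

lemma DGAlg.commute_of_center₀ {z : A.carrier} (hz : z ∈ A.gr 0) (hc : z ∈ A.selfBimod.center)
    (a : A.carrier) : a * z = z * a :=
  GrBimod.smul_eq_of_center₀ (E := A.selfBimod) ⟨hc, hz⟩ a

/-- Bimodule maps of degree `0` preserve graded centres. -/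
lemma GrBimod.map_mem_center {E F : GrBimod A} (f : E.carrier →ₗ[ℂ] F.carrier)
    (h1 : ∀ (a : A) (x : E), f (a • x) = a • f x) (h2 : ∀ (a : A) (x : E), f (op a • x) = op a • f x)
    (h3 : ∀ {k : ℕ} {x : E}, x ∈ E.gr k → f x ∈ F.gr k) {x : E} (hx : x ∈ E.center) :
    f x ∈ F.center := by
  refine E.mem_of_homogeneous (F.center.comap f) hx fun k y hy hyc => ?_
  refine (F.mem_center_of_mem (h3 hy)).2 fun j ν hν => ?_
  rw [← h1, E.smul_eq_of_center hy hyc hν, map_smul, h2]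

/-- The right multiplication of the graded centre of a bimodule by the graded centre of the dga. -/
def GrBimod.rmul (E : GrBimod A) (x : E.center) (z : A.center) : E.center :=
  ⟨op (DGAlg.centerIncl z) • (x : E), E.op_smul_mem_center x.2 z⟩

lemma GrBimod.coe_rmul (E : GrBimod A) (x : E.center) (z : A.center) :
    (E.rmul x z : E) = op (DGAlg.centerIncl z) • (x : E) := rfl

/-- A finite family of central vectors of degree `0` of a graded bimodule `E` together with
coordinate functions, which are bimodule maps of degree `0` to the dga. It exhibits `E` as a direct
summand of a free bimodule. -/
structure DualBasis (E : GrBimod A) (ι : Type) [Fintype ι] where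
  vec : ι → E
  vec_mem : ∀ i, vec i ∈ E.center₀
  coord : ι → E.carrier →ₗ[ℂ] A.carrier
  coord_smul : ∀ (i : ι) (a : A) (x : E), coord i (a • x) = a * coord i x
  coord_op_smul : ∀ (i : ι) (a : A) (x : E), coord i (op a • x) = coord i x * a
  coord_mem : ∀ (i : ι) {k : ℕ} {x : E}, x ∈ E.gr k → coord i x ∈ A.gr k
  sum_eq : ∀ x : E, ∑ i, op (coord i x) • vec i = x

/-- The basis vectors are the first components of the standard basis, the coordinates those of the
inclusion into the free bimodule. -/
lemma GrBimod.IsFGP.exists_dualBasis {E : GrBimod A} (h : E.IsFGP) :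
    ∃ n, Nonempty (DualBasis E (Fin n)) := by
  obtain ⟨F, n, e, he1, he2, he3⟩ := h
  have hsymm : ∀ v : Fin n → A.carrier, e (e.symm v) = v := e.apply_symm_apply
  let v : Fin n → E × F := fun i => e.symm (Pi.single i 1)
  have hv : ∀ i, (v i).1 ∈ E.gr 0 := fun i => ((he3 0 (v i)).2 fun j => by
    rw [hsymm]
    rcases eq_or_ne j i with rfl | hj
    · rw [Pi.single_eq_same]; exact SetLike.GradedOne.one_mem
    · rw [Pi.single_eq_of_ne hj]; exact Submodule.zero_mem _).1
  have hvc : ∀ i (a : A), a • v i = op a • v i := fun i a => e.injective (funext fun j => by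
    rw [he1, he2, hsymm]
    rcases eq_or_ne j i with rfl | hj
    · rw [Pi.single_eq_same, mul_one, one_mul]
    · rw [Pi.single_eq_of_ne hj, mul_zero, zero_mul])
  have hsmul : ∀ (c : ℂ) (x : E × F) i, e (c • x) i = c • e x i := fun c x i => by
    have h1 : c • x = (algebraMap ℂ A.carrier c) • x :=
      Prod.ext (algebraMap_smul A.carrier c x.1).symm (algebraMap_smul A.carrier c x.2).symm
    rw [h1, he1, Algebra.smul_def]
  refine ⟨n, ⟨{
    vec := fun i => (v i).1
    vec_mem := fun i => E.mem_center₀_iff.2 ⟨hv i, fun a => congrArg Prod.fst (hvc i a)⟩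
    coord := fun i =>
      { toFun := fun x => e (x, 0) i
        map_add' := fun x y => by
          have h1 : ((x + y, 0) : E × F) = (x, 0) + (y, 0) := by simp
          rw [h1, map_add, Pi.add_apply]
        map_smul' := fun c x => by
          have h1 : ((c • x, 0) : E × F) = c • ((x, 0) : E × F) := by simp
          rw [h1, hsmul, RingHom.id_apply] }
    coord_smul := fun i a x => by
      have h1 : ((a • x, 0) : E × F) = a • ((x, 0) : E × F) := by simp
      exact (congrArg (e · i) h1).trans (he1 _ _ _)
    coord_op_smul := fun i a x => by
      have h1 : ((op a • x, 0) : E × F) = op a • ((x, 0) : E × F) := by simp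
      exact (congrArg (e · i) h1).trans (he2 _ _ _)
    coord_mem := fun i k x hx => (he3 k (x, 0)).1 ⟨hx, Submodule.zero_mem _⟩ i
    sum_eq := fun x => by
      have h1 : ∑ i, op (e (x, 0) i) • v i = (x, 0) := e.injective (funext fun j => by
        rw [map_sum, Finset.sum_apply, Finset.sum_eq_single j]
        · rw [he2, hsymm, Pi.single_eq_same, one_mul]
        · intro i _ hi
          rw [he2, hsymm, Pi.single_eq_of_ne hi.symm, zero_mul]
        · exact fun h => (h (Finset.mem_univ _)).elim)
      have h2 := congrArg Prod.fst h1
      rwa [Prod.fst_sum] at h2 }⟩⟩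

namespace DualBasis

variable {E : GrBimod A} {ι : Type} [Fintype ι] (D : DualBasis E ι)

/-- The basis vectors, as elements of the graded centre. -/
def cvec (i : ι) : E.center := ⟨D.vec i, (D.vec_mem i).1⟩

lemma cvec_mem (i : ι) : (D.cvec i : E) ∈ E.gr 0 := (D.vec_mem i).2

lemma coord_mem_center (i : ι) {x : E} (hx : x ∈ E.center) :
    D.coord i x ∈ A.selfBimod.center :=
  GrBimod.map_mem_center (F := A.selfBimod) (D.coord i) (D.coord_smul i) (D.coord_op_smul i)
    (D.coord_mem i) hx

/-- The coordinates of central elements, which are central. -/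
def ccoord (i : ι) : E.center →ₗ[ℂ] A.center.carrier where
  toFun x := ⟨D.coord i x, D.coord_mem_center i x.2⟩
  map_add' x y := Subtype.ext (map_add (D.coord i) (x : E) y)
  map_smul' c x := Subtype.ext (map_smul (D.coord i) c (x : E))

lemma coe_ccoord (i : ι) (x : E.center) : DGAlg.centerIncl (D.ccoord i x) = D.coord i x := rfl

lemma ccoord_rmul (i : ι) (x : E.center) (z : A.center) :
    D.ccoord i (E.rmul x z) = D.ccoord i x * z := Subtype.ext (D.coord_op_smul i _ (x : E))

lemma sum_rmul (x : E.center) : ∑ i, E.rmul (D.cvec i) (D.ccoord i x) = x := by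
  refine Subtype.ext ?_
  rw [AddSubmonoidClass.coe_finsetSum]
  exact D.sum_eq x

/-- A map on the graded centre of `E` extends to `E` by `Σ vᵢ aᵢ ↦ Σ L(vᵢ) aᵢ`. -/
def extend {X : GrBimod A} (L : E.center →ₗ[ℂ] X.carrier) : E.carrier →ₗ[ℂ] X.carrier where
  toFun x := ∑ i, op (D.coord i x) • L (D.cvec i)
  map_add' x y := by simp only [map_add, MulOpposite.op_add, add_smul, Finset.sum_add_distrib]
  map_smul' c x := by
    simp only [map_smul, MulOpposite.op_smul, smul_assoc, Finset.smul_sum, RingHom.id_apply]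

lemma extend_apply {X : GrBimod A} (L : E.center →ₗ[ℂ] X.carrier) (x : E) :
    D.extend L x = ∑ i, op (D.coord i x) • L (D.cvec i) := rfl

variable {X : GrBimod A} {L : E.center →ₗ[ℂ] X.carrier}

lemma extend_op_smul (a : A) (x : E) : D.extend L (op a • x) = op a • D.extend L x := by
  rw [extend_apply, extend_apply, Finset.smul_sum]
  refine Finset.sum_congr rfl fun i _ => ?_
  rw [D.coord_op_smul, MulOpposite.op_mul, mul_smul]

/-- The extension restricts to the original map where that is linear over the graded centre. -/
lemma extend_of_mem (hL : ∀ z x, L (E.rmul x z) = op (DGAlg.centerIncl z) • L x) (x : E.center) :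
    D.extend L x = L x := by
  conv_rhs => rw [← D.sum_rmul x]
  rw [extend_apply, map_sum]
  refine Finset.sum_congr rfl fun i _ => ?_
  rw [hL, coe_ccoord]

/-- The extension is also left linear if central vectors of degree `0` go to such vectors. -/
lemma extend_smul (hc : ∀ x : E.center, (x : E) ∈ E.gr 0 → L x ∈ X.center₀) (a : A) (x : E) :
    D.extend L (a • x) = a • D.extend L x := by
  rw [extend_apply, extend_apply, Finset.smul_sum]
  refine Finset.sum_congr rfl fun i _ => ?_
  rw [D.coord_smul, MulOpposite.op_mul, mul_smul, smul_comm a,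
    GrBimod.smul_eq_of_center₀ (hc (D.cvec i) (D.vec_mem i).2)]

lemma extend_mem (hc : ∀ x : E.center, (x : E) ∈ E.gr 0 → L x ∈ X.center₀) {k : ℕ} {x : E}
    (hx : x ∈ E.gr k) : D.extend L x ∈ X.gr k := by
  rw [extend_apply]
  refine Submodule.sum_mem _ fun i _ => ?_
  have := X.op_smul_mem (D.coord_mem i hx) (hc (D.cvec i) (D.vec_mem i).2).2
  rwa [zero_add] at this

/-- Right linear maps that agree on the basis vectors agree. -/
lemma eq_of_vec {V : Type*} [AddCommGroup V] [Module ℂ V] [Module A.carrierᵐᵒᵖ V]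
    {f g : E.carrier →ₗ[ℂ] V} (hf : ∀ (a : A) x, f (op a • x) = op a • f x)
    (hg : ∀ (a : A) x, g (op a • x) = op a • g x) (h : ∀ i, f (D.vec i) = g (D.vec i)) (x : E) :
    f x = g x := by
  rw [← D.sum_eq x, map_sum, map_sum]
  exact Finset.sum_congr rfl fun i _ => by rw [hf, hg, h]

end DualBasis

/-- The right Leibniz rule in degree `0`, where no sign occurs. -/
lemma FlatObj.nabla_op_smul {E : FlatObj A} {x : E} (hx : x ∈ E.gr 0) (a : A) :
    E.nabla (op a • x) = op a • E.nabla x + op (A.d a) • x := by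
  rw [E.leibniz_right hx, pow_zero, one_smul]

/-- If a map on the graded centre commutes with the connections, so does its extension: both sides
satisfy the Leibniz rule, and they agree on the basis vectors. -/
lemma DualBasis.extend_nabla {E F : FlatObj A} {ι : Type} [Fintype ι]
    (D : DualBasis E.toGrBimod ι) {L : E.center →ₗ[ℂ] F.carrier}
    (hL : ∀ z x, L (E.rmul x z) = op (DGAlg.centerIncl z) • L x)
    (hc : ∀ x : E.center, (x : E) ∈ E.gr 0 → L x ∈ F.center₀)
    (hn : ∀ x : E.center, L ⟨E.nabla x, E.nabla_mem_center x.2⟩ = F.nabla (L x)) (x : E) :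
    D.extend (X := F.toGrBimod) L (E.nabla x) = F.nabla (D.extend (X := F.toGrBimod) L x) := by
  conv_lhs => rw [← D.sum_eq x]
  rw [D.extend_apply L x, map_sum, map_sum, map_sum]
  refine Finset.sum_congr rfl fun i _ => ?_
  rw [E.nabla_op_smul (D.vec_mem i).2, map_add, D.extend_op_smul, D.extend_op_smul,
    F.nabla_op_smul (hc (D.cvec i) (D.vec_mem i).2).2, ← hn]
  have h1 := D.extend_of_mem hL ⟨E.nabla (D.vec i), E.nabla_mem_center (D.vec_mem i).1⟩
  have h2 := D.extend_of_mem hL (D.cvec i)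
  exact congrArg₂ (fun s t => op _ • s + op _ • t) h1 h2

/-! ### Free bimodules and kernels of bimodule maps -/

/-- The homogeneous elements of `A ^ n`. -/
def DGAlg.freeGr (A : DGAlg.{u}) (n : ℕ) (k : ℕ) : Submodule ℂ (Fin n → A.carrier) :=
  Submodule.pi Set.univ fun _ => A.gr k

lemma DGAlg.mem_freeGr {n k : ℕ} {v : Fin n → A.carrier} :
    v ∈ A.freeGr n k ↔ ∀ i, v i ∈ A.gr k := by
  simp [DGAlg.freeGr]

lemma DGAlg.freeGr_isInternal (A : DGAlg.{u}) (n : ℕ) : DirectSum.IsInternal (A.freeGr n) := by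
  classical
  refine isInternal_of_projections _
    (fun k => LinearMap.pi fun i => gradedProj A.gr k ∘ₗ LinearMap.proj i) ?_ ?_ ?_ ?_
  · exact fun k v => mem_freeGr.2 fun i => SetLike.coe_mem _
  · exact fun k v hv => funext fun i => DirectSum.decompose_of_mem_same _ (mem_freeGr.1 hv i)
  · exact fun j k h v hv => funext fun i =>
      DirectSum.decompose_of_mem_ne (ℳ := A.gr) (mem_freeGr.1 hv i) h.symm
  · intro v
    refine ⟨Finset.univ.biUnion fun i => (DirectSum.decompose A.gr (v i)).support,
      funext fun i => ?_⟩
    rw [Finset.sum_apply]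
    refine (DirectSum.sum_support_decompose A.gr (v i)).symm.trans ?_
    refine Finset.sum_subset (Finset.subset_biUnion_of_mem
      (fun i => (DirectSum.decompose A.gr (v i)).support) (Finset.mem_univ i)) fun k _ hk => ?_
    rw [DFinsupp.notMem_support_iff.1 hk, ZeroMemClass.coe_zero]

instance (A : DGAlg.{u}) (n : ℕ) : DirectSum.Decomposition (A.freeGr n) :=
  (A.freeGr_isInternal n).chooseDecomposition

/-- The free graded bimodule `A ^ n`. -/
abbrev DGAlg.freeBimod (A : DGAlg.{u}) (n : ℕ) : GrBimod A where
  carrier := Fin n → A.carrier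
  gr := A.freeGr n
  smul_mem ha hv := DGAlg.mem_freeGr.2 fun i =>
    SetLike.GradedMul.mul_mem ha (DGAlg.mem_freeGr.1 hv i)
  op_smul_mem ha hv := DGAlg.mem_freeGr.2 fun i =>
    SetLike.GradedMul.mul_mem (DGAlg.mem_freeGr.1 hv i) ha

/-- An endomorphism of degree `0` of a graded bimodule. -/
structure GrBimod.IsEnd (V : GrBimod A) (P : V.carrier →ₗ[ℂ] V.carrier) : Prop where
  map_smul : ∀ (a : A) (x : V), P (a • x) = a • P x
  map_op_smul : ∀ (a : A) (x : V), P (op a • x) = op a • P x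
  map_gr : ∀ {k : ℕ} {x : V}, x ∈ V.gr k → P x ∈ V.gr k

namespace GrBimod

variable (V : GrBimod A) {P : V.carrier →ₗ[ℂ] V.carrier} (hP : V.IsEnd P)

include hP in
lemma IsEnd.ker_isInternal : DirectSum.IsInternal
    fun k => (V.gr k).comap (LinearMap.ker P).subtype := by
  classical
  refine isInternal_of_projections _
    (fun k => (gradedProj V.gr k).restrict fun x hx => by
      rw [LinearMap.mem_ker] at hx ⊢
      rw [map_gradedProj V.gr V.gr (fun _ _ h => hP.map_gr h), hx, map_zero]) ?_ ?_ ?_ ?_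
  · exact fun k v => SetLike.coe_mem (DirectSum.decompose V.gr (v : V) k)
  · exact fun k v hv => Subtype.ext (DirectSum.decompose_of_mem_same V.gr hv)
  · exact fun j k h v hv => Subtype.ext (DirectSum.decompose_of_mem_ne V.gr hv h.symm)
  · intro v
    refine ⟨(DirectSum.decompose V.gr (v : V)).support, Subtype.ext ?_⟩
    rw [AddSubmonoidClass.coe_finsetSum]
    exact (DirectSum.sum_support_decompose V.gr (v : V)).symm

/-- The left action on the kernel of an endomorphism. -/
abbrev kerModuleL : Module A.carrier (LinearMap.ker P) :=
  { smul := fun a x => ⟨a • (x : V), by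
      rw [LinearMap.mem_ker, hP.map_smul, x.2, smul_zero]⟩
    one_smul := fun x => Subtype.ext (one_smul A.carrier (x : V))
    mul_smul := fun a b x => Subtype.ext (mul_smul a b (x : V))
    smul_zero := fun a => Subtype.ext (smul_zero (A := V.carrier) a)
    smul_add := fun a x y => Subtype.ext (smul_add a (x : V) (y : V))
    add_smul := fun a b x => Subtype.ext (add_smul a b (x : V))
    zero_smul := fun x => Subtype.ext (zero_smul A.carrier (x : V)) }

/-- The right action on the kernel of an endomorphism. -/
abbrev kerModuleR : Module A.carrierᵐᵒᵖ (LinearMap.ker P) :=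
  { smul := fun a x => ⟨a • (x : V), by
      rw [LinearMap.mem_ker, ← op_unop a, hP.map_op_smul, x.2, smul_zero]⟩
    one_smul := fun x => Subtype.ext (one_smul A.carrierᵐᵒᵖ (x : V))
    mul_smul := fun a b x => Subtype.ext (mul_smul a b (x : V))
    smul_zero := fun a => Subtype.ext (smul_zero (A := V.carrier) a)
    smul_add := fun a x y => Subtype.ext (smul_add a (x : V) (y : V))
    add_smul := fun a b x => Subtype.ext (add_smul a b (x : V))
    zero_smul := fun x => Subtype.ext (zero_smul A.carrierᵐᵒᵖ (x : V)) }

/-- The kernel of an endomorphism of a graded bimodule. -/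
abbrev kerBimod : GrBimod A :=
  letI := kerModuleL V hP
  letI := kerModuleR V hP
  { carrier := LinearMap.ker P
    bimod := ⟨fun a b x => Subtype.ext (smul_comm a b (x : V))⟩
    towerL := ⟨fun c a x => Subtype.ext (smul_assoc c a (x : V))⟩
    towerR := ⟨fun c a x => Subtype.ext (smul_assoc c a (x : V))⟩
    gr := fun k => (V.gr k).comap (LinearMap.ker P).subtype
    decomposition := (IsEnd.ker_isInternal V hP).chooseDecomposition
    smul_mem := fun ha hx => V.smul_mem ha hx
    op_smul_mem := fun ha hx => V.op_smul_mem ha hx }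

include hP in
lemma IsEnd.one_sub : V.IsEnd (1 - P) where
  map_smul a x := by
    simp only [LinearMap.sub_apply, Module.End.one_apply, hP.map_smul, smul_sub]
  map_op_smul a x := by
    simp only [LinearMap.sub_apply, Module.End.one_apply, hP.map_op_smul, smul_sub]
  map_gr hx := sub_mem hx (hP.map_gr hx)

end GrBimod

/-- The range of an idempotent endomorphism of `A ^ n` is a direct summand. -/
lemma GrBimod.isFGP_kerBimod {n : ℕ} {P : (Fin n → A.carrier) →ₗ[ℂ] (Fin n → A.carrier)}
    (hP : (A.freeBimod n).IsEnd P) (hPP : ∀ v, P (P v) = P v) :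
    ((A.freeBimod n).kerBimod (GrBimod.IsEnd.one_sub _ hP)).IsFGP := by
  have hfix : ∀ v : LinearMap.ker (1 - P), P v = v := fun v => (sub_eq_zero.1 v.2).symm
  have hker : ∀ v : LinearMap.ker P, P v = 0 := fun v => v.2
  refine ⟨(A.freeBimod n).kerBimod hP, n,
    { toFun := fun x => (x.1 : Fin n → A.carrier) + (x.2 : Fin n → A.carrier)
      invFun := fun v => (⟨P v, by
        rw [LinearMap.mem_ker, LinearMap.sub_apply, Module.End.one_apply, hPP, sub_self]⟩,
        ⟨v - P v, by rw [LinearMap.mem_ker, map_sub, hPP, sub_self]⟩)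
      left_inv := fun x => Prod.ext
        (Subtype.ext (by
          change P ((x.1 : Fin n → A.carrier) + (x.2 : Fin n → A.carrier)) = _
          rw [map_add, hfix, hker, add_zero]))
        (Subtype.ext (by
          change (x.1 : Fin n → A.carrier) + (x.2 : Fin n → A.carrier) -
            P ((x.1 : Fin n → A.carrier) + (x.2 : Fin n → A.carrier)) = _
          rw [map_add, hfix, hker, add_zero, add_sub_cancel_left]))
      right_inv := fun v => add_sub_cancel (P v) v
      map_add' := fun x y => add_add_add_comm _ _ _ _ }, ?_, ?_, ?_⟩
  · exact fun a x i => (mul_add a _ _).symm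
  · exact fun a x i => (add_mul _ _ a).symm
  · intro k x
    refine ⟨fun h => DGAlg.mem_freeGr.1 (add_mem (S := Submodule ℂ (Fin n → A.carrier)) h.1 h.2),
      fun h => ?_⟩
    have h0 : (x.1 : Fin n → A.carrier) + (x.2 : Fin n → A.carrier) ∈ A.freeGr n k :=
      DGAlg.mem_freeGr.2 h
    have h1 : (x.1 : Fin n → A.carrier) ∈ A.freeGr n k := by
      have := hP.map_gr h0
      rwa [map_add, hfix, hker, add_zero] at this
    refine ⟨h1, ?_⟩
    have := sub_mem h0 h1
    rwa [add_sub_cancel_left] at this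

/-! ### Base change along an isomorphism of graded centres -/

/-- A morphism of graded centres, as a map to the target dga. -/
def DGHom.incl (φ : DGHom A.center B.center) : A.center.carrier →ₗ[ℂ] B.carrier :=
  (show B.center.carrier →ₗ[ℂ] B.carrier from B.centerSubalgebra.val.toLinearMap) ∘ₗ
    φ.toAlgHom.toLinearMap

namespace DGHom

variable (φ : DGHom A.center B.center)

lemma incl_apply (z : A.center) : φ.incl z = DGAlg.centerIncl (φ.toAlgHom z) := rfl

lemma incl_mul (z w : A.center) : φ.incl (z * w) = φ.incl z * φ.incl w :=
  congrArg DGAlg.centerIncl (map_mul φ.toAlgHom z w)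

lemma incl_mem_center (z : A.center) : φ.incl z ∈ B.selfBimod.center := (φ.toAlgHom z).2

lemma incl_mem_gr {k : ℕ} {z : A.center} (hz : DGAlg.centerIncl z ∈ A.gr k) :
    φ.incl z ∈ B.gr k := φ.map_gr (a := z) hz

lemma incl_d (z : A.center) : φ.incl (A.center.d z) = B.d (φ.incl z) :=
  congrArg DGAlg.centerIncl (φ.map_d z)

end DGHom

/-- An isomorphism of graded centres of flat bimodules over different dga's, which is semilinear
over a morphism of the graded centres of the dga's and compatible with degrees and connections. -/
structure CenterEquiv (φ : DGHom A.center B.center) (E : FlatObj A) (F : FlatObj B) where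
  toEquiv : E.center ≃ₗ[ℂ] F.center
  map_rmul : ∀ (z : A.center) (x : E.center),
    toEquiv (E.rmul x z) = F.rmul (toEquiv x) (φ.toAlgHom z)
  map_gr : ∀ {k : ℕ} {x : E.center}, (x : E) ∈ E.gr k → (toEquiv x : F) ∈ F.gr k
  map_gr_symm : ∀ {k : ℕ} {y : F.center}, (y : F) ∈ F.gr k → (toEquiv.symm y : E) ∈ E.gr k
  map_nabla : ∀ x : E.center,
    toEquiv ⟨E.nabla x, E.nabla_mem_center x.2⟩ = ⟨F.nabla (toEquiv x), F.nabla_mem_center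
      (toEquiv x).2⟩

/-- The inverse, over the inverse of the isomorphism of graded centres of the dga's. -/
def CenterEquiv.symm {φ : DGHom A.center B.center} {ψ : DGHom B.center A.center}
    (h : ∀ b, φ.toAlgHom (ψ.toAlgHom b) = b) {E : FlatObj A} {F : FlatObj B}
    (g : CenterEquiv φ E F) : CenterEquiv ψ F E where
  toEquiv := g.toEquiv.symm
  map_rmul z x := by
    rw [LinearEquiv.symm_apply_eq, g.map_rmul, LinearEquiv.apply_symm_apply, h]
  map_gr := g.map_gr_symm
  map_gr_symm hx := by
    rw [LinearEquiv.symm_symm]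
    exact g.map_gr hx
  map_nabla x := by
    rw [LinearEquiv.symm_apply_eq, g.map_nabla]
    simp only [LinearEquiv.apply_symm_apply]

section BaseChange

variable (φ : DGHom A.center B.center) {E : FlatObj A} {n : ℕ}
  (D : DualBasis E.toGrBimod (Fin n))

/-- The coordinates of a central element of `E`, mapped to `B`. -/
def DualBasis.coords : E.center →ₗ[ℂ] (Fin n → B.carrier) :=
  LinearMap.pi fun i => φ.incl ∘ₗ D.ccoord i

namespace DualBasis

lemma coords_apply (x : E.center) (i : Fin n) : D.coords φ x i = φ.incl (D.ccoord i x) := rfl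

lemma coords_rmul (x : E.center) (z : A.center) :
    D.coords φ (E.rmul x z) = op (φ.incl z) • D.coords φ x := by
  funext i
  rw [coords_apply, D.ccoord_rmul, φ.incl_mul]
  rfl

lemma coords_mem_gr {k : ℕ} {x : E.center} (hx : (x : E) ∈ E.gr k) :
    D.coords φ x ∈ B.freeGr n k :=
  DGAlg.mem_freeGr.2 fun i => φ.incl_mem_gr (D.coord_mem i hx)

lemma op_smul_coords {j k : ℕ} {x : E.center} (hx : (x : E) ∈ E.gr k) {b : B} (hb : b ∈ B.gr j) :
    op b • D.coords φ x = (-1 : ℂ) ^ (j * k) • b • D.coords φ x :=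
  funext fun i => GrBimod.op_smul_eq_of_center (E := B.selfBimod)
    (φ.incl_mem_gr (D.coord_mem i hx)) (φ.incl_mem_center _) hb

lemma op_smul_coords₀ {x : E.center} (hx : (x : E) ∈ E.gr 0) (b : B) :
    op b • D.coords φ x = b • D.coords φ x :=
  funext fun i => (DGAlg.commute_of_center₀
    (φ.incl_mem_gr (z := D.ccoord i x) (D.coord_mem i hx)) (φ.incl_mem_center _) b).symm

/-- The projection of `B ^ n` onto the base change of `E`: the matrix of the coordinates of the
basis vectors. -/
def proj : (Fin n → B.carrier) →ₗ[ℂ] (Fin n → B.carrier) where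
  toFun v := ∑ j, op (v j) • D.coords φ (D.cvec j)
  map_add' v w := by
    simp only [Pi.add_apply, MulOpposite.op_add, add_smul, Finset.sum_add_distrib]
  map_smul' c v := by
    simp only [Pi.smul_apply, MulOpposite.op_smul, smul_assoc, Finset.smul_sum, RingHom.id_apply]

lemma proj_apply (v : Fin n → B.carrier) :
    D.proj φ v = ∑ j, op (v j) • D.coords φ (D.cvec j) := rfl

lemma proj_coords (x : E.center) : D.proj φ (D.coords φ x) = D.coords φ x := by
  conv_rhs => rw [← D.sum_rmul x]
  rw [map_sum, proj_apply]
  exact Finset.sum_congr rfl fun i _ => (D.coords_rmul φ _ _).symm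

lemma proj_op_smul (b : B) (v : Fin n → B.carrier) :
    D.proj φ (op b • v) = op b • D.proj φ v := by
  rw [proj_apply, proj_apply, Finset.smul_sum]
  refine Finset.sum_congr rfl fun i _ => ?_
  rw [Pi.smul_apply, op_smul_eq_mul, MulOpposite.op_mul, mul_smul]

lemma proj_isEnd : (B.freeBimod n).IsEnd (D.proj φ) where
  map_smul b v := by
    rw [proj_apply, proj_apply, Finset.smul_sum]
    refine Finset.sum_congr rfl fun i _ => ?_
    rw [Pi.smul_apply, smul_eq_mul, MulOpposite.op_mul, mul_smul,
      D.op_smul_coords₀ φ (D.cvec_mem i), smul_comm]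
  map_op_smul b v := D.proj_op_smul φ b v
  map_gr {k v} hv := by
    rw [proj_apply]
    refine (B.freeGr n k).sum_mem fun i _ => ?_
    have := (B.freeBimod n).op_smul_mem (DGAlg.mem_freeGr.1 hv i)
      (D.coords_mem_gr φ (D.cvec_mem i))
    rwa [zero_add] at this

lemma proj_proj (v : Fin n → B.carrier) : D.proj φ (D.proj φ v) = D.proj φ v := by
  rw [proj_apply φ D v, map_sum]
  exact Finset.sum_congr rfl fun i _ => by rw [proj_op_smul, proj_coords]

/-- The derivative of a central element. -/
def _root_.NCGeom.FlatObj.cnabla (E : FlatObj A) (x : E.center) : E.center :=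
  ⟨E.nabla x, E.nabla_mem_center x.2⟩

/-- The connection on the base change of `E`, defined on all of `B ^ n` by
`v ↦ Σ ∇(eⱼ) vⱼ + eⱼ d(vⱼ)`. -/
def conn : (Fin n → B.carrier) →ₗ[ℂ] (Fin n → B.carrier) where
  toFun v := ∑ j, (op (v j) • D.coords φ (E.cnabla (D.cvec j)) +
    op (B.d (v j)) • D.coords φ (D.cvec j))
  map_add' v w := by
    rw [← Finset.sum_add_distrib]
    refine Finset.sum_congr rfl fun j _ => ?_
    rw [Pi.add_apply, map_add, MulOpposite.op_add, MulOpposite.op_add, add_smul, add_smul]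
    abel
  map_smul' c v := by
    simp only [Pi.smul_apply, map_smul, MulOpposite.op_smul, smul_assoc, Finset.smul_sum,
      RingHom.id_apply, smul_add]

lemma conn_apply (v : Fin n → B.carrier) :
    D.conn φ v = ∑ j, (op (v j) • D.coords φ (E.cnabla (D.cvec j)) +
      op (B.d (v j)) • D.coords φ (D.cvec j)) := rfl

lemma cnabla_rmul {x : E.center} (hx : (x : E) ∈ E.gr 0) (z : A.center) :
    E.cnabla (E.rmul x z) = E.rmul (E.cnabla x) z + E.rmul x (A.center.d z) :=
  Subtype.ext (FlatObj.nabla_op_smul hx _)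

/-- On central elements of `E`, the connection is the original one. -/
lemma conn_coords (x : E.center) : D.conn φ (D.coords φ x) = D.coords φ (E.cnabla x) := by
  have h1 : E.cnabla x = ∑ j, E.cnabla (E.rmul (D.cvec j) (D.ccoord j x)) := by
    refine Subtype.ext ?_
    rw [AddSubmonoidClass.coe_finsetSum]
    refine Eq.trans ?_ (map_sum E.nabla _ _)
    exact congrArg E.nabla (D.sum_eq x).symm
  rw [h1, map_sum, conn_apply]
  refine Finset.sum_congr rfl fun j _ => ?_
  rw [cnabla_rmul (D.cvec_mem j), map_add, coords_rmul, coords_rmul, φ.incl_d]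
  rfl

/-- The connection takes values in the base change. -/
lemma proj_conn (v : Fin n → B.carrier) : D.proj φ (D.conn φ v) = D.conn φ v := by
  rw [conn_apply, map_sum]
  exact Finset.sum_congr rfl fun i _ => by
    rw [map_add, proj_op_smul, proj_op_smul, proj_coords, proj_coords]

/-- On the base change, where `D.proj φ v = v`, this is the right Leibniz rule. -/
lemma conn_op_smul {k : ℕ} {v : Fin n → B.carrier} (hv : v ∈ B.freeGr n k) (b : B) :
    D.conn φ (op b • v) = op b • D.conn φ v + (-1 : ℂ) ^ k • op (B.d b) • D.proj φ v := by
  rw [conn_apply, conn_apply, proj_apply, Finset.smul_sum, Finset.smul_sum, Finset.smul_sum,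
    ← Finset.sum_add_distrib]
  refine Finset.sum_congr rfl fun j _ => ?_
  rw [Pi.smul_apply, op_smul_eq_mul, B.leibniz (DGAlg.mem_freeGr.1 hv j), MulOpposite.op_mul,
    mul_smul, MulOpposite.op_add, add_smul, MulOpposite.op_smul, smul_assoc, MulOpposite.op_mul,
    MulOpposite.op_mul, mul_smul, mul_smul, smul_add, add_assoc]

/-- The left Leibniz rule. It holds because the coordinates of `eⱼ` and `∇ eⱼ` are graded-central, of
degrees `0` and `1`. -/
lemma conn_smul {k : ℕ} {b : B} (hb : b ∈ B.gr k) (v : Fin n → B.carrier) :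
    D.conn φ (b • v) = B.d b • D.proj φ v + (-1 : ℂ) ^ k • b • D.conn φ v := by
  rw [conn_apply, conn_apply, proj_apply, Finset.smul_sum, Finset.smul_sum, Finset.smul_sum,
    ← Finset.sum_add_distrib]
  refine Finset.sum_congr rfl fun j _ => ?_
  have h1 : ((E.cnabla (D.cvec j) : E.center) : E) ∈ E.gr 1 := E.nabla_mem (D.cvec_mem j)
  have h0 := D.op_smul_coords₀ φ (D.cvec_mem j)
  rw [Pi.smul_apply, smul_eq_mul, B.leibniz hb, MulOpposite.op_mul, mul_smul,
    MulOpposite.op_add, add_smul, MulOpposite.op_smul, smul_assoc, MulOpposite.op_mul,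
    MulOpposite.op_mul, mul_smul, mul_smul, h0, h0 b, D.op_smul_coords φ h1 hb, mul_one,
    smul_comm (B.d b), smul_add, smul_add, smul_comm b (op (v j)), smul_comm b (op (B.d (v j))),
    smul_comm (op (v j)) (_ : ℂ)]
  abel

lemma conn_mem {k : ℕ} {v : Fin n → B.carrier} (hv : v ∈ B.freeGr n k) :
    D.conn φ v ∈ B.freeGr n (k + 1) := by
  rw [conn_apply]
  refine (B.freeGr n (k + 1)).sum_mem fun j _ => add_mem ?_ ?_
  · have h1 : ((E.cnabla (D.cvec j) : E.center) : E) ∈ E.gr 1 := E.nabla_mem (D.cvec_mem j)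
    have := (B.freeBimod n).op_smul_mem (DGAlg.mem_freeGr.1 hv j) (D.coords_mem_gr φ h1)
    rwa [add_comm] at this
  · have := (B.freeBimod n).op_smul_mem (B.d_mem (DGAlg.mem_freeGr.1 hv j))
      (D.coords_mem_gr φ (D.cvec_mem j))
    rwa [zero_add] at this

lemma conn_conn (v : Fin n → B.carrier) : D.conn φ (D.conn φ v) = 0 := by
  rw [conn_apply φ D v, map_sum]
  refine Finset.sum_eq_zero fun j _ => ?_
  have h1 : ((E.cnabla (D.cvec j) : E.center) : E) ∈ E.gr 1 := E.nabla_mem (D.cvec_mem j)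
  have h2 : E.cnabla (E.cnabla (D.cvec j)) = 0 := Subtype.ext (E.flat _)
  rw [map_add, D.conn_op_smul φ (D.coords_mem_gr φ h1),
    D.conn_op_smul φ (D.coords_mem_gr φ (D.cvec_mem j)), conn_coords, conn_coords, h2, map_zero,
    smul_zero, proj_coords, proj_coords, B.d_d, MulOpposite.op_zero, zero_smul, smul_zero]
  simp

/-- The base change of a flat bimodule, as the image of an idempotent matrix. -/
def baseChange : FlatObj B where
  toGrBimod := (B.freeBimod n).kerBimod (GrBimod.IsEnd.one_sub _ (D.proj_isEnd φ))
  fgp := GrBimod.isFGP_kerBimod (D.proj_isEnd φ) (D.proj_proj φ)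
  nabla := (D.conn φ).restrict fun v _ => by
    rw [LinearMap.mem_ker, LinearMap.sub_apply, Module.End.one_apply, proj_conn, sub_self]
  nabla_mem hx := D.conn_mem φ hx
  leibniz_right {k x} hx b := Subtype.ext (by
    have h : D.proj φ x = x := (sub_eq_zero.1 x.2).symm
    have := D.conn_op_smul φ (v := x.1) hx b
    rw [h] at this
    exact this)
  leibniz_left {k b} hb x := Subtype.ext (by
    have h : D.proj φ x = x := (sub_eq_zero.1 x.2).symm
    have := D.conn_smul φ hb x.1
    rw [h] at this
    exact this)
  flat x := Subtype.ext (D.conn_conn φ x)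

/-- The inclusion of the base change into `B ^ n`. -/
def baseChangeVal : (D.baseChange φ).carrier →ₗ[ℂ] (Fin n → B.carrier) :=
  (LinearMap.ker (1 - D.proj φ)).subtype

lemma baseChangeVal_injective : Function.Injective (D.baseChangeVal φ) := Subtype.val_injective

lemma proj_baseChangeVal (x : D.baseChange φ) :
    D.proj φ (D.baseChangeVal φ x) = D.baseChangeVal φ x :=
  (sub_eq_zero.1 (Subtype.property (p := (· ∈ LinearMap.ker (1 - D.proj φ))) x)).symm

lemma mem_baseChange_gr {k : ℕ} {x : D.baseChange φ} :
    x ∈ (D.baseChange φ).gr k ↔ ∀ i, D.baseChangeVal φ x i ∈ B.gr k := DGAlg.mem_freeGr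

/-- An element of the base change is central if and only if its coordinates are. -/
lemma mem_baseChange_center {x : D.baseChange φ} :
    x ∈ (D.baseChange φ).center ↔ ∀ i, D.baseChangeVal φ x i ∈ B.selfBimod.center := by
  have hcomp : ∀ i k, D.baseChangeVal φ ((D.baseChange φ).comp x k) i =
      B.selfBimod.comp (D.baseChangeVal φ x i) k := fun i k =>
    map_gradedProj (D.baseChange φ).gr B.gr (f := LinearMap.proj i ∘ₗ D.baseChangeVal φ)
      (fun k y hy => (D.mem_baseChange_gr φ).1 hy i) k x
  constructor
  · intro h i k j ν hν
    have h1 := congrArg (fun y => D.baseChangeVal φ y i) (h k j ν hν)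
    rw [← hcomp]
    exact h1
  · intro h k j ν hν
    refine D.baseChangeVal_injective φ (funext fun i => ?_)
    have h1 := h i k j ν hν
    rw [← hcomp] at h1
    exact h1

/-- The central coordinates of a central element of the base change. -/
def baseChangeCoord (i : Fin n) (y : (D.baseChange φ).center) : B.center :=
  ⟨D.baseChangeVal φ y i, (D.mem_baseChange_center φ).1 y.2 i⟩

end DualBasis

end BaseChange

/-- Every flat bimodule has a base change along an isomorphism of graded centres. -/
lemma exists_centerEquiv {φ : DGHom A.center B.center} {ψ : DGHom B.center A.center}
    (h₁ : ∀ a, ψ.toAlgHom (φ.toAlgHom a) = a) (h₂ : ∀ b, φ.toAlgHom (ψ.toAlgHom b) = b)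
    (E : FlatObj A) : ∃ F : FlatObj B, Nonempty (CenterEquiv φ E F) := by
  obtain ⟨n, ⟨D⟩⟩ := E.fgp.exists_dualBasis
  let f : E.center → (D.baseChange φ).center := fun x =>
    ⟨⟨D.coords φ x, by
      rw [LinearMap.mem_ker, LinearMap.sub_apply, Module.End.one_apply, D.proj_coords, sub_self]⟩,
      (D.mem_baseChange_center φ).2 fun i => φ.incl_mem_center _⟩
  have hf : ∀ x, D.baseChangeVal φ (f x) = D.coords φ x := fun x => rfl
  let g : (D.baseChange φ).center → E.center := fun y =>
    ∑ i, E.rmul (D.cvec i) (ψ.toAlgHom (D.baseChangeCoord φ i y))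
  have hfg : ∀ y, f (g y) = y := fun y => Subtype.ext (D.baseChangeVal_injective φ (by
    rw [hf]
    refine Eq.trans ?_ (D.proj_baseChangeVal φ y)
    rw [map_sum, D.proj_apply]
    refine Finset.sum_congr rfl fun i _ => ?_
    rw [D.coords_rmul, φ.incl_apply, h₂]
    rfl))
  have hgf : ∀ x, g (f x) = x := fun x => by
    conv_rhs => rw [← D.sum_rmul x]
    change ∑ i, E.rmul (D.cvec i) (ψ.toAlgHom (D.baseChangeCoord φ i (f x))) = _
    refine Finset.sum_congr rfl fun i _ => ?_
    exact congrArg (E.rmul (D.cvec i)) (h₁ (D.ccoord i x))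
  have hgr : ∀ {k : ℕ} {x : E.center}, (x : E) ∈ E.gr k →
      (f x : D.baseChange φ) ∈ (D.baseChange φ).gr k := fun hx => D.coords_mem_gr φ hx
  refine ⟨D.baseChange φ, ⟨{
    toEquiv :=
      { toFun := f
        invFun := g
        left_inv := hgf
        right_inv := hfg
        map_add' := fun x y => Subtype.ext (D.baseChangeVal_injective φ (map_add (D.coords φ) x y))
        map_smul' := fun c x => Subtype.ext
          (D.baseChangeVal_injective φ (map_smul (D.coords φ) c x)) }
    map_rmul := fun z x => Subtype.ext (D.baseChangeVal_injective φ (D.coords_rmul φ x z))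
    map_gr := hgr
    map_gr_symm := fun {k y} hy => ?_
    map_nabla := fun x => Subtype.ext (D.baseChangeVal_injective φ (D.conn_coords φ x).symm) }⟩⟩
  change ((∑ i, E.rmul (D.cvec i) (ψ.toAlgHom (D.baseChangeCoord φ i y)) : E.center) : E) ∈ _
  rw [AddSubmonoidClass.coe_finsetSum]
  refine Submodule.sum_mem _ fun i _ => ?_
  have := E.op_smul_mem (ψ.map_gr
    (a := D.baseChangeCoord φ i y)
    ((D.mem_baseChange_gr φ).1 hy i)) (D.cvec_mem i)
  rwa [zero_add] at this

/-! ### Transport along isomorphisms of graded centres -/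

/-- A linear map that vanishes on the kernel of a surjection factors through it. -/
lemma exists_factor {V W U : Type*} [AddCommGroup V] [Module ℂ V] [AddCommGroup W] [Module ℂ W]
    [AddCommGroup U] [Module ℂ U] {p : V →ₗ[ℂ] W} (hp : Function.Surjective p) {q : V →ₗ[ℂ] U}
    (h : LinearMap.ker p ≤ LinearMap.ker q) : ∃ c : W →ₗ[ℂ] U, ∀ v, c (p v) = q v := by
  refine ⟨(LinearMap.ker p).liftQ q h ∘ₗ (p.quotKerEquivOfSurjective hp).symm.toLinearMap,
    fun v => ?_⟩
  have h1 : (p.quotKerEquivOfSurjective hp).symm (p v) = Submodule.Quotient.mk v := by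
    rw [LinearEquiv.symm_apply_eq]
    rfl
  rw [LinearMap.comp_apply, LinearEquiv.coe_coe, h1]
  exact Submodule.liftQ_apply _ _ _

namespace DualBasis

variable {E : GrBimod A} {ι : Type} [Fintype ι]

lemma coord_eq_sum (D : DualBasis E ι) (i : ι) (x : E) :
    D.coord i x = ∑ k, D.coord i (D.vec k) * D.coord k x := by
  conv_lhs => rw [← D.sum_eq x]
  rw [map_sum]
  exact Finset.sum_congr rfl fun k _ => D.coord_op_smul _ _ _

/-- Coordinates that are right linear and whose values on the basis vectors are central of degree
`0` are bimodule maps of degree `0`. -/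
lemma exists_of_right {vec : ι → E} (hvec : ∀ i, vec i ∈ E.center₀)
    {coord : ι → E.carrier →ₗ[ℂ] A.carrier}
    (hop : ∀ (i : ι) (a : A) (x : E), coord i (op a • x) = coord i x * a)
    (hsum : ∀ x : E, ∑ i, op (coord i x) • vec i = x)
    (h0 : ∀ i j, coord i (vec j) ∈ A.gr 0) (hc : ∀ i j, coord i (vec j) ∈ A.selfBimod.center) :
    ∃ D : DualBasis E ι, D.vec = vec ∧ D.coord = coord := by
  refine ⟨⟨vec, hvec, coord, fun i a x => ?_, hop, fun i k x hx => ?_, hsum⟩, rfl, rfl⟩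
  · conv_lhs => rw [← hsum x]
    conv_rhs => rw [← hsum x]
    rw [Finset.smul_sum, map_sum, map_sum, Finset.mul_sum]
    refine Finset.sum_congr rfl fun j _ => ?_
    rw [smul_comm a, GrBimod.smul_eq_of_center₀ (hvec j), hop, hop, hop, ← mul_assoc,
      DGAlg.commute_of_center₀ (h0 i j) (hc i j)]
  · -- only the components of degree `k` of the coordinates contribute to `x`
    have h1 : x = ∑ j, op (gradedProj A.gr k (coord j x)) • vec j := by
      have h2 := congrArg (gradedProj E.gr k) (hsum x)
      rw [map_sum] at h2
      have h3 : gradedProj E.gr k x = x := DirectSum.decompose_of_mem_same _ hx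
      rw [h3] at h2
      refine h2.symm.trans (Finset.sum_congr rfl fun j _ => ?_)
      let f : A.carrier →ₗ[ℂ] E.carrier :=
        { toFun := fun a => op a • vec j
          map_add' := fun a b => by rw [MulOpposite.op_add, add_smul]
          map_smul' := fun c a => by rw [MulOpposite.op_smul, smul_assoc, RingHom.id_apply] }
      refine (map_gradedProj A.gr E.gr (f := f) (fun l a ha => ?_) k (coord j x)).symm
      have := E.op_smul_mem ha (hvec j).2
      rwa [zero_add] at this
    rw [h1, map_sum]
    refine Submodule.sum_mem _ fun j _ => ?_
    rw [hop]
    have := SetLike.GradedMul.mul_mem (A := A.gr) (h0 i j)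
      (SetLike.coe_mem (DirectSum.decompose A.gr (coord j x) k))
    rwa [zero_add] at this

end DualBasis

section Transport

variable {φ : DGHom A.center B.center} {ψ : DGHom B.center A.center}

/-- Central dual bases are transported along isomorphisms of graded centres. -/
lemma CenterEquiv.exists_dualBasis
    (h₂ : ∀ b, φ.toAlgHom (ψ.toAlgHom b) = b) {E : FlatObj A} {F : FlatObj B}
    (g : CenterEquiv φ E F) {ι : Type} [Fintype ι] (D : DualBasis E.toGrBimod ι) :
    ∃ D' : DualBasis F.toGrBimod ι, (∀ i, D'.vec i = g.toEquiv (D.cvec i)) ∧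
      ∀ i (x : E.center), D'.coord i (g.toEquiv x : F) = φ.incl (D.ccoord i x) := by
  obtain ⟨n, ⟨D₀⟩⟩ := F.fgp.exists_dualBasis
  let L : ι → F.center →ₗ[ℂ] B.selfBimod.carrier := fun i =>
    φ.incl ∘ₗ D.ccoord i ∘ₗ g.toEquiv.symm.toLinearMap
  have hL : ∀ i z x, L i (F.rmul x z) = op (DGAlg.centerIncl z) • L i x := by
    intro i z x
    have h := (g.symm h₂).map_rmul z x
    have h' : g.toEquiv.symm (F.rmul x z) = E.rmul (g.toEquiv.symm x) (ψ.toAlgHom z) := h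
    change φ.incl (D.ccoord i (g.toEquiv.symm (F.rmul x z))) = _
    rw [h', D.ccoord_rmul, φ.incl_mul, φ.incl_apply (ψ.toAlgHom z), h₂]
    rfl
  let C : ι → F.carrier →ₗ[ℂ] B.carrier := fun i => D₀.extend (L i)
  have hC : ∀ (i : ι) (b : B) (x : F), C i (op b • x) = C i x * b :=
    fun i b x => D₀.extend_op_smul b x
  have hg : ∀ i (x : E.center), C i (g.toEquiv x : F) = φ.incl (D.ccoord i x) := by
    intro i x
    refine (D₀.extend_of_mem (hL i) (g.toEquiv x)).trans ?_
    change φ.incl (D.ccoord i (g.toEquiv.symm (g.toEquiv x))) = _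
    rw [LinearEquiv.symm_apply_apply]
  have hsum : ∀ x : F, ∑ i, op (C i x) • (g.toEquiv (D.cvec i) : F) = x := by
    intro x
    let f : F.carrier →ₗ[ℂ] F.carrier :=
      { toFun := fun x => ∑ i, op (C i x) • (g.toEquiv (D.cvec i) : F)
        map_add' := fun x y => by
          rw [← Finset.sum_add_distrib]
          refine Finset.sum_congr rfl fun i _ => ?_
          rw [map_add, MulOpposite.op_add, add_smul]
        map_smul' := fun c x => by
          rw [RingHom.id_apply, Finset.smul_sum]
          refine Finset.sum_congr rfl fun i _ => ?_
          rw [map_smul, MulOpposite.op_smul, smul_assoc] }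
    refine D₀.eq_of_vec (f := f) (g := LinearMap.id) (fun a x => ?_) (fun _ _ => rfl)
      (fun i => ?_) x
    · change ∑ i, _ = op a • ∑ i, _
      rw [Finset.smul_sum]
      refine Finset.sum_congr rfl fun i _ => ?_
      rw [hC, MulOpposite.op_mul, mul_smul]
    · have h1 : g.toEquiv (g.toEquiv.symm (D₀.cvec i)) = D₀.cvec i :=
        LinearEquiv.apply_symm_apply _ _
      have h2 := congrArg (fun y => (g.toEquiv y : F)) (D.sum_rmul (g.toEquiv.symm (D₀.cvec i)))
      have h3 : (D₀.vec i : F) = (g.toEquiv (g.toEquiv.symm (D₀.cvec i)) : F) :=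
        congrArg Subtype.val h1.symm
      simp only [map_sum, AddSubmonoidClass.coe_finsetSum] at h2
      rw [LinearMap.id_apply]
      refine Eq.trans ?_ (h2.trans h3.symm)
      refine Finset.sum_congr rfl fun j _ => ?_
      rw [g.map_rmul, F.coe_rmul, ← φ.incl_apply, ← hg, h1]
      rfl
  obtain ⟨D', h1, h2⟩ := DualBasis.exists_of_right (E := F.toGrBimod)
    (vec := fun i => (g.toEquiv (D.cvec i) : F)) (coord := C)
    (fun i => ⟨(g.toEquiv (D.cvec i)).2, g.map_gr (D.cvec_mem i)⟩)
    hC hsum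
    (fun i j => by
      rw [hg]
      exact φ.incl_mem_gr (D.coord_mem i (D.cvec_mem j)))
    (fun i j => by
      rw [hg]
      exact φ.incl_mem_center _)
  refine ⟨D', fun i => by rw [h1], fun i x => ?_⟩
  rw [h2]
  exact hg i x

/-- Morphisms preserve graded centres. -/
def FlatObj.Hom.center {E E' : FlatObj A} (f : E ⟶ E') : E.center →ₗ[ℂ] E'.center :=
  f.lin.restrict fun _ hx => GrBimod.map_mem_center f.lin f.map_smul f.map_op_smul f.map_gr hx

/-- Morphisms are transported along isomorphisms of graded centres. -/
lemma CenterEquiv.exists_hom (h₂ : ∀ b, φ.toAlgHom (ψ.toAlgHom b) = b)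
    {E E' : FlatObj A} {F F' : FlatObj B} (g : CenterEquiv φ E F) (g' : CenterEquiv φ E' F')
    (f : E ⟶ E') : ∃ f' : F ⟶ F', ∀ x : E.center,
      f'.lin (g.toEquiv x : F) = (g'.toEquiv (FlatObj.Hom.center f x) : F') := by
  obtain ⟨n, ⟨D⟩⟩ := F.fgp.exists_dualBasis
  let L : F.center →ₗ[ℂ] F'.carrier := F'.center.subtype ∘ₗ g'.toEquiv.toLinearMap ∘ₗ
    FlatObj.Hom.center f ∘ₗ g.toEquiv.symm.toLinearMap
  have hL' : ∀ x, L x = (g'.toEquiv (FlatObj.Hom.center f (g.toEquiv.symm x)) : F') :=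
    fun _ => rfl
  have hL : ∀ z x, L (F.rmul x z) = op (DGAlg.centerIncl z) • L x := by
    intro z x
    have h1 : g.toEquiv.symm (F.rmul x z) = E.rmul (g.toEquiv.symm x) (ψ.toAlgHom z) :=
      (g.symm h₂).map_rmul z x
    have h2 : ∀ y z, FlatObj.Hom.center f (E.rmul y z) = E'.rmul (FlatObj.Hom.center f y) z :=
      fun y z => Subtype.ext (f.map_op_smul _ _)
    rw [hL', hL', h1, h2, g'.map_rmul, h₂]
    rfl
  have hc : ∀ x : F.center, (x : F) ∈ F.gr 0 → L x ∈ F'.center₀ := fun x hx =>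
    ⟨(g'.toEquiv _).2, g'.map_gr (f.map_gr (g.map_gr_symm hx))⟩
  have hn : ∀ x : F.center, L ⟨F.nabla x, F.nabla_mem_center x.2⟩ = F'.nabla (L x) := by
    intro x
    have h1 := (g.symm h₂).map_nabla x
    have h2 : ∀ y : E.center, FlatObj.Hom.center f ⟨E.nabla y, E.nabla_mem_center y.2⟩ =
        ⟨E'.nabla (FlatObj.Hom.center f y), E'.nabla_mem_center (FlatObj.Hom.center f y).2⟩ :=
      fun y => Subtype.ext (f.map_nabla _)
    have h3 : g.toEquiv.symm ⟨F.nabla x, F.nabla_mem_center x.2⟩ =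
      ⟨E.nabla (g.toEquiv.symm x), E.nabla_mem_center (g.toEquiv.symm x).2⟩ := h1
    rw [hL', hL', h3, h2, g'.map_nabla]
  refine ⟨⟨D.extend (X := F'.toGrBimod) L, D.extend_smul hc, D.extend_op_smul, D.extend_mem hc,
    D.extend_nabla hL hc hn⟩, fun x => ?_⟩
  change D.extend (X := F'.toGrBimod) L (g.toEquiv x : F) = _
  rw [D.extend_of_mem (X := F'.toGrBimod) hL, hL', LinearEquiv.symm_apply_apply]

end Transport

section BaseChange

variable {φ : DGHom A.center B.center} {ψ : DGHom B.center A.center} {E : FlatObj A}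
  {F : FlatObj B}

/-- The base change map of an isomorphism of graded centres: `F` is generated by its graded centre,
with the relations that come from that of `B` only. -/
def CenterEquiv.toBaseChange (h₂ : ∀ b, φ.toAlgHom (ψ.toAlgHom b) = b) (g : CenterEquiv φ E F) :
    BaseChange φ E F where
  lin := F.center.subtype ∘ₗ g.toEquiv.toLinearMap
  mem_center x := (g.toEquiv x).2
  semilinear z x := congrArg Subtype.val (g.map_rmul z x)
  map_gr hx := g.map_gr hx
  map_nabla x := congrArg Subtype.val (g.map_nabla x)
  surjective y := by
    obtain ⟨n, ⟨D⟩⟩ := F.fgp.exists_dualBasis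
    refine ⟨∑ i, g.toEquiv.symm (D.cvec i) ⊗ₜ[ℂ] D.coord i y, ?_⟩
    rw [map_sum]
    refine Eq.trans (Finset.sum_congr rfl fun i _ => ?_) (D.sum_eq y)
    rw [TensorProduct.lift.tmul]
    change op (D.coord i y) • (g.toEquiv (g.toEquiv.symm (D.cvec i)) : F) = _
    rw [LinearEquiv.apply_symm_apply]
    rfl
  ker_eq := by
    obtain ⟨n, ⟨D⟩⟩ := F.fgp.exists_dualBasis
    apply le_antisymm
    · intro t ht
      rw [LinearMap.mem_ker] at ht
      set p := TensorProduct.lift (F.actBil (F.center.subtype ∘ₗ g.toEquiv.toLinearMap)) with hp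
      set S : Submodule ℂ (E.center ⊗[ℂ] B.carrier) := Submodule.span ℂ _ with hS
      -- modulo the relations, `t` only depends on the coordinates of its image in `F`
      have key : ∀ t, t - ∑ i, g.toEquiv.symm (D.cvec i) ⊗ₜ[ℂ] D.coord i (p t) ∈ S := by
        intro t
        induction t with
        | zero => simp
        | add s t hs ht =>
          have := add_mem hs ht
          simp only [map_add, tmul_add, Finset.sum_add_distrib]
          rwa [add_sub_add_comm]
        | tmul x b =>
          have h1 : x = ∑ i, E.rmul (g.toEquiv.symm (D.cvec i))
              (ψ.toAlgHom (D.ccoord i (g.toEquiv x))) := by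
            apply g.toEquiv.injective
            rw [map_sum]
            refine (D.sum_rmul (g.toEquiv x)).symm.trans (Finset.sum_congr rfl fun i _ => ?_)
            rw [g.map_rmul, h₂, LinearEquiv.apply_symm_apply]
          have h2 : ∀ i, D.coord i (p (x ⊗ₜ[ℂ] b)) =
              DGAlg.centerIncl (φ.toAlgHom (ψ.toAlgHom (D.ccoord i (g.toEquiv x)))) * b := by
            intro i
            rw [h₂, hp, TensorProduct.lift.tmul]
            exact D.coord_op_smul i b _
          conv =>
            enter [2, 1, 2]
            rw [h1]
          rw [TensorProduct.sum_tmul, ← Finset.sum_sub_distrib]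
          refine Submodule.sum_mem _ fun i _ => Submodule.subset_span ?_
          rw [h2]
          exact ⟨_, _, _, rfl⟩
      have := key t
      rw [ht] at this
      simpa using this
    · refine Submodule.span_le.2 ?_
      rintro _ ⟨z, x, b, rfl⟩
      rw [SetLike.mem_coe, LinearMap.mem_ker, map_sub, TensorProduct.lift.tmul,
        TensorProduct.lift.tmul]
      change op b • (g.toEquiv (E.rmul x z) : F) - op (_ * b) • (g.toEquiv x : F) = 0
      rw [g.map_rmul, F.coe_rmul, MulOpposite.op_mul, mul_smul, sub_self]

/-- A base change of `E` inherits the central dual bases of `E`. -/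
lemma BaseChange.exists_dualBasis (f : BaseChange φ E F) {ι : Type} [Fintype ι]
    (D : DualBasis E.toGrBimod ι) :
    ∃ D' : DualBasis F.toGrBimod ι, (∀ i, D'.vec i = f.lin (D.cvec i)) ∧
      ∀ i (x : E.center), D'.coord i (f.lin x) = φ.incl (D.ccoord i x) := by
  have hsl : ∀ z x, f.lin (E.rmul x z) = op (φ.incl z) • f.lin x := f.semilinear
  let q : ι → E.center ⊗[ℂ] B.carrier →ₗ[ℂ] B.carrier := fun i =>
    TensorProduct.lift (LinearMap.mul ℂ B.carrier ∘ₗ φ.incl ∘ₗ D.ccoord i)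
  have hq : ∀ i x b, q i (x ⊗ₜ b) = φ.incl (D.ccoord i x) * b := fun _ _ _ => rfl
  have hker : ∀ i, LinearMap.ker (TensorProduct.lift (F.actBil f.lin)) ≤ LinearMap.ker (q i) := by
    intro i
    rw [f.ker_eq]
    refine Submodule.span_le.2 ?_
    rintro _ ⟨z, x, b, rfl⟩
    rw [SetLike.mem_coe, LinearMap.mem_ker, map_sub, hq, hq]
    have h1 := D.ccoord_rmul i x z
    change φ.incl (D.ccoord i (E.rmul x z)) * b - _ = 0
    rw [h1, φ.incl_mul, mul_assoc]
    exact sub_self _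
  choose C hC using fun i => exists_factor f.surjective (hker i)
  have hC' : ∀ i x b, C i (op b • f.lin x) = φ.incl (D.ccoord i x) * b :=
    fun i x b => hC i (x ⊗ₜ b)
  have hC1 : ∀ i x, C i (f.lin x) = φ.incl (D.ccoord i x) := fun i x => by
    have := hC' i x 1
    rwa [MulOpposite.op_one, one_smul, mul_one] at this
  have hind : ∀ (P : F → Prop), P 0 → (∀ x y, P x → P y → P (x + y)) →
      (∀ x (b : B), P (op b • f.lin x)) → ∀ y, P y := by
    intro P h0 hadd h y
    obtain ⟨t, rfl⟩ := f.surjective y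
    induction t with
    | zero => rw [map_zero]; exact h0
    | add s t hs ht => rw [map_add]; exact hadd _ _ hs ht
    | tmul x b => exact h x b
  have hop : ∀ (i : ι) (b : B) (x : F), C i (op b • x) = C i x * b := by
    intro i b y
    refine hind (fun y => C i (op b • y) = C i y * b) ?_ ?_ ?_ y
    · rw [smul_zero, map_zero, zero_mul]
    · intro x y hx hy
      rw [smul_add, map_add, map_add, hx, hy, add_mul]
    · intro x b'
      rw [← mul_smul, ← MulOpposite.op_mul, hC', hC', mul_assoc]
  have hsum : ∀ y : F, ∑ i, op (C i y) • f.lin (D.cvec i) = y := by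
    intro y
    refine hind (fun y => ∑ i, op (C i y) • f.lin (D.cvec i) = y) ?_ ?_ ?_ y
    · simp
    · intro x y hx hy
      conv_rhs => rw [← hx, ← hy]
      rw [← Finset.sum_add_distrib]
      exact Finset.sum_congr rfl fun i _ => by rw [map_add, MulOpposite.op_add, add_smul]
    · intro x b
      conv_rhs => rw [← D.sum_rmul x]
      rw [map_sum, Finset.smul_sum]
      refine Finset.sum_congr rfl fun i _ => ?_
      rw [hC', hsl, MulOpposite.op_mul, mul_smul]
  obtain ⟨D', h1, h2⟩ := DualBasis.exists_of_right (E := F.toGrBimod)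
    (vec := fun i => f.lin (D.cvec i)) (coord := C)
    (fun i => ⟨f.mem_center _, f.map_gr (D.cvec_mem i)⟩) hop hsum
    (fun i j => by rw [hC1]; exact φ.incl_mem_gr (D.coord_mem i (D.cvec_mem j)))
    (fun i j => by rw [hC1]; exact φ.incl_mem_center _)
  exact ⟨D', fun i => by rw [h1], fun i x => by rw [h2, hC1]⟩

/-- Base change along an isomorphism of graded centres of dga's does not change the graded centre of
a bimodule. -/
lemma BaseChange.exists_centerEquiv (h₁ : ∀ a, ψ.toAlgHom (φ.toAlgHom a) = a)
    (h₂ : ∀ b, φ.toAlgHom (ψ.toAlgHom b) = b) (f : BaseChange φ E F) :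
    ∃ g : CenterEquiv φ E F, ∀ x, (g.toEquiv x : F) = f.lin x := by
  obtain ⟨n, ⟨D⟩⟩ := E.fgp.exists_dualBasis
  obtain ⟨D', hv, hc⟩ := f.exists_dualBasis D
  let l : E.center →ₗ[ℂ] F.center := f.lin.codRestrict _ f.mem_center
  have hφ : ∀ z w : A.center, φ.incl z = φ.incl w → z = w := by
    intro z w h
    have h' : φ.toAlgHom z = φ.toAlgHom w := Subtype.ext h
    rw [← h₁ z, ← h₁ w, h']
  have hcc : ∀ i x, D'.ccoord i (l x) = φ.toAlgHom (D.ccoord i x) := fun i x =>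
    Subtype.ext (hc i x)
  have hinj : Function.Injective l := by
    intro x y h
    rw [← D.sum_rmul x, ← D.sum_rmul y]
    refine Finset.sum_congr rfl fun i _ => congrArg (E.rmul (D.cvec i)) (hφ _ _ ?_)
    rw [← hc, ← hc]
    exact congrArg (fun y : F.center => D'.coord i (y : F)) h
  have hsurj : Function.Surjective l := by
    intro y
    refine ⟨∑ i, E.rmul (D.cvec i) (ψ.toAlgHom (D'.ccoord i y)), ?_⟩
    rw [map_sum]
    refine Eq.trans (Finset.sum_congr rfl fun i _ => Subtype.ext ?_) (D'.sum_rmul y)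
    refine (f.semilinear _ (D.cvec i)).trans ?_
    rw [h₂, F.coe_rmul, ← hv]
    rfl
  let e := LinearEquiv.ofBijective l ⟨hinj, hsurj⟩
  refine ⟨⟨e, fun z x => Subtype.ext (f.semilinear z x), fun hx => f.map_gr hx, fun {k y} hy => ?_,
    fun x => Subtype.ext (f.map_nabla x)⟩, fun _ => rfl⟩
  obtain ⟨x, rfl⟩ := e.surjective y
  rw [LinearEquiv.symm_apply_apply, ← D.sum_rmul x, AddSubmonoidClass.coe_finsetSum]
  refine Submodule.sum_mem _ fun i _ => ?_
  have h3 : DGAlg.centerIncl (D.ccoord i x) ∈ A.gr k := by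
    have h4 : φ.toAlgHom (D.ccoord i x) ∈ B.center.gr k := by
      rw [← hcc]
      exact D'.coord_mem i hy
    have h5 := ψ.map_gr h4
    have h6 : ψ.toAlgHom (φ.toAlgHom (D.ccoord i x)) ∈ A.center.gr k := h5
    rw [h₁] at h6
    exact h6
  have := E.op_smul_mem h3 (D.cvec_mem i)
  rwa [zero_add] at this

end BaseChange

/-! ### Transport of tensor products -/

section Tensor

variable {E E' G : FlatObj A} {ι κ : Type} [Fintype ι] [Fintype κ]
  (D : DualBasis E.toGrBimod ι) (D' : DualBasis E'.toGrBimod κ)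

lemma Pairing.bil_op_smul_left (b : Pairing E E' G) {y : E'} (hy : y ∈ E'.center₀) (a : A)
    (x : E) : b.bil (op a • x) y = op a • b.bil x y := by
  rw [b.balanced, GrBimod.smul_eq_of_center₀ hy, b.smul_right]

/-- A pairing of sums of basis vectors. -/
lemma Pairing.bil_eq_sum (b : Pairing E E' G) (x : E) (y : E') :
    b.bil x y = ∑ p : ι × κ, op (D.coord p.1 x * D'.coord p.2 y) •
      b.bil (D.vec p.1) (D'.vec p.2) := by
  conv_lhs => rw [← D.sum_eq x, ← D'.sum_eq y]
  rw [map_sum b.bil, LinearMap.sum_apply, Fintype.sum_prod_type]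
  refine Finset.sum_congr rfl fun i _ => ?_
  rw [map_sum]
  refine Finset.sum_congr rfl fun j _ => ?_
  rw [b.smul_right, b.bil_op_smul_left (D'.vec_mem j), MulOpposite.op_mul, mul_smul]

/-- The products of the vectors of central dual bases of `E` and `E'` form a central dual basis of
`E ⊗ E'`. -/
lemma Pairing.IsTensor.exists_dualBasis {b : Pairing E E' G} (hb : b.IsTensor) :
    ∃ D'' : DualBasis G.toGrBimod (ι × κ),
      (∀ p, D''.vec p = b.bil (D.vec p.1) (D'.vec p.2)) ∧
      ∀ p x y, D''.coord p (b.bil x y) = D.coord p.1 x * D'.coord p.2 y := by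
  let q : ι × κ → E.carrier ⊗[ℂ] E'.carrier →ₗ[ℂ] A.carrier := fun p =>
    TensorProduct.lift ((LinearMap.mul ℂ A.carrier).compl₁₂ (D.coord p.1) (D'.coord p.2))
  have hq : ∀ p x y, q p (x ⊗ₜ y) = D.coord p.1 x * D'.coord p.2 y := fun _ _ _ => rfl
  have hker : ∀ p, LinearMap.ker (TensorProduct.lift b.bil) ≤ LinearMap.ker (q p) := by
    intro p
    rw [hb.2]
    refine Submodule.span_le.2 ?_
    rintro _ ⟨a, x, y, rfl⟩
    rw [SetLike.mem_coe, LinearMap.mem_ker, map_sub, hq, hq, D.coord_op_smul, D'.coord_smul,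
      mul_assoc, sub_self]
  choose C hC using fun p => exists_factor hb.1 (hker p)
  have hC' : ∀ p x y, C p (b.bil x y) = D.coord p.1 x * D'.coord p.2 y :=
    fun p x y => hC p (x ⊗ₜ y)
  have hind : ∀ (P : G → Prop), P 0 → (∀ x y, P x → P y → P (x + y)) →
      (∀ x y, P (b.bil x y)) → ∀ z, P z := by
    intro P h0 hadd h z
    obtain ⟨t, rfl⟩ := hb.1 z
    induction t with
    | zero => rw [map_zero]; exact h0
    | add s t hs ht => rw [map_add]; exact hadd _ _ hs ht
    | tmul x y => exact h x y
  obtain ⟨D'', h1, h2⟩ := DualBasis.exists_of_right (E := G.toGrBimod)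
    (vec := fun p : ι × κ => b.bil (D.vec p.1) (D'.vec p.2)) (coord := C)
    (fun p => b.mem_center₀ (D.vec_mem p.1) (D'.vec_mem p.2))
    (fun p a z => by
      refine hind (fun z => C p (op a • z) = C p z * a) ?_ ?_ ?_ z
      · rw [smul_zero, map_zero, zero_mul]
      · intro x y hx hy
        rw [smul_add, map_add, map_add, hx, hy, add_mul]
      · intro x y
        rw [← b.smul_right, hC', hC', D'.coord_op_smul, mul_assoc])
    (fun z => by
      refine hind (fun z => ∑ p, op (C p z) • b.bil (D.vec p.1) (D'.vec p.2) = z) ?_ ?_ ?_ z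
      · simp
      · intro x y hx hy
        conv_rhs => rw [← hx, ← hy]
        rw [← Finset.sum_add_distrib]
        exact Finset.sum_congr rfl fun i _ => by rw [map_add, MulOpposite.op_add, add_smul]
      · intro x y
        conv_rhs => rw [b.bil_eq_sum D D' x y]
        exact Finset.sum_congr rfl fun p _ => by rw [hC'])
    (fun p r => by
      rw [hC']
      exact SetLike.GradedMul.mul_mem (D.coord_mem p.1 (D.vec_mem r.1).2)
        (D'.coord_mem p.2 (D'.vec_mem r.2).2))
    (fun p r => by
      rw [hC']
      exact A.mul_mem_center (D.coord_mem_center p.1 (D.vec_mem r.1).1)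
        (D'.coord_mem_center p.2 (D'.vec_mem r.2).1))
  exact ⟨D'', fun p => by rw [h1], fun p x y => by rw [h2, hC']⟩

/-- The converse: products of dual bases detect tensor products. -/
lemma Pairing.isTensor_of_dualBasis {b : Pairing E E' G} (D'' : DualBasis G.toGrBimod (ι × κ))
    (h1 : ∀ p, D''.vec p = b.bil (D.vec p.1) (D'.vec p.2))
    (h2 : ∀ p x y, D''.coord p (b.bil x y) = D.coord p.1 x * D'.coord p.2 y) : b.IsTensor := by
  constructor
  · intro z
    refine ⟨∑ p, D.vec p.1 ⊗ₜ[ℂ] (op (D''.coord p z) • D'.vec p.2), ?_⟩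
    rw [map_sum]
    refine Eq.trans (Finset.sum_congr rfl fun p _ => ?_) (D''.sum_eq z)
    rw [TensorProduct.lift.tmul, b.smul_right, h1]
  · apply le_antisymm
    · intro t ht
      rw [LinearMap.mem_ker] at ht
      set S : Submodule ℂ (E.carrier ⊗[ℂ] E'.carrier) := Submodule.span ℂ _ with hS
      -- modulo the relations, `t` only depends on the coordinates of its image in `G`
      have key : ∀ t, t - ∑ p : ι × κ, D.vec p.1 ⊗ₜ[ℂ]
          (op (D''.coord p (TensorProduct.lift b.bil t)) • D'.vec p.2) ∈ S := by
        intro t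
        induction t with
        | zero => simp
        | add s t hs ht =>
          have := add_mem hs ht
          simp only [map_add, MulOpposite.op_add, add_smul, tmul_add, Finset.sum_add_distrib]
          rwa [add_sub_add_comm]
        | tmul x y =>
          have e1 : x ⊗ₜ[ℂ] y = ∑ i, (op (D.coord i x) • D.vec i) ⊗ₜ[ℂ] y := by
            rw [← TensorProduct.sum_tmul, D.sum_eq]
          have e2 : ∀ i, D.vec i ⊗ₜ[ℂ] (D.coord i x • y) =
              ∑ j, D.vec i ⊗ₜ[ℂ] (op (D.coord i x * D'.coord j y) • D'.vec j) := by
            intro i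
            rw [← TensorProduct.tmul_sum]
            refine congrArg (fun y => D.vec i ⊗ₜ[ℂ] y) ?_
            conv_lhs => rw [← D'.sum_eq y]
            rw [Finset.smul_sum]
            refine Finset.sum_congr rfl fun j _ => ?_
            rw [smul_comm, GrBimod.smul_eq_of_center₀ (D'.vec_mem j), MulOpposite.op_mul, mul_smul]
          rw [TensorProduct.lift.tmul, Fintype.sum_prod_type]
          simp only [h2]
          rw [Finset.sum_congr rfl fun i _ => (e2 i).symm, e1, ← Finset.sum_sub_distrib]
          exact Submodule.sum_mem _ fun i _ => Submodule.subset_span ⟨_, _, _, rfl⟩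
      have := key t
      rw [ht] at this
      simpa using this
    · refine Submodule.span_le.2 ?_
      rintro _ ⟨a, x, y, rfl⟩
      rw [SetLike.mem_coe, LinearMap.mem_ker, map_sub, TensorProduct.lift.tmul,
        TensorProduct.lift.tmul, b.balanced, sub_self]

/-- The product of central elements is central. -/
lemma Pairing.mem_center (b : Pairing E E' G) {x : E} {y : E'} (hx : x ∈ E.center)
    (hy : y ∈ E'.center) : b.bil x y ∈ G.center := by
  obtain ⟨n, ⟨D⟩⟩ := E.fgp.exists_dualBasis
  obtain ⟨m, ⟨D'⟩⟩ := E'.fgp.exists_dualBasis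
  rw [b.bil_eq_sum D D']
  exact G.center.sum_mem fun p _ => G.op_smul_mem_center
    (b.mem_center₀ (D.vec_mem p.1) (D'.vec_mem p.2)).1
    (⟨_, A.mul_mem_center (D.coord_mem_center p.1 hx) (D'.coord_mem_center p.2 hy)⟩ : A.center)

end Tensor

/-- Tensor products are transported along isomorphisms of graded centres. -/
lemma CenterEquiv.exists_pairing {φ : DGHom A.center B.center} {ψ : DGHom B.center A.center}
    (h₂ : ∀ b, φ.toAlgHom (ψ.toAlgHom b) = b) {E E' G : FlatObj A} {F F' H : FlatObj B}
    (g : CenterEquiv φ E F) (g' : CenterEquiv φ E' F') (g'' : CenterEquiv φ G H)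
    {b : Pairing E E' G} (hb : b.IsTensor) :
    ∃ c : Pairing F F' H, c.IsTensor ∧ ∀ (x : E.center) (y : E'.center),
      c.bil (g.toEquiv x) (g'.toEquiv y) = g''.toEquiv ⟨b.bil x y, b.mem_center x.2 y.2⟩ := by
  obtain ⟨n, ⟨D⟩⟩ := E.fgp.exists_dualBasis
  obtain ⟨m, ⟨D'⟩⟩ := E'.fgp.exists_dualBasis
  obtain ⟨D'', hv, hc⟩ := hb.exists_dualBasis D D'
  obtain ⟨C, Cv, Cc⟩ := g.exists_dualBasis h₂ D
  obtain ⟨C', Cv', Cc'⟩ := g'.exists_dualBasis h₂ D'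
  obtain ⟨C'', Cv'', Cc''⟩ := g''.exists_dualBasis h₂ D''
  obtain ⟨β, hβ⟩ : ∃ β : F.carrier →ₗ[ℂ] F'.carrier →ₗ[ℂ] H.carrier, ∀ x y, β x y =
      ∑ p : Fin n × Fin m, op (C.coord p.1 x * C'.coord p.2 y) • C''.vec p :=
    ⟨LinearMap.mk₂ ℂ
      (fun x y => ∑ p : Fin n × Fin m, op (C.coord p.1 x * C'.coord p.2 y) • C''.vec p)
      (fun x x' y => by
        simp only [map_add, add_mul, MulOpposite.op_add, add_smul, Finset.sum_add_distrib])
      (fun c x y => by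
        simp only [map_smul, smul_mul_assoc, MulOpposite.op_smul, smul_assoc, Finset.smul_sum])
      (fun x y y' => by
        simp only [map_add, mul_add, MulOpposite.op_add, add_smul, Finset.sum_add_distrib])
      (fun c x y => by
        simp only [map_smul, mul_smul_comm, MulOpposite.op_smul, smul_assoc, Finset.smul_sum]),
      fun _ _ => rfl⟩
  -- in coordinates the pairing is the product, so its properties can be checked on coordinates
  have hcoord : ∀ p x y, C''.coord p (β x y) = C.coord p.1 x * C'.coord p.2 y := by
    intro p x y
    rw [hβ, map_sum, C.coord_eq_sum p.1 x, C'.coord_eq_sum p.2 y, Finset.sum_mul_sum,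
      Fintype.sum_prod_type]
    refine Finset.sum_congr rfl fun k _ => Finset.sum_congr rfl fun l _ => ?_
    have e : C''.coord p (C''.vec (k, l)) = C.coord p.1 (C.vec k) * C'.coord p.2 (C'.vec l) := by
      rw [Cv'', Cc'', Cv, Cc, Cv', Cc', ← φ.incl_mul]
      refine congrArg φ.incl (Subtype.ext ?_)
      refine Eq.trans ?_ (hc p (D.vec k) (D'.vec l))
      exact congrArg (D''.coord p) (hv (k, l))
    rw [C''.coord_op_smul, e, mul_assoc, mul_assoc, ← mul_assoc (C'.coord p.2 (C'.vec l)),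
      ← mul_assoc (C.coord k x),
      DGAlg.commute_of_center₀ (C'.coord_mem p.2 (C'.vec_mem l).2)
        (C'.coord_mem_center p.2 (C'.vec_mem l).1) (C.coord k x)]
  have hext : ∀ z w : H, (∀ p, C''.coord p z = C''.coord p w) → z = w := fun z w h => by
    rw [← C''.sum_eq z, ← C''.sum_eq w]
    exact Finset.sum_congr rfl fun p _ => by rw [h]
  have hcenter : ∀ (x : E.center) (y : E'.center),
      β (g.toEquiv x) (g'.toEquiv y) = g''.toEquiv ⟨b.bil x y, b.mem_center x.2 y.2⟩ := by
    intro x y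
    refine hext _ _ fun p => ?_
    rw [hcoord, Cc, Cc', Cc'', ← φ.incl_mul]
    exact congrArg φ.incl (Subtype.ext (hc p x y).symm)
  have hsl : ∀ (a : B) (x : F) (y : F'), β (a • x) y = a • β x y := fun a x y =>
    hext _ _ fun p => by rw [hcoord, C.coord_smul, C''.coord_smul, hcoord, mul_assoc]
  have hbal : ∀ (a : B) (x : F) (y : F'), β (op a • x) y = β x (a • y) := fun a x y =>
    hext _ _ fun p => by rw [hcoord, C.coord_op_smul, hcoord, C'.coord_smul, mul_assoc]
  have hsr : ∀ (a : B) (x : F) (y : F'), β x (op a • y) = op a • β x y := fun a x y =>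
    hext _ _ fun p => by rw [hcoord, C'.coord_op_smul, C''.coord_op_smul, hcoord, mul_assoc]
  have hgr : ∀ {i j : ℕ} {x : F} {y : F'}, x ∈ F.gr i → y ∈ F'.gr j → β x y ∈ H.gr (i + j) := by
    intro i j x y hx hy
    rw [hβ]
    refine Submodule.sum_mem _ fun p _ => ?_
    have := H.op_smul_mem
      (SetLike.GradedMul.mul_mem (C.coord_mem p.1 hx) (C'.coord_mem p.2 hy)) (C''.vec_mem p).2
    rwa [zero_add] at this
  have hβv : ∀ k l, β (C.vec k) (C'.vec l) = C''.vec (k, l) := by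
    intro k l
    rw [Cv, Cv', Cv'', hcenter]
    exact congrArg (fun z => (g''.toEquiv z : H)) (Subtype.ext (hv (k, l)).symm)
  -- the Leibniz rule for the basis vectors comes from that of the original pairing
  have hnv : ∀ k l, H.nabla (C''.vec (k, l)) =
      β (F.nabla (C.vec k)) (C'.vec l) + β (C.vec k) (F'.nabla (C'.vec l)) := by
    intro k l
    have e1 : F.nabla (C.vec k) = g.toEquiv (E.cnabla (D.cvec k)) := by
      rw [Cv]
      exact congrArg Subtype.val (g.map_nabla (D.cvec k)).symm
    have e2 : F'.nabla (C'.vec l) = g'.toEquiv (E'.cnabla (D'.cvec l)) := by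
      rw [Cv']
      exact congrArg Subtype.val (g'.map_nabla (D'.cvec l)).symm
    have e3 : H.nabla (C''.vec (k, l)) = g''.toEquiv (G.cnabla (D''.cvec (k, l))) := by
      rw [Cv'']
      exact congrArg Subtype.val (g''.map_nabla (D''.cvec (k, l))).symm
    rw [e1, e2, e3, Cv, Cv', hcenter, hcenter, ← Submodule.coe_add, ← map_add]
    refine congrArg (fun z => (g''.toEquiv z : H)) (Subtype.ext ?_)
    change G.nabla (D''.vec (k, l)) = b.bil (E.nabla (D.vec k)) (D'.vec l) +
      b.bil (D.vec k) (E'.nabla (D'.vec l))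
    rw [hv, b.map_nabla _ (D.vec_mem k).2, pow_zero, one_smul]
  have hn0 : ∀ {i : ℕ} (k : Fin n) (l : Fin m) {r : B} (s : B), r ∈ B.gr i →
      H.nabla (β (op r • C.vec k) (op s • C'.vec l)) =
        β (F.nabla (op r • C.vec k)) (op s • C'.vec l) +
          (-1 : ℂ) ^ i • β (op r • C.vec k) (F'.nabla (op s • C'.vec l)) := by
    intro i k l r s hr
    have hl := C'.vec_mem l
    have hop : ∀ (a : B) (x : F), β (op a • x) (C'.vec l) = op a • β x (C'.vec l) :=
      fun a x => by rw [hbal, GrBimod.smul_eq_of_center₀ hl, hsr]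
    have hop' : β (op r • C.vec k) (F'.nabla (C'.vec l)) =
        (-1 : ℂ) ^ i • op r • β (C.vec k) (F'.nabla (C'.vec l)) := by
      have h1 : F'.nabla (C'.vec l) ∈ F'.gr 1 := F'.nabla_mem hl.2
      rw [hbal, GrBimod.smul_eq_of_center h1 (F'.nabla_mem_center hl.1) hr, map_smul, hsr, mul_one]
    have hsq : (-1 : ℂ) ^ i * (-1) ^ i = 1 := by rw [← mul_pow]; simp
    rw [hsr, hop, hβv, ← mul_smul, ← MulOpposite.op_mul, H.nabla_op_smul (C''.vec_mem (k, l)).2,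
      hnv, B.leibniz hr, F.nabla_op_smul (C.vec_mem k).2, F'.nabla_op_smul hl.2, hsr, map_add,
      LinearMap.add_apply, hop, hop, map_add, hsr, hsr, hop', hop, hβv, MulOpposite.op_add,
      MulOpposite.op_smul, MulOpposite.op_mul, MulOpposite.op_mul, MulOpposite.op_mul, add_smul,
      smul_assoc, mul_smul, mul_smul, mul_smul, smul_comm (op s) ((-1 : ℂ) ^ i)]
    simp only [smul_add, smul_smul ((-1 : ℂ) ^ i), hsq, one_smul]
    abel
  have hn : ∀ {i : ℕ} {x : F} (y : F'), x ∈ F.gr i →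
      H.nabla (β x y) = β (F.nabla x) y + (-1 : ℂ) ^ i • β x (F'.nabla y) := by
    intro i x y hx
    conv_lhs => rw [← C.sum_eq x, ← C'.sum_eq y]
    conv_rhs => rw [← C.sum_eq x, ← C'.sum_eq y]
    simp only [map_sum, LinearMap.sum_apply, Finset.smul_sum]
    rw [← Finset.sum_add_distrib]
    refine Finset.sum_congr rfl fun l _ => ?_
    rw [← Finset.sum_add_distrib]
    exact Finset.sum_congr rfl fun k _ => hn0 k l _ (C.coord_mem k hx)
  let c : Pairing F F' H := ⟨β, hsl, hbal, hsr, hgr, hn⟩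
  exact ⟨c, Pairing.isTensor_of_dualBasis C C' C'' (fun p => (hβv p.1 p.2).symm) hcoord, hcenter⟩

/-! ### Fibres -/

section Fibres

variable {φ : DGHom A.center B.center} {ψ : DGHom B.center A.center}
  {χ : A.center.gr 0 →ₐ[ℂ] ℂ} {η : B.center.gr 0 →ₐ[ℂ] ℂ}

/-- The restriction to the degree zero parts. -/
def CenterEquiv.center₀Map {E : FlatObj A} {F : FlatObj B} (g : CenterEquiv φ E F) :
    E.center₀ →ₗ[ℂ] F.center₀ where
  toFun x := ⟨g.toEquiv ⟨x, x.2.1⟩, (g.toEquiv _).2, g.map_gr x.2.2⟩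
  map_add' x y := Subtype.ext
    (congrArg (fun z : F.center => (z : F)) (g.toEquiv.map_add ⟨x, x.2.1⟩ ⟨y, y.2.1⟩))
  map_smul' c x := Subtype.ext
    (congrArg (fun z : F.center => (z : F)) (g.toEquiv.map_smul c ⟨x, x.2.1⟩))

/-- The map of fibres given by an isomorphism of graded centres. -/
def CenterEquiv.fibreMap {E : FlatObj A} {F : FlatObj B} (g : CenterEquiv φ E F)
    (h : ∀ z, χ z = η (φ.zero z)) : Fibre χ E →ₗ[ℂ] Fibre η F :=
  fibreMapAux χ (ψ := η) g.center₀Map φ.zero (fun z => (h z).symm) fun z x y hxy => by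
    refine Eq.trans ?_ (congrArg Subtype.val (g.map_rmul z ⟨x, x.2.1⟩))
    exact congrArg (fun y => (g.toEquiv y : F)) (Subtype.ext hxy)

/-- Characters that correspond along `φ` correspond along its inverse. -/
lemma char_symm (h₂ : ∀ b, φ.toAlgHom (ψ.toAlgHom b) = b) (h : ∀ z, χ z = η (φ.zero z))
    (w : B.center.gr 0) : η w = χ (ψ.zero w) := by
  rw [h]
  exact congrArg η (Subtype.ext (h₂ w).symm)

/-- The isomorphism of fibres given by an isomorphism of graded centres. -/
def CenterEquiv.fibreEquiv (h₂ : ∀ b, φ.toAlgHom (ψ.toAlgHom b) = b) {E : FlatObj A}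
    {F : FlatObj B} (g : CenterEquiv φ E F) (h : ∀ z, χ z = η (φ.zero z)) :
    Fibre χ E ≃ₗ[ℂ] Fibre η F :=
  LinearEquiv.ofLinearMap (g.fibreMap h) ((g.symm h₂).fibreMap (char_symm h₂ h))
    (Submodule.linearMap_qext _ (LinearMap.ext fun y =>
      congrArg Submodule.Quotient.mk (Subtype.ext
        (congrArg (fun z : F.center => (z : F)) (g.toEquiv.apply_symm_apply ⟨y, y.2.1⟩)))))
    (Submodule.linearMap_qext _ (LinearMap.ext fun x =>
      congrArg Submodule.Quotient.mk (Subtype.ext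
        (congrArg (fun z : E.center => (z : E)) (g.toEquiv.symm_apply_apply ⟨x, x.2.1⟩)))))

/-- The map of fibres of a base change is that of the isomorphism of graded centres it restricts
to. -/
lemma BaseChange.fibreMap_eq {E : FlatObj A} {F : FlatObj B} (f : BaseChange φ E F)
    (g : CenterEquiv φ E F) (hg : ∀ x, (g.toEquiv x : F) = f.lin x)
    (h : ∀ z, χ z = η (φ.zero z)) : f.fibreMap h = g.fibreMap h :=
  Submodule.linearMap_qext _ (LinearMap.ext fun x =>
    congrArg Submodule.Quotient.mk (Subtype.ext (hg ⟨x, x.2.1⟩).symm))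

variable (R : Type u) [CommRing R] [Algebra ℂ R]

/-- The isomorphism of fibres with coefficients in `R`. -/
def CenterEquiv.fibreEquivR (h₂ : ∀ b, φ.toAlgHom (ψ.toAlgHom b) = b) {E : FlatObj A}
    {F : FlatObj B} (g : CenterEquiv φ E F) (h : ∀ z, χ z = η (φ.zero z)) :
    (R ⊗[ℂ] Fibre χ E) ≃ₗ[R] (R ⊗[ℂ] Fibre η F) :=
  (g.fibreEquiv h₂ h).baseChange ℂ R _ _

lemma CenterEquiv.fibreEquivR_apply (h₂ : ∀ b, φ.toAlgHom (ψ.toAlgHom b) = b) {E : FlatObj A}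
    {F : FlatObj B} (g : CenterEquiv φ E F) (h : ∀ z, χ z = η (φ.zero z))
    (u : R ⊗[ℂ] Fibre χ E) : g.fibreEquivR R h₂ h u = (g.fibreMap h).baseChange R u := rfl

/-- Compatibility of the identifications of fibres with transported morphisms. -/
lemma CenterEquiv.fibreEquivR_fibreMap (h₂ : ∀ b, φ.toAlgHom (ψ.toAlgHom b) = b)
    (h : ∀ z, χ z = η (φ.zero z)) {E E' : FlatObj A} {F F' : FlatObj B} (g : CenterEquiv φ E F)
    (g' : CenterEquiv φ E' F') {f : E ⟶ E'} {f' : F ⟶ F'}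
    (hf : ∀ x : E.center, f'.lin (g.toEquiv x : F) = g'.toEquiv (FlatObj.Hom.center f x))
    (u : R ⊗[ℂ] Fibre χ E) :
    g'.fibreEquivR R h₂ h ((NCGeom.fibreMap χ f).baseChange R u) =
      (NCGeom.fibreMap η f').baseChange R (g.fibreEquivR R h₂ h u) := by
  have e : g'.fibreMap h ∘ₗ NCGeom.fibreMap χ f = NCGeom.fibreMap η f' ∘ₗ g.fibreMap h :=
    Submodule.linearMap_qext _ (LinearMap.ext fun x =>
      congrArg Submodule.Quotient.mk (Subtype.ext (hf ⟨x, x.2.1⟩).symm))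
  have e' := congrArg (fun t => t.baseChange R u) e
  simp only [LinearMap.baseChange_comp] at e'
  exact e'

/-- Compatibility of the identifications of fibres with transported tensor products. -/
lemma CenterEquiv.fibreEquivR_fibrePair (h₂ : ∀ b, φ.toAlgHom (ψ.toAlgHom b) = b)
    (h : ∀ z, χ z = η (φ.zero z)) {E E' G : FlatObj A} {F F' H : FlatObj B}
    (g : CenterEquiv φ E F) (g' : CenterEquiv φ E' F') (g'' : CenterEquiv φ G H)
    {b : Pairing E E' G} {c : Pairing F F' H}
    (hbc : ∀ (x : E.center) (y : E'.center),
      c.bil (g.toEquiv x) (g'.toEquiv y) = g''.toEquiv ⟨b.bil x y, b.mem_center x.2 y.2⟩)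
    (u : R ⊗[ℂ] Fibre χ E) (v : R ⊗[ℂ] Fibre χ E') :
    g''.fibreEquivR R h₂ h (b.fibrePair χ R u v) =
      c.fibrePair η R (g.fibreEquivR R h₂ h u) (g'.fibreEquivR R h₂ h v) := by
  have e : ∀ x y, g''.fibreMap h (b.fibreBil χ x y) =
      c.fibreBil η (g.fibreMap h x) (g'.fibreMap h y) := by
    intro x y
    obtain ⟨x, rfl⟩ := Submodule.Quotient.mk_surjective _ x
    obtain ⟨y, rfl⟩ := Submodule.Quotient.mk_surjective _ y
    exact congrArg Submodule.Quotient.mk (Subtype.ext (hbc ⟨x, x.2.1⟩ ⟨y, y.2.1⟩).symm)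
  change g''.fibreEquivR R h₂ h (b.fibrePairₗ χ R u v) = c.fibrePairₗ η R _ _
  induction u with
  | zero => simp
  | add x y hx hy => simp only [map_add, LinearMap.add_apply, hx, hy]
  | tmul r x =>
    induction v with
    | zero => simp
    | add x y hx hy => simp only [map_add, hx, hy]
    | tmul s y =>
      change g''.fibreEquivR R h₂ h (b.fibrePair χ R (r ⊗ₜ x) (s ⊗ₜ y)) =
        c.fibrePair η R (g.fibreEquivR R h₂ h (r ⊗ₜ x)) (g'.fibreEquivR R h₂ h (s ⊗ₜ y))
      rw [fibreEquivR_apply, fibreEquivR_apply, fibreEquivR_apply, Pairing.fibrePair_tmul,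
        LinearMap.baseChange_tmul, LinearMap.baseChange_tmul, LinearMap.baseChange_tmul,
        Pairing.fibrePair_tmul, e]

end Fibres

/-! ### The induced map of fundamental groups -/

section Pull

variable {φ : DGHom A.center B.center} {ψ : DGHom B.center A.center}
  {χ : A.center.gr 0 →ₐ[ℂ] ℂ} {η : B.center.gr 0 →ₐ[ℂ] ℂ}
  (h₁ : ∀ a, ψ.toAlgHom (φ.toAlgHom a) = a) (h₂ : ∀ b, φ.toAlgHom (ψ.toAlgHom b) = b)
  (h : ∀ z, χ z = η (φ.zero z))
  {R : Type u} [CommRing R] [Algebra ℂ R]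

/-- The pull back of an automorphism of a fibre along an isomorphism of graded centres. -/
def CenterEquiv.pull {E : FlatObj A} {F : FlatObj B} (g : CenterEquiv φ E F)
    (l : (R ⊗[ℂ] Fibre η F) ≃ₗ[R] (R ⊗[ℂ] Fibre η F)) :
    (R ⊗[ℂ] Fibre χ E) ≃ₗ[R] (R ⊗[ℂ] Fibre χ E) :=
  (g.fibreEquivR R h₂ h).trans (l.trans (g.fibreEquivR R h₂ h).symm)

lemma CenterEquiv.fibreEquivR_pull {E : FlatObj A} {F : FlatObj B} (g : CenterEquiv φ E F)
    (l : (R ⊗[ℂ] Fibre η F) ≃ₗ[R] (R ⊗[ℂ] Fibre η F)) (u : R ⊗[ℂ] Fibre χ E) :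
    g.fibreEquivR R h₂ h (g.pull h₂ h l u) = l (g.fibreEquivR R h₂ h u) :=
  LinearEquiv.apply_symm_apply _ _

/-- Pull backs of natural automorphisms are natural, for all choices of base changes. -/
lemma CenterEquiv.pull_fibreMap (l : tensorAut η R) {E E' : FlatObj A} {F F' : FlatObj B}
    (g : CenterEquiv φ E F) (g' : CenterEquiv φ E' F') (f : E ⟶ E') (u : R ⊗[ℂ] Fibre χ E) :
    g'.pull h₂ h (l.1 F') ((NCGeom.fibreMap χ f).baseChange R u) =
      (NCGeom.fibreMap χ f).baseChange R (g.pull h₂ h (l.1 F) u) := by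
  obtain ⟨f', hf⟩ := g.exists_hom h₂ g' f
  apply (g'.fibreEquivR R h₂ h).injective
  rw [fibreEquivR_pull, g.fibreEquivR_fibreMap R h₂ h g' hf, g.fibreEquivR_fibreMap R h₂ h g' hf,
    fibreEquivR_pull, l.2.1]

/-- The pull back does not depend on the base change. -/
lemma CenterEquiv.pull_eq_pull (l : tensorAut η R) {E : FlatObj A} {F F' : FlatObj B}
    (g : CenterEquiv φ E F) (g' : CenterEquiv φ E F') :
    g.pull h₂ h (l.1 F) = g'.pull h₂ h (l.1 F') := by
  have h1 : NCGeom.fibreMap χ (𝟙 E) = LinearMap.id :=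
    Submodule.linearMap_qext _ (LinearMap.ext fun x => rfl)
  refine LinearEquiv.ext fun u => ?_
  have h2 := g.pull_fibreMap h₂ h l g' (𝟙 E) u
  rw [h1, LinearMap.baseChange_id, LinearMap.id_apply, LinearMap.id_apply] at h2
  exact h2.symm

/-- The isomorphism `φ` itself, from the graded centre of the unit object of `A` to that of `B`. -/
def CenterEquiv.unit : CenterEquiv φ (FlatObj.unit A) (FlatObj.unit B) where
  toEquiv :=
    { toFun := fun x => φ.toAlgHom x
      invFun := fun y => ψ.toAlgHom y
      left_inv := h₁
      right_inv := h₂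
      map_add' := fun x y => map_add φ.toAlgHom x y
      map_smul' := fun c x => map_smul φ.toAlgHom c x }
  map_rmul z x := map_mul φ.toAlgHom (show A.center.carrier from x) z
  map_gr {_ x} hx := φ.map_gr (a := x) hx
  map_gr_symm {_ x} hx := ψ.map_gr (a := x) hx
  map_nabla x := φ.map_d x

variable (T : FlatObj A → FlatObj B) (G : ∀ E, CenterEquiv φ E (T E))

/-- The pull back of tensor automorphisms along a choice of base changes. -/
def pullAut (R : Type u) [CommRing R] [Algebra ℂ R] : tensorAut η R →* tensorAut χ R where
  toFun l := ⟨fun E => (G E).pull h₂ h (l.1 (T E)), by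
    refine ⟨fun E F f u => (G E).pull_fibreMap h₂ h l (G F) f u, fun E E' P b hb u v => ?_,
      fun u => ?_⟩
    · obtain ⟨c, hc, hbc⟩ := (G E).exists_pairing h₂ (G E') (G P) hb
      apply ((G P).fibreEquivR R h₂ h).injective
      rw [CenterEquiv.fibreEquivR_pull, (G E).fibreEquivR_fibrePair R h₂ h (G E') (G P) hbc,
        (G E).fibreEquivR_fibrePair R h₂ h (G E') (G P) hbc, CenterEquiv.fibreEquivR_pull,
        CenterEquiv.fibreEquivR_pull, l.2.2.1 _ _ _ c hc]
    · change (G (FlatObj.unit A)).pull h₂ h (l.1 (T (FlatObj.unit A))) u = u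
      rw [(G (FlatObj.unit A)).pull_eq_pull h₂ h l (CenterEquiv.unit h₁ h₂)]
      apply ((CenterEquiv.unit h₁ h₂).fibreEquivR R h₂ h).injective
      rw [CenterEquiv.fibreEquivR_pull, l.2.2.2]⟩
  map_one' := Subtype.ext (funext fun E => LinearEquiv.ext fun u =>
    ((G E).fibreEquivR R h₂ h).symm_apply_apply u)
  map_mul' l m := Subtype.ext (funext fun E => LinearEquiv.ext fun u => by
    apply ((G E).fibreEquivR R h₂ h).injective
    refine ((G E).fibreEquivR_pull h₂ h _ u).trans ?_
    refine Eq.trans ?_ ((G E).fibreEquivR_pull h₂ h (l.1 (T E)) _).symm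
    exact congrArg (l.1 (T E)) ((G E).fibreEquivR_pull h₂ h (m.1 (T E)) u).symm)

lemma fibreEquivR_pullAut (l : tensorAut η R) {E : FlatObj A} {F : FlatObj B}
    (g : CenterEquiv φ E F) (u : R ⊗[ℂ] Fibre χ E) :
    g.fibreEquivR R h₂ h ((pullAut h₁ h₂ h T G R l).1 E u) = l.1 F (g.fibreEquivR R h₂ h u) := by
  have h1 : (pullAut h₁ h₂ h T G R l).1 E = g.pull h₂ h (l.1 F) :=
    (G E).pull_eq_pull h₂ h l g
  rw [h1, g.fibreEquivR_pull h₂ h]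

/-- The pull back as a morphism of group functors. -/
def pullHom : autGroup η ⟶ autGroup χ where
  app R := GrpCat.ofHom (pullAut h₁ h₂ h T G R)
  naturality R S f := by
    refine GrpCat.hom_ext (MonoidHom.ext fun l => Subtype.ext (funext fun E =>
      LinearEquiv.toLinearMap_injective (ext_rTensor f.hom fun u => ?_)))
    apply ((G E).fibreEquivR S h₂ h).injective
    change (G E).fibreEquivR S h₂ h ((G E).pull h₂ h (extendEquiv f.hom (l.1 (T E))) _) =
      (G E).fibreEquivR S h₂ h (extendEquiv f.hom ((G E).pull h₂ h (l.1 (T E))) _)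
    rw [CenterEquiv.fibreEquivR_pull, extendEquiv_rTensor, CenterEquiv.fibreEquivR_apply,
      CenterEquiv.fibreEquivR_apply, baseChange_rTensor, baseChange_rTensor, extendEquiv_rTensor]
    exact congrArg _ ((G E).fibreEquivR_pull h₂ h (l.1 (T E)) u).symm

lemma isInduced_pullHom : IsInduced φ h (pullHom h₁ h₂ h T G) := by
  intro R l E F f u
  obtain ⟨g, hg⟩ := f.exists_centerEquiv h₁ h₂
  rw [f.fibreMap_eq g hg h]
  exact fibreEquivR_pullAut h₁ h₂ h T G l g u

include h₂ G in
/-- As every object has a base change, the induced map is unique. -/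
lemma IsInduced.unique {θ θ' : autGroup η ⟶ autGroup χ} (hθ : IsInduced φ h θ)
    (hθ' : IsInduced φ h θ') : θ = θ' := by
  refine NatTrans.ext (funext fun R => GrpCat.hom_ext (MonoidHom.ext fun l => Subtype.ext
    (funext fun E => LinearEquiv.ext fun u => ?_)))
  have e1 := hθ R l E _ ((G E).toBaseChange h₂) u
  have e2 := hθ' R l E _ ((G E).toBaseChange h₂) u
  have e3 : ((G E).toBaseChange h₂).fibreMap h = (G E).fibreMap h :=
    BaseChange.fibreMap_eq _ (G E) (fun _ => rfl) h
  rw [← e2, e3] at e1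
  exact ((G E).fibreEquivR R h₂ h).injective e1

/-- The pull backs along `φ` and along its inverse are inverse to each other. -/
lemma pullAut_bijective (T' : FlatObj B → FlatObj A) (G' : ∀ F, CenterEquiv ψ F (T' F)) :
    Function.Bijective (pullAut h₁ h₂ h T G R) := by
  have h' := char_symm (χ := χ) (η := η) h₂ h
  constructor
  · intro l m hlm
    refine Subtype.ext (funext fun F => LinearEquiv.ext fun v => ?_)
    let g : CenterEquiv φ (T' F) F := (G' F).symm h₁
    obtain ⟨u, rfl⟩ := (g.fibreEquivR R h₂ h).surjective v
    rw [← fibreEquivR_pullAut h₁ h₂ h T G l g, ← fibreEquivR_pullAut h₁ h₂ h T G m g, hlm]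
  · intro m
    refine ⟨pullAut h₂ h₁ h' T' G' R m, Subtype.ext (funext fun E => LinearEquiv.ext fun u => ?_)⟩
    apply ((G E).fibreEquivR R h₂ h).injective
    rw [fibreEquivR_pullAut]
    let g : CenterEquiv ψ (T E) E := (G E).symm h₂
    have hg : ∀ u, g.fibreEquivR R h₁ h' ((G E).fibreEquivR R h₂ h u) = u := fun u =>
      ((G E).fibreEquivR R h₂ h).symm_apply_apply u
    apply (g.fibreEquivR R h₁ h').injective
    rw [fibreEquivR_pullAut h₂ h₁ h' T' G' m g, hg, hg]

lemma isIso_pullHom (T' : FlatObj B → FlatObj A) (G' : ∀ F, CenterEquiv ψ F (T' F)) :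
    IsIso (pullHom h₁ h₂ h T G) := by
  have : ∀ R, IsIso ((pullHom h₁ h₂ h T G).app R) := fun R =>
    (ConcreteCategory.isIso_iff_bijective _).2 (pullAut_bijective h₁ h₂ h T G T' G')
  exact NatIso.isIso_of_isIso_app _

end Pull

end NCGeom

end

theorem mainTheorem7 (A B : NCGeom.DGAlg.{u}) (hAB : NCGeom.DGMoritaEquivalent A B)
    (CA : NCGeom.CStarCompletion A.center) (CB : NCGeom.CStarCompletion B.center)
    (hA : NCGeom.PropertyQ CA) (hB : NCGeom.PropertyQ CB) :
    ∃ φ : NCGeom.DGHom A.center B.center, φ.IsIso ∧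
      ∀ q : CB.Spec, ∃ (p : CA.Spec) (hpq : ∀ z, CA.char p z = CB.char q (φ.zero z)),
        (∃! θ : NCGeom.fundamentalGroup CB q ⟶ NCGeom.fundamentalGroup CA p,
          NCGeom.IsInduced φ hpq θ) ∧
        ∀ θ : NCGeom.fundamentalGroup CB q ⟶ NCGeom.fundamentalGroup CA p,
          NCGeom.IsInduced φ hpq θ → IsIso θ := by
  obtain ⟨φ, ψ, h₁, h₂⟩ := hAB.exists_isIso
  refine ⟨φ, ⟨ψ, h₁, h₂⟩, fun q => ?_⟩
  obtain ⟨p, hp⟩ := CA.exists_char_eq ((CB.char q).comp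
    { toFun := φ.zero
      map_one' := Subtype.ext (map_one φ.toAlgHom)
      map_mul' := fun x y => Subtype.ext (map_mul φ.toAlgHom (x : A.center) y)
      map_zero' := Subtype.ext (map_zero φ.toAlgHom)
      map_add' := fun x y => Subtype.ext (map_add φ.toAlgHom (x : A.center) y)
      commutes' := fun c => Subtype.ext (φ.toAlgHom.commutes c) })
  have hpq : ∀ z, CA.char p z = CB.char q (φ.zero z) := hp
  choose T G using fun E : NCGeom.FlatObj A => NCGeom.exists_centerEquiv h₁ h₂ E
  choose T' G' using fun F : NCGeom.FlatObj B => NCGeom.exists_centerEquiv h₂ h₁ F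
  have hind := NCGeom.isInduced_pullHom h₁ h₂ hpq T fun E => (G E).some
  have huniq := fun θ (hθ : NCGeom.IsInduced φ hpq θ) =>
    hθ.unique h₂ hpq T (fun E => (G E).some) hind
  refine ⟨p, hpq, ⟨_, hind, huniq⟩, fun θ hθ => ?_⟩
  rw [huniq θ hθ]
  exact NCGeom.isIso_pullHom h₁ h₂ hpq T _ T' fun F => (G' F).some
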